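/- Let $A$ be a separable, simple, unital $\mathrm{C}^*$-algebra. Then $A$ is pure if and only if $A$ is tracially pure. Here the following notation and definitions are used. Let $M_\infty(A)=\bigcup_n M_n(A)$ (with $M_n(A)\subset M_{n+1}(A)$ via $a\mapsto a\oplus 0$), and let $QT(A)$ be the set of normalized quasitraces on $A$, each extended (without renormalization) to $M_\infty(A)$. For $\tau\in QT(A)$ and a positive element $a\in M_\infty(A)$ put $d_\tau(a)=\lim_{n\to\infty}\tau(a^{1/n})$. For positive $a,b\in M_\infty(A)$ write $a\precsim b$ if there is a sequence $(x_j)$ in $M_\infty(A)$ with $x_j^*bx_j\to a$. The Cuntz semigroup $W(A)$ is the set of classes $\langle a\rangle$ of positive elements $a\in M_\infty(A)$ modulo the relation "$a\precsim b$ and $b\precsim a$", with the order induced by $\precsim$ and with addition $\langle a\rangle+\langle b\rangle=\langle a\oplus b\rangle$. Finally, $\mathrm{her}(a)$ is the norm closure of $aM_\infty(A)a$ (which, for $a\in M_n(A)$, is the closure of $aM_n(A)a$). $A$ is **pure** if 1. (comparison) for all nonzero positive contractions $a,b\in M_\infty(A)$: if $d_\tau(a)<d_\tau(b)$ for every $\tau\in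 QT(A)$, then $a\precsim b$; and 2. (almost divisible Cuntz semigroup) for every positive contraction $a\in M_\infty(A)$ and every integer $k\ge 1$ there is $x\in W(A)$ with $k\cdot x\le\langle a\rangle\le(k+1)\cdot x$. $A$ is **tracially pure** if 1. (strong tracial comparison) for all nonzero positive contractions $a,b\in M_\infty(A)$: if $d_\tau(a)<\tau(b)$ for every $\tau\in QT(A)$, then $a\precsim b$; and 2. (tracial almost divisibility) for every positive contraction $a\in M_\infty(A)$, every $\varepsilon>0$ and every integer $k\ge 1$ there is a completely positive contractive order zero (i.e. orthogonality preserving) map $\psi:M_k(\mathbb{C})\to\mathrm{her}(a)\subset M_\infty(A)$ with $\tau(\psi(\mathbf{1}_k))\ge\tau(a)-\varepsilon$ for every $\tau\in QT(A)$. -/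

import Mathlib

open scoped ComplexOrder Topology Matrix

namespace PureCStar

noncomputable section

/-- A unital C⋆-algebra is simple if it is nonzero and has no nontrivial closed two-sided ideals. -/
def IsSimple (A : Type*) [CStarAlgebra A] : Prop :=
  Nontrivial A ∧ ∀ I : TwoSidedIdeal A, IsClosed (I : Set A) → I = ⊥ ∨ I = ⊤

/-! ### The matrix algebras -/

/-- The C⋆-algebra `M_n(A)`, with Mathlib's C⋆-algebra structure on matrices. It is a type synonym,
so that all of its structure is found through the single instance `CStarAlgebra (Mat n A)`. -/
def Mat (n : ℕ) (A : Type*) : Type _ := CStarMatrix (Fin n) (Fin n) A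

section Blocks

/-- The block diagonal sum of two (possibly rectangular) matrices. -/
def blockSum {A : Type*} [Zero A] {n m n' m' : ℕ} (a : Matrix (Fin n) (Fin n') A)
    (b : Matrix (Fin m) (Fin m') A) : Matrix (Fin (n + m)) (Fin (n' + m')) A :=
  Matrix.reindex finSumFinEquiv finSumFinEquiv (Matrix.fromBlocks a 0 0 b)

lemma blockSum_mul {A : Type*} [CStarAlgebra A] {n m n' m' n'' m'' : ℕ}
    (a : Matrix (Fin n) (Fin n') A)
    (b : Matrix (Fin m) (Fin m') A) (c : Matrix (Fin n') (Fin n'') A)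
    (d : Matrix (Fin m') (Fin m'') A) :
    blockSum a b * blockSum c d = blockSum (a * c) (b * d) := by
  simp [blockSum, Matrix.submatrix_mul_equiv, Matrix.fromBlocks_multiply]

lemma blockSum_conjTranspose {A : Type*} [CStarAlgebra A] {n m n' m' : ℕ} (a : Matrix (Fin n) (Fin n') A)
    (b : Matrix (Fin m) (Fin m') A) : (blockSum a b)ᴴ = blockSum aᴴ bᴴ := by
  simp [blockSum, Matrix.fromBlocks_conjTranspose]

end Blocks

section Matrices

variable {A : Type*} [CStarAlgebra A] [PartialOrder A] [StarOrderedRing A]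

instance (n : ℕ) : CStarAlgebra (Mat n A) :=
  inferInstanceAs (CStarAlgebra (CStarMatrix (Fin n) (Fin n) A))

instance (n : ℕ) : PartialOrder (Mat n A) :=
  inferInstanceAs (PartialOrder (CStarMatrix (Fin n) (Fin n) A))

instance (n : ℕ) : StarOrderedRing (Mat n A) :=
  inferInstanceAs (StarOrderedRing (CStarMatrix (Fin n) (Fin n) A))

/-- The element of `M_n(A)` with given matrix of entries. -/
def Mat.of {A : Type*} {n : ℕ} : Matrix (Fin n) (Fin n) A ≃ Mat n A := Equiv.refl _

/-- The matrix of entries of an element of `M_n(A)`. -/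
def Mat.entries {A : Type*} {n : ℕ} (a : Mat n A) : Matrix (Fin n) (Fin n) A := Mat.of.symm a

lemma Mat.of_mul {n : ℕ} (a b : Matrix (Fin n) (Fin n) A) :
    Mat.of (a * b) = Mat.of a * Mat.of b := rfl

lemma Mat.of_conjTranspose {n : ℕ} (a : Matrix (Fin n) (Fin n) A) :
    Mat.of aᴴ = star (Mat.of a) := rfl

lemma Mat.of_zero {n : ℕ} : Mat.of (0 : Matrix (Fin n) (Fin n) A) = 0 := rfl

lemma Mat.entries_mul {n : ℕ} (a b : Mat n A) : (a * b).entries = a.entries * b.entries := rfl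

lemma Mat.entries_star {n : ℕ} (a : Mat n A) : (star a).entries = a.entriesᴴ := rfl

lemma Mat.continuous_of {n : ℕ} : Continuous (Mat.of : Matrix (Fin n) (Fin n) A → Mat n A) :=
  continuous_id (X := Matrix (Fin n) (Fin n) A)

lemma Mat.continuous_entries {n : ℕ} : Continuous (Mat.entries : Mat n A → _) :=
  continuous_id (X := Matrix (Fin n) (Fin n) A)

/-- The direct sum `a ⊕ b = diag(a, b)` in `M_{n+m}(A)` of `a` in `M_n(A)` and `b` in `M_m(A)`. -/
def Mat.directSum {A : Type*} [Zero A] {n m : ℕ} (a : Mat n A) (b : Mat m A) : Mat (n + m) A :=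
  Mat.of (blockSum a.entries b.entries)

lemma Mat.directSum_nonneg {n m : ℕ} {a : Mat n A} {b : Mat m A} (ha : 0 ≤ a) (hb : 0 ≤ b) :
    0 ≤ a.directSum b := by
  obtain ⟨c, rfl⟩ := CStarAlgebra.nonneg_iff_eq_star_mul_self.mp ha
  obtain ⟨d, rfl⟩ := CStarAlgebra.nonneg_iff_eq_star_mul_self.mp hb
  have h : (star c * c).directSum (star d * d) = star (c.directSum d) * c.directSum d := by
    simp only [Mat.directSum, Mat.entries_mul, Mat.entries_star]
    rw [← blockSum_mul, ← blockSum_conjTranspose]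
    rfl
  rw [h]
  exact star_mul_self_nonneg _

/-- The element `x⋆ b x` of `M_n(A)`, for `b` in `M_m(A)` and an `m × n` matrix `x` over `A`. -/
def Mat.conj {A : Type*} [CStarAlgebra A] {n m : ℕ} (x : Matrix (Fin m) (Fin n) A) (b : Mat m A) :
    Mat n A :=
  Mat.of (xᴴ * b.entries * x)

lemma Mat.conj_conj {A : Type*} [CStarAlgebra A] {n m l : ℕ} (x : Matrix (Fin m) (Fin n) A)
    (y : Matrix (Fin l) (Fin m) A) (b : Mat l A) :
    Mat.conj x (Mat.conj y b) = Mat.conj (y * x) b := by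
  change Mat.of (xᴴ * (yᴴ * b.entries * y) * x) = Mat.of ((y * x)ᴴ * b.entries * (y * x))
  simp only [Matrix.conjTranspose_mul, Matrix.mul_assoc]

lemma Mat.conj_directSum {A : Type*} [CStarAlgebra A] {n m n' m' : ℕ}
    (x : Matrix (Fin m) (Fin n) A) (y : Matrix (Fin m') (Fin n') A) (b : Mat m A) (c : Mat m' A) :
    Mat.conj (blockSum x y) (b.directSum c) = (Mat.conj x b).directSum (Mat.conj y c) := by
  change Mat.of ((blockSum x y)ᴴ * blockSum b.entries c.entries * blockSum x y) =
    Mat.of (blockSum (xᴴ * b.entries * x) (yᴴ * c.entries * y))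
  rw [blockSum_conjTranspose, blockSum_mul, blockSum_mul]

lemma Mat.continuous_conj {n m : ℕ} (x : Matrix (Fin m) (Fin n) A) :
    Continuous (Mat.conj x) :=
  Mat.continuous_of.comp ((continuous_const.matrix_mul Mat.continuous_entries).matrix_mul
    continuous_const)

lemma Mat.tendsto_directSum {n m : ℕ} {ι : Type*} {l : Filter ι} {f : ι → Mat n A}
    {g : ι → Mat m A} {a : Mat n A} {b : Mat m A} (hf : Filter.Tendsto f l (𝓝 a))
    (hg : Filter.Tendsto g l (𝓝 b)) :
    Filter.Tendsto (fun j => (f j).directSum (g j)) l (𝓝 (a.directSum b)) := by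
  have hc : Continuous fun p : Matrix (Fin n) (Fin n) A × Matrix (Fin m) (Fin m) A =>
      blockSum p.1 p.2 :=
    Continuous.matrix_submatrix (continuous_fst.matrix_fromBlocks continuous_const
      continuous_const continuous_snd) _ _
  have hf' := (Mat.continuous_entries.tendsto a).comp hf
  have hg' := (Mat.continuous_entries.tendsto b).comp hg
  have h1 := (hc.tendsto (a.entries, b.entries)).comp (hf'.prodMk_nhds hg')
  have h2 := (Mat.continuous_of.tendsto (blockSum a.entries b.entries)).comp h1
  exact h2

end Matrices

/-! ### Cuntz comparison and the Cuntz semigroup -/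

/-- Positive elements of `M_∞(A) = ⋃ₙ M_n(A)`, given by a matrix size and a positive matrix of
that size. (All the notions below are invariant under the corner embeddings
`M_n(A) ⊆ M_{n+1}(A)`, `a ↦ a ⊕ 0`.) -/
structure PosMat (A : Type*) [CStarAlgebra A] [PartialOrder A] [StarOrderedRing A] where
  /-- the matrix size -/
  size : ℕ
  /-- the positive matrix -/
  val : Mat size A
  nonneg : 0 ≤ val

section Cuntz

variable {A : Type*} [CStarAlgebra A] [PartialOrder A] [StarOrderedRing A]

/-- `a` is a nonzero positive contraction in `M_∞(A)`. -/
def PosMat.IsNonzeroContraction (a : PosMat A) : Prop := a.val ≠ 0 ∧ ‖a.val‖ ≤ 1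

/-- Cuntz subequivalence of positive elements of `M_∞(A)`: `a ≾ b` if there are (rectangular)
matrices `x₀, x₁, …` over `A` such that `xⱼ⋆ b xⱼ` converges to `a`. -/
def CuntzLE (a b : PosMat A) : Prop :=
  ∃ x : ℕ → Matrix (Fin b.size) (Fin a.size) A,
    Filter.Tendsto (fun j => Mat.conj (x j) b.val) Filter.atTop (𝓝 a.val)

lemma cuntzLE_iff_mem_closure {a b : PosMat A} :
    CuntzLE a b ↔ a.val ∈ closure (Set.range fun x => Mat.conj (n := a.size) x b.val) := by
  rw [mem_closure_iff_seq_limit]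
  constructor
  · rintro ⟨x, hx⟩
    exact ⟨_, fun j => ⟨x j, rfl⟩, hx⟩
  · rintro ⟨s, hs, hlim⟩
    choose x hx using hs
    refine ⟨x, ?_⟩
    simpa only [hx] using hlim

lemma CuntzLE.trans {a b c : PosMat A} (hab : CuntzLE a b) (hbc : CuntzLE b c) :
    CuntzLE a c := by
  rw [cuntzLE_iff_mem_closure] at *
  refine closure_minimal ?_ isClosed_closure hab
  rintro _ ⟨x, rfl⟩
  have := image_closure_subset_closure_image (Mat.continuous_conj x) (Set.mem_image_of_mem _ hbc)
  refine closure_mono ?_ this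
  rintro _ ⟨_, ⟨y, rfl⟩, rfl⟩
  exact ⟨y * x, (Mat.conj_conj x y c.val).symm⟩

/-- An element whose entries are obtained from those of `b` by a re-indexing is
Cuntz subequivalent to `b`. -/
lemma CuntzLE.of_reindex {a b : PosMat A} (e : Fin a.size → Fin b.size)
    (h : ∀ i j, a.val.entries i j = b.val.entries (e i) (e j)) : CuntzLE a b := by
  refine ⟨fun _ => (1 : Matrix (Fin b.size) (Fin b.size) A).submatrix id e, ?_⟩
  have : Mat.conj ((1 : Matrix (Fin b.size) (Fin b.size) A).submatrix id e) b.val = a.val := by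
    apply Mat.of.symm.injective
    ext i j
    refine Eq.trans ?_ (h i j).symm
    change ((((1 : Matrix (Fin b.size) (Fin b.size) A).submatrix id e)ᴴ * b.val.entries) *
      ((1 : Matrix (Fin b.size) (Fin b.size) A).submatrix id e)) i j = _
    simp [Matrix.mul_apply, Matrix.one_apply, Finset.sum_ite_eq]
  simp only [this]
  exact tendsto_const_nhds

instance : Preorder (PosMat A) where
  le := CuntzLE
  le_refl a := CuntzLE.of_reindex id fun _ _ => rfl
  le_trans _ _ _ := CuntzLE.trans

/-- The direct sum of positive elements of `M_∞(A)`. -/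
instance : Add (PosMat A) where
  add a b := ⟨a.size + b.size, a.val.directSum b.val, Mat.directSum_nonneg a.nonneg b.nonneg⟩

instance : Zero (PosMat A) where
  zero := ⟨0, 0, le_rfl⟩

lemma PosMat.add_le_add {a b c d : PosMat A} (h : a ≤ c) (h' : b ≤ d) : a + b ≤ c + d := by
  obtain ⟨x, hx⟩ : CuntzLE a c := h
  obtain ⟨y, hy⟩ : CuntzLE b d := h'
  have hlim : Filter.Tendsto
      (fun j => Mat.conj (blockSum (x j) (y j)) (c.val.directSum d.val))
      Filter.atTop (𝓝 (a.val.directSum b.val)) := by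
    simp only [Mat.conj_directSum]
    exact Mat.tendsto_directSum hx hy
  have : CuntzLE (a + b) (c + d) := Exists.intro (fun j => blockSum (x j) (y j)) hlim
  exact this

lemma PosMat.entries_add (a b : PosMat A) (i j : Fin a.size ⊕ Fin b.size) :
    (a + b).val.entries (finSumFinEquiv i) (finSumFinEquiv j) =
      Matrix.fromBlocks a.val.entries 0 0 b.val.entries i j := by
  change blockSum a.val.entries b.val.entries _ _ = _
  simp [blockSum]

/-- Comparison of direct sums through a map of index sets. -/
lemma PosMat.add_le_of_reindex {a b c : PosMat A} (e : Fin a.size ⊕ Fin b.size → Fin c.size)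
    (h : ∀ i j, Matrix.fromBlocks a.val.entries 0 0 b.val.entries i j =
      c.val.entries (e i) (e j)) : a + b ≤ c := by
  refine CuntzLE.of_reindex (a := a + b) (fun i => e (finSumFinEquiv.symm i)) fun i j => ?_
  obtain ⟨i, rfl⟩ := finSumFinEquiv.surjective i
  obtain ⟨j, rfl⟩ := finSumFinEquiv.surjective j
  rw [PosMat.entries_add, h]
  simp

lemma PosMat.add_comm_le (a b : PosMat A) : a + b ≤ b + a := by
  refine PosMat.add_le_of_reindex (fun i => finSumFinEquiv i.swap) fun i j => ?_
  rw [PosMat.entries_add]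
  rcases i with i | i <;> rcases j with j | j <;> rfl

lemma PosMat.le_add_right (a b : PosMat A) : a ≤ a + b := by
  refine CuntzLE.of_reindex (b := a + b) (fun i => finSumFinEquiv (Sum.inl i)) fun i j => ?_
  rw [PosMat.entries_add]
  rfl

lemma PosMat.add_zero_le (a : PosMat A) : a + 0 ≤ a := by
  refine PosMat.add_le_of_reindex (b := 0) (Sum.elim id (fun i => Fin.elim0 i)) fun i j => ?_
  rcases i with i | i
  · rcases j with j | j
    · rfl
    · exact Fin.elim0 j
  · exact Fin.elim0 i

lemma PosMat.add_assoc_le (a b c : PosMat A) : a + b + c ≤ a + (b + c) := by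
  refine PosMat.add_le_of_reindex (a := a + b) (c := a + (b + c))
    (Sum.elim (fun i => finSumFinEquiv (m := a.size) (n := (b + c).size)
      ((finSumFinEquiv (m := a.size) (n := b.size)).symm i |>.map id
        fun k => finSumFinEquiv (m := b.size) (n := c.size) (Sum.inl k)))
      (fun k => finSumFinEquiv (m := a.size) (n := (b + c).size)
        (Sum.inr (finSumFinEquiv (m := b.size) (n := c.size) (Sum.inr k))))) fun i j => ?_
  have hi : ∀ i : Fin (a + b).size, ∃ k : Fin a.size ⊕ Fin b.size, finSumFinEquiv k = i :=
    finSumFinEquiv.surjective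
  rcases i with i | i <;> rcases j with j | j
  all_goals try obtain ⟨i, rfl⟩ := hi i
  all_goals try obtain ⟨j, rfl⟩ := hi j
  all_goals try rcases i with i | i
  all_goals try rcases j with j | j
  all_goals
    simp only [Sum.elim_inl, Sum.elim_inr, Equiv.symm_apply_apply, Sum.map_inl, Sum.map_inr, id,
      PosMat.entries_add, Matrix.fromBlocks_apply₁₁, Matrix.fromBlocks_apply₁₂,
      Matrix.fromBlocks_apply₂₁, Matrix.fromBlocks_apply₂₂, Matrix.zero_apply]

variable (A) in
/-- The Cuntz semigroup `W(A)`: the classes of positive elements of `M_∞(A)` for the relation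
`a ≾ b ∧ b ≾ a`, with the order induced by `≾` and the addition induced by `⊕`. -/
def CuntzSemigroup : Type _ := Antisymmetrization (PosMat A) (· ≤ ·)

instance : PartialOrder (CuntzSemigroup A) :=
  inferInstanceAs (PartialOrder (Antisymmetrization (PosMat A) (· ≤ ·)))

/-- The class `⟨a⟩` in `W(A)` of a positive element `a` of `M_∞(A)`. -/
def cuntzClass (a : PosMat A) : CuntzSemigroup A := toAntisymmetrization (· ≤ ·) a

lemma cuntzClass_le_iff {a b : PosMat A} : cuntzClass a ≤ cuntzClass b ↔ CuntzLE a b := Iff.rfl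

lemma cuntzClass_surjective : Function.Surjective (cuntzClass (A := A)) := Quotient.mk_surjective

instance : Add (CuntzSemigroup A) where
  add := Quotient.map₂ (· + ·) fun _ _ h _ _ h' =>
    ⟨PosMat.add_le_add h.1 h'.1, PosMat.add_le_add h.2 h'.2⟩

instance : Zero (CuntzSemigroup A) where
  zero := cuntzClass 0

instance : AddCommMonoid (CuntzSemigroup A) where
  nsmul := nsmulRec
  add_comm := by
    rintro ⟨a⟩ ⟨b⟩
    exact Quotient.sound ⟨PosMat.add_comm_le a b, PosMat.add_comm_le b a⟩
  add_zero := by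
    rintro ⟨a⟩
    exact Quotient.sound ⟨PosMat.add_zero_le a, PosMat.le_add_right a 0⟩
  zero_add := by
    rintro ⟨a⟩
    exact Quotient.sound ⟨(PosMat.add_comm_le 0 a).trans (PosMat.add_zero_le a),
      (PosMat.le_add_right a 0).trans (PosMat.add_comm_le a 0)⟩
  add_assoc := by
    rintro ⟨a⟩ ⟨b⟩ ⟨c⟩
    refine Quotient.sound ⟨PosMat.add_assoc_le a b c, ?_⟩
    calc a + (b + c) ≤ b + c + a := PosMat.add_comm_le _ _
      _ ≤ b + (c + a) := PosMat.add_assoc_le _ _ _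
      _ ≤ c + a + b := PosMat.add_comm_le _ _
      _ ≤ c + (a + b) := PosMat.add_assoc_le _ _ _
      _ ≤ a + b + c := PosMat.add_comm_le _ _

lemma cuntzClass_add (a b : PosMat A) : cuntzClass (a + b) = cuntzClass a + cuntzClass b := rfl

end Cuntz

/-! ### Quasitraces and dimension functions -/

/-- `τ : B → ℂ` is a (`1`-)quasitrace on the C⋆-algebra `B`. -/
structure IsQuasitrace {B : Type*} [CStarAlgebra B] (τ : B → ℂ) : Prop where
  nonneg : ∀ x, 0 ≤ τ (star x * x)
  comm : ∀ x, τ (star x * x) = τ (x * star x)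
  re_add_im : ∀ x y, IsSelfAdjoint x → IsSelfAdjoint y →
    τ (x + Complex.I • y) = τ x + Complex.I * τ y
  linear_on_comm : ∀ C : NonUnitalStarSubalgebra ℂ B, IsClosed (C : Set B) →
    (∀ x ∈ C, ∀ y ∈ C, x * y = y * x) →
    ∀ (c : ℂ), ∀ x ∈ C, ∀ y ∈ C, τ (c • x + y) = c * τ x + τ y

section Quasitraces

variable (A : Type*) [CStarAlgebra A] [PartialOrder A] [StarOrderedRing A]

/-- The space `QT(A)` of normalized quasitraces on `A` (quasitraces which extend to all the
matrix algebras over `A`), each given together with its extension `τ` to `M_∞(A) = ⋃ₙ M_n(A)`.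
The value on `A` itself is the one on `1 × 1` matrices. -/
structure NormalizedQuasitrace where
  /-- the quasitrace on `M_n(A)` -/
  toFun : ∀ n : ℕ, Mat n A → ℂ
  isQuasitrace : ∀ n, IsQuasitrace (toFun n)
  /-- compatibility with the corner embeddings -/
  corner : ∀ (n : ℕ) (a : Mat n A), toFun (n + 1) (a.directSum (0 : Mat 1 A)) = toFun n a
  normalized : toFun 1 1 = 1

variable {A}

/-- The real number `τ(a)`, for a positive element `a` of `M_∞(A)`. -/
def NormalizedQuasitrace.eval (τ : NormalizedQuasitrace A) (a : PosMat A) : ℝ :=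
  (τ.toFun a.size a.val).re

/-- The dimension function `d_τ(a) = lim_{n → ∞} τ(a^{1/n})`. -/
def NormalizedQuasitrace.dim (τ : NormalizedQuasitrace A) (a : PosMat A) : ℝ :=
  Filter.limUnder Filter.atTop fun n : ℕ => (τ.toFun a.size (a.val ^ (1 / (n + 1 : ℝ)))).re

end Quasitraces

/-! ### Comparison and divisibility -/

section Pure

variable (A : Type*) [CStarAlgebra A] [PartialOrder A] [StarOrderedRing A]

/-- `m`-comparison of positive elements. -/
def HasComparison (m : ℕ) : Prop :=
  ∀ (a : PosMat A) (b : Fin (m + 1) → PosMat A),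
    a.IsNonzeroContraction → (∀ i, (b i).IsNonzeroContraction) →
    (∀ τ : NormalizedQuasitrace A, ∀ i, τ.dim a < τ.dim (b i)) →
    cuntzClass a ≤ ∑ i, cuntzClass (b i)

/-- Strong tracial `m`-comparison of positive elements. -/
def HasStrongTracialComparison (m : ℕ) : Prop :=
  ∀ a b : PosMat A, a.IsNonzeroContraction → b.IsNonzeroContraction →
    (∀ τ : NormalizedQuasitrace A, τ.dim a < 1 / (m + 1 : ℝ) * τ.eval b) →
    CuntzLE a b

/-- `A` has `m`-almost divisible Cuntz semigroup. -/
def IsAlmostDivisible (m : ℕ) : Prop :=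
  ∀ a : PosMat A, ‖a.val‖ ≤ 1 → ∀ k : ℕ, k ≠ 0 →
    ∃ x : CuntzSemigroup A, k • x ≤ cuntzClass a ∧ cuntzClass a ≤ ((k + 1) * (m + 1)) • x

/-- The hereditary subalgebra `her(a)`, the norm closure of `aBa`. -/
def her {B : Type*} [CStarAlgebra B] (a : B) : Set B := closure (Set.range fun y => a * y * a)

/-- A completely positive map is contractive and has order zero (preserves orthogonality). -/
def IsContractiveOrderZero {B C : Type*} [CStarAlgebra B] [PartialOrder B] [StarOrderedRing B]
    [CStarAlgebra C] [PartialOrder C] [StarOrderedRing C] (ψ : CompletelyPositiveMap B C) : Prop :=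
  (∀ x, ‖ψ x‖ ≤ ‖x‖) ∧ ∀ x y : B, 0 ≤ x → 0 ≤ y → x * y = 0 → ψ x * ψ y = 0

/-- `A` is tracially `m`-almost divisible. -/
def IsTraciallyAlmostDivisible (m : ℕ) : Prop :=
  ∀ a : PosMat A, ‖a.val‖ ≤ 1 → ∀ ε : ℝ, 0 < ε → ∀ k : ℕ, k ≠ 0 →
    ∃ ψ : CompletelyPositiveMap (Mat k ℂ) (Mat a.size A),
      IsContractiveOrderZero ψ ∧ (∀ x, ψ x ∈ her a.val) ∧
      ∀ τ : NormalizedQuasitrace A,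
        (τ.toFun a.size (ψ 1)).re ≥ 1 / (m + 1 : ℝ) * τ.eval a - ε

/-- `(m, m')`-pureness. -/
def IsPureOfType (m m' : ℕ) : Prop := HasComparison A m ∧ IsAlmostDivisible A m'

/-- `A` is pure: strict comparison and almost divisible Cuntz semigroup. -/
def IsPure : Prop := IsPureOfType A 0 0

/-- Tracial `(m, m')`-pureness. -/
def IsTraciallyPureOfType (m m' : ℕ) : Prop :=
  HasStrongTracialComparison A m ∧ IsTraciallyAlmostDivisible A m'

/-- `A` is tracially pure: strong tracial comparison and tracial almost divisibility. -/
def IsTraciallyPure : Prop := IsTraciallyPureOfType A 0 0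

end Pure

end

end PureCStar

/-!
Fix a quasitrace `τ` and let `g_δ` be a continuous function which is `0` on `(-∞, δ/2]` and `1` on
`[δ, ∞)`. The dimension function is written as the *rank* `sup_δ τ(g_δ(a))`, which agrees with
`d_τ(a)` on contractions (`NormalizedQuasitrace.dim_eq_rank`). The exact form of Cuntz comparison
`CuntzLE.exists_factor` (if `a ≾ b`, then `g_ε(a) = w⋆ w` with `g_δ(b) w = w`) together with the
trace property shows that the rank is monotone, and it is additive on direct sums, so that it
defines a functional `NormalizedQuasitrace.rankHom` on the Cuntz semigroup.

*Comparison.* Since `τ(b) ≤ d_τ(b)` for contractions, comparison implies strong tracial comparison.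
Conversely, let `d_τ(a) < d_τ(b)` for all `τ`. Then `τ(g_ε(a)) < sup_δ τ(g_δ(b))` for all `τ`, and
as the space of quasitraces is compact, a single `δ` serves for all `τ`
(`NormalizedQuasitrace.exists_cut_lt_cut`). Strong tracial comparison applied to `(a - ε)₊` and
`g_δ(b)` gives `(a - ε)₊ ≾ g_δ(b) ≾ b`, and `ε > 0` is arbitrary.

*From almost divisibility to tracial almost divisibility*
(`IsAlmostDivisible.isTraciallyAlmostDivisible`). Let `K x ≤ ⟨a⟩ ≤ (K + 1) x` for a large multiple
`K = k N` of `k`, with `x = ⟨e⟩`. The exact form of comparison turns `K ⟨e⟩ ≤ ⟨a⟩` into a system of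
`K` elements of `her(a)` with common source and orthogonal ranges. Up to an error these carry the
trace of `K` copies of `e`, and, arranged as a `k × N` array, they define a map of order zero on
`M_k(ℂ)`.

*From tracial almost divisibility to almost divisibility* (`IsSimple.isAlmostDivisible`), given
strong tracial comparison. Tracial divisibility controls `τ(a)` only, whereas the rank of `a` is
needed. The element `a` is therefore cut into bands by functions with disjoint supports accumulating
at `0` (`band`). The maps of order zero into the bands have orthogonal ranges, and the images of the
matrix unit `e_11` under these infinitely many maps, with weights `2⁻ˡ`, add up to a single element
`z` with `K ⟨z⟩ ≤ ⟨a⟩` (`exists_of_orthogonal_orderZero`). In place of the structure theorem for maps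
`ψ` of order zero, only two relations are used: with `h = ψ(e_ii)` and `t = ψ(e_ij)` one has
`(h t)(h t)⋆ = h⁴` and `(h t)⋆ (h t) ≤ ψ(e_jj)`. The bands leave gaps, and these are distributed over `M` different choices
of bands in such a way that all gaps together have trace at most that of one copy of the support of
`a`. Adding up the resulting elements `z` gives `x` in `W(A)` with `K x ≤ M ⟨a⟩` whose rank is at
least about `(M - 1) / K` times that of `a` (`IsTraciallyAlmostDivisible.exists_rank`). For
`M = k + 3` and `K = k M + 1` this yields strict inequalities of ranks, to which comparison applies.
Simplicity enters only here: it provides a lower bound for the rank of `a` that is uniform in `τ`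
(`IsSimple.exists_le_rank`).
-/


set_option linter.unusedSectionVars false
namespace PureCStar

/-! ### Cut-off functions -/

/-- The piecewise linear function which vanishes on `(-∞, δ/2]` and is `1` on `[δ, ∞)`. -/
noncomputable def ramp (δ t : ℝ) : ℝ := max 0 (min 1 (2 * t / δ - 1))

section Ramp

@[fun_prop]
lemma continuous_ramp (δ : ℝ) : Continuous (ramp δ) := by
  unfold ramp; fun_prop

lemma ramp_nonneg (δ t : ℝ) : 0 ≤ ramp δ t := le_max_left _ _

lemma ramp_le_one (δ t : ℝ) : ramp δ t ≤ 1 := max_le zero_le_one (min_le_left _ _)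

lemma ramp_eq_one {δ t : ℝ} (hδ : 0 < δ) (h : δ ≤ t) : ramp δ t = 1 := by
  have : 1 ≤ 2 * t / δ - 1 := by
    rw [le_sub_iff_add_le, le_div_iff₀ hδ]; linarith
  rw [ramp, min_eq_left this, max_eq_right zero_le_one]

lemma ramp_eq_zero {δ t : ℝ} (hδ : 0 < δ) (h : t ≤ δ / 2) : ramp δ t = 0 := by
  have : 2 * t / δ - 1 ≤ 0 := by
    rw [sub_nonpos, div_le_one hδ]; linarith
  rw [ramp, max_eq_left ((min_le_right _ _).trans this)]

lemma half_lt_of_ramp_ne_zero {δ t : ℝ} (hδ : 0 < δ) (h : ramp δ t ≠ 0) : δ / 2 < t := by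
  by_contra! h'
  exact h (ramp_eq_zero hδ h')

lemma ramp_le_ramp {δ δ' t : ℝ} (ht : 0 ≤ t) (hδ : 0 < δ') (h : δ' ≤ δ) :
    ramp δ t ≤ ramp δ' t := by
  unfold ramp
  gcongr

lemma le_ramp_add {δ t : ℝ} (hδ : 0 < δ) (ht : t ≤ 1) : t ≤ ramp δ t + δ := by
  rcases le_total δ t with h | h
  · rw [ramp_eq_one hδ h]; linarith
  · linarith [ramp_nonneg δ t]

end Ramp

section Calculus

variable {B : Type*} [CStarAlgebra B] [PartialOrder B] [StarOrderedRing B]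

lemma spectrum_le_norm {a : B} {t : ℝ} (ht : t ∈ spectrum ℝ a) : t ≤ ‖a‖ := by
  have : Nontrivial B := by
    by_contra h
    rw [not_nontrivial_iff_subsingleton] at h
    simp [spectrum.of_subsingleton] at ht
  exact (Real.le_norm_self t).trans (spectrum.norm_le_norm_of_mem ht)

lemma cfc_mul_self_of_eqOn_one (a : B) {f g : ℝ → ℝ} (hf : Continuous f) (hg : Continuous g)
    (h : ∀ t, g t ≠ 0 → f t = 1) :
    cfc f a * cfc g a = cfc g a := by
  rw [← cfc_mul f g a]
  congr 1
  ext t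
  by_cases h0 : g t = 0
  · simp [h0]
  · simp [h t h0]

lemma cfc_ramp_nonneg (a : B) (δ : ℝ) : 0 ≤ cfc (ramp δ) a :=
  cfc_nonneg fun _ _ => ramp_nonneg _ _

lemma cfc_ramp_le_one (a : B) (δ : ℝ) : cfc (ramp δ) a ≤ 1 :=
  cfc_le_one _ _ fun _ _ => ramp_le_one _ _

lemma norm_cfc_ramp_le_one (a : B) (δ : ℝ) : ‖cfc (ramp δ) a‖ ≤ 1 :=
  norm_cfc_le zero_le_one fun t _ => by
    rw [Real.norm_of_nonneg (ramp_nonneg _ _)]; exact ramp_le_one _ _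

lemma norm_cfc_sub_self_le {a : B} (ha : IsSelfAdjoint a) {f : ℝ → ℝ} (hf : Continuous f) {c : ℝ}
    (hc : 0 ≤ c) (h : ∀ t ∈ spectrum ℝ a, |f t - t| ≤ c) : ‖cfc f a - a‖ ≤ c := by
  have : cfc f a - a = cfc (fun t => f t - t) a := by
    rw [cfc_sub f (fun t => t) a, cfc_id' ℝ a]
  rw [this]
  exact norm_cfc_le hc h

end Calculus

/-! ### Quasitraces on commuting elements -/

section Quasitrace

variable {B : Type*} [CStarAlgebra B] [PartialOrder B] [StarOrderedRing B] {τ : B → ℂ}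

/-- Quasitraces are linear on commuting self-adjoint elements, which generate a commutative closed
subalgebra. -/
lemma IsQuasitrace.map_smul_add (hτ : IsQuasitrace τ) {x y : B} (hx : IsSelfAdjoint x)
    (hy : IsSelfAdjoint y) (hxy : Commute x y) (c : ℂ) : τ (c • x + y) = c * τ x + τ y := by
  have hcomm : ∀ a ∈ ({x, y} : Set B), ∀ b ∈ ({x, y} : Set B), a * b = b * a := by
    rintro a (rfl | rfl) b (rfl | rfl)
    · rfl
    · exact hxy
    · exact hxy.symm
    · rfl
  have hcomm' : ∀ a ∈ ({x, y} : Set B), ∀ b ∈ ({x, y} : Set B), a * star b = star b * a := by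
    rintro a ha b (rfl | rfl)
    · rw [hx.star_eq]; exact hcomm a ha _ (by simp)
    · rw [hy.star_eq]; exact hcomm a ha _ (by simp)
  have hadj : IsMulCommutative (NonUnitalStarAlgebra.adjoin ℂ ({x, y} : Set B)) :=
    NonUnitalStarAlgebra.isMulCommutative_adjoin ℂ hcomm hcomm'
  let S := (NonUnitalStarAlgebra.adjoin ℂ ({x, y} : Set B)).topologicalClosure
  have hS : ∀ a ∈ S, ∀ b ∈ S, a * b = b * a := by
    intro a ha b hb
    let _ := (NonUnitalStarAlgebra.adjoin ℂ ({x, y} : Set B)).nonUnitalCommRingTopologicalClosure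
      hadj.is_comm.comm
    exact congrArg Subtype.val (mul_comm (⟨a, ha⟩ : S) ⟨b, hb⟩)
  have hsub : ({x, y} : Set B) ⊆ S :=
    (NonUnitalStarAlgebra.subset_adjoin ℂ _).trans
      (NonUnitalStarSubalgebra.le_topologicalClosure _)
  exact hτ.linear_on_comm S (NonUnitalStarSubalgebra.isClosed_topologicalClosure _) hS c x
    (hsub (by simp)) y (hsub (by simp))

lemma IsQuasitrace.map_add (hτ : IsQuasitrace τ) {x y : B} (hx : IsSelfAdjoint x)
    (hy : IsSelfAdjoint y) (hxy : Commute x y) : τ (x + y) = τ x + τ y := by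
  simpa using hτ.map_smul_add hx hy hxy 1

lemma IsQuasitrace.map_zero (hτ : IsQuasitrace τ) : τ 0 = 0 := by
  simpa using hτ.map_add (IsSelfAdjoint.zero B) (IsSelfAdjoint.zero B) (Commute.refl 0)

lemma IsQuasitrace.map_smul (hτ : IsQuasitrace τ) {x : B} (hx : IsSelfAdjoint x) (c : ℂ) :
    τ (c • x) = c * τ x := by
  simpa [hτ.map_zero] using hτ.map_smul_add hx (IsSelfAdjoint.zero B) (Commute.zero_right x) c

lemma IsQuasitrace.re_add (hτ : IsQuasitrace τ) {x y : B} (hx : IsSelfAdjoint x)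
    (hy : IsSelfAdjoint y) (hxy : Commute x y) : (τ (x + y)).re = (τ x).re + (τ y).re := by
  rw [hτ.map_add hx hy hxy, Complex.add_re]

lemma IsQuasitrace.re_smul (hτ : IsQuasitrace τ) {x : B} (hx : IsSelfAdjoint x) (c : ℝ) :
    (τ (c • x)).re = c * (τ x).re := by
  have := hτ.map_smul hx (c : ℂ)
  rw [Complex.coe_smul] at this
  rw [this, Complex.re_ofReal_mul]

lemma IsQuasitrace.map_nonneg (hτ : IsQuasitrace τ) {x : B} (hx : 0 ≤ x) : 0 ≤ τ x := by
  obtain ⟨c, rfl⟩ := CStarAlgebra.nonneg_iff_eq_star_mul_self.mp hx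
  exact hτ.nonneg c

lemma IsQuasitrace.re_nonneg (hτ : IsQuasitrace τ) {x : B} (hx : 0 ≤ x) : 0 ≤ (τ x).re :=
  (Complex.nonneg_iff.mp (hτ.map_nonneg hx)).1

lemma IsQuasitrace.re_mono (hτ : IsQuasitrace τ) {x y : B} (hx : IsSelfAdjoint x)
    (hy : IsSelfAdjoint y) (hxy : Commute x y) (h : x ≤ y) : (τ x).re ≤ (τ y).re := by
  have h1 := hτ.re_add hx (hy.sub hx) (hxy.sub_right (Commute.refl x))
  have h2 := hτ.re_nonneg (sub_nonneg.mpr h)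
  rw [add_sub_cancel] at h1
  linarith

lemma IsQuasitrace.re_cfc_add (hτ : IsQuasitrace τ) (a : B) {f g : ℝ → ℝ} (hf : Continuous f)
    (hg : Continuous g) :
    (τ (cfc (fun t => f t + g t) a)).re = (τ (cfc f a)).re + (τ (cfc g a)).re := by
  rw [cfc_add a f g]
  exact hτ.re_add (cfc_predicate f a) (cfc_predicate g a) (cfc_commute_cfc f g a)

lemma IsQuasitrace.re_cfc_sub (hτ : IsQuasitrace τ) (a : B) {f g : ℝ → ℝ} (hf : Continuous f)
    (hg : Continuous g) :
    (τ (cfc (fun t => f t - g t) a)).re = (τ (cfc f a)).re - (τ (cfc g a)).re := by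
  have := hτ.re_cfc_add a (f := fun t => f t - g t) (by fun_prop) hg
  simp only [sub_add_cancel] at this
  linarith

lemma IsQuasitrace.re_cfc_mono (hτ : IsQuasitrace τ) {a : B} {f g : ℝ → ℝ} (hf : Continuous f)
    (hg : Continuous g) (h : ∀ t ∈ spectrum ℝ a, f t ≤ g t) :
    (τ (cfc f a)).re ≤ (τ (cfc g a)).re :=
  hτ.re_mono (cfc_predicate f a) (cfc_predicate g a) (cfc_commute_cfc f g a) (cfc_mono h)

lemma IsQuasitrace.re_cfc_const_mul (hτ : IsQuasitrace τ) (a : B) {f : ℝ → ℝ} (hf : Continuous f)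
    (c : ℝ) : (τ (cfc (fun t => c * f t) a)).re = c * (τ (cfc f a)).re := by
  rw [cfc_const_mul c f a]
  exact hτ.re_smul (cfc_predicate f a) c

lemma IsQuasitrace.re_cfc_add_const (hτ : IsQuasitrace τ) {a : B} (ha : IsSelfAdjoint a)
    {f : ℝ → ℝ} (hf : Continuous f) (c : ℝ) :
    (τ (cfc (fun t => f t + c) a)).re = (τ (cfc f a)).re + c * (τ 1).re := by
  rw [hτ.re_cfc_add a hf continuous_const, cfc_const c a, Algebra.algebraMap_eq_smul_one,
    hτ.re_smul (IsSelfAdjoint.one B)]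

lemma IsQuasitrace.re_le_of_le_smul_one (hτ : IsQuasitrace τ) {a : B} (ha : IsSelfAdjoint a) {c : ℝ}
    (h : a ≤ c • (1 : B)) : (τ a).re ≤ c * (τ 1).re := by
  rw [← hτ.re_smul (IsSelfAdjoint.one B)]
  exact hτ.re_mono ha ((IsSelfAdjoint.all c).smul (IsSelfAdjoint.one B))
    ((Commute.one_right a).smul_right c) h

lemma IsQuasitrace.re_le_norm (hτ : IsQuasitrace τ) {a : B} (ha : IsSelfAdjoint a) :
    (τ a).re ≤ ‖a‖ * (τ 1).re := by
  apply hτ.re_le_of_le_smul_one ha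
  rw [← Algebra.algebraMap_eq_smul_one]
  exact ha.le_algebraMap_norm_self

lemma IsQuasitrace.im_eq_zero (hτ : IsQuasitrace τ) {a : B} (ha : IsSelfAdjoint a) :
    (τ a).im = 0 := by
  have h1 : 0 ≤ algebraMap ℝ B ‖a‖ - a := sub_nonneg.mpr ha.le_algebraMap_norm_self
  have h2 : 0 ≤ algebraMap ℝ B ‖a‖ := by
    rw [Algebra.algebraMap_eq_smul_one]; exact smul_nonneg (norm_nonneg _) zero_le_one
  have h3 := hτ.map_add (IsSelfAdjoint.of_nonneg h1) ha (by
    apply Commute.sub_left _ (Commute.refl a)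
    exact Algebra.commutes _ _)
  rw [sub_add_cancel] at h3
  have h4 := (Complex.nonneg_iff.mp (hτ.map_nonneg h1)).2
  have h5 := (Complex.nonneg_iff.mp (hτ.map_nonneg h2)).2
  have h6 := congrArg Complex.im h3
  rw [Complex.add_im] at h6
  linarith

lemma IsQuasitrace.norm_le_of_isSelfAdjoint (hτ : IsQuasitrace τ) {a : B} (ha : IsSelfAdjoint a) :
    ‖τ a‖ ≤ ‖a‖ * (τ 1).re := by
  have h1 := hτ.re_le_norm ha
  have h2 := hτ.re_le_norm ha.neg
  have h3 : (τ (-a)).re = - (τ a).re := by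
    have := hτ.re_smul ha (-1)
    simpa using this
  rw [norm_neg, h3] at h2
  have : τ a = ((τ a).re : ℂ) := Complex.ext rfl (by simp [hτ.im_eq_zero ha])
  rw [this, Complex.norm_real, Real.norm_eq_abs, abs_le]
  constructor <;> linarith

open scoped ComplexStarModule in
lemma IsQuasitrace.norm_le (hτ : IsQuasitrace τ) (a : B) : ‖τ a‖ ≤ 2 * ‖a‖ * (τ 1).re := by
  have h1 := hτ.re_add_im (ℜ a) (ℑ a) (ℜ a).2 (ℑ a).2
  rw [realPart_add_I_smul_imaginaryPart] at h1
  have h2 := hτ.norm_le_of_isSelfAdjoint (ℜ a).2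
  have h3 := hτ.norm_le_of_isSelfAdjoint (ℑ a).2
  have h4 : ‖(ℜ a : B)‖ ≤ ‖a‖ := realPart.norm_le a
  have h5 : ‖(ℑ a : B)‖ ≤ ‖a‖ := imaginaryPart.norm_le a
  have h6 := hτ.re_nonneg (zero_le_one (α := B))
  rw [h1]
  refine (norm_add_le _ _).trans ?_
  rw [norm_mul, Complex.norm_I, one_mul]
  nlinarith

lemma IsQuasitrace.re_sum (hτ : IsQuasitrace τ) {ι : Type*} (s : Finset ι) (x : ι → B)
    (hx : ∀ i ∈ s, IsSelfAdjoint (x i)) (hc : ∀ i ∈ s, ∀ j ∈ s, Commute (x i) (x j)) :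
    (τ (∑ i ∈ s, x i)).re = ∑ i ∈ s, (τ (x i)).re := by
  classical
  induction s using Finset.induction_on with
  | empty => simp [hτ.map_zero]
  | insert i s hi ih =>
    rw [Finset.sum_insert hi, Finset.sum_insert hi, hτ.re_add (hx i (by simp)), ih]
    · exact fun j hj => hx j (by simp [hj])
    · exact fun j hj k hk => hc j (by simp [hj]) k (by simp [hk])
    · exact isSelfAdjoint_sum s fun j hj => hx j (by simp [hj])
    · exact Commute.sum_right _ _ _ fun j hj => hc i (by simp) j (by simp [hj])

/-- A positive contraction `p` for which `f` is a unit satisfies `τ p ≤ τ f`. -/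
lemma IsQuasitrace.re_le_of_mul_eq (hτ : IsQuasitrace τ) {p f : B} (hp : 0 ≤ p) (hp1 : p ≤ 1)
    (hf : 0 ≤ f) (hf1 : f ≤ 1) (h : f * p = p) : (τ p).re ≤ (τ f).re := by
  have hp' := IsSelfAdjoint.of_nonneg hp
  have hf' := IsSelfAdjoint.of_nonneg hf
  have h' : p * f = p := by simpa [hp'.star_eq, hf'.star_eq] using congrArg star h
  refine hτ.re_mono hp' hf' (h'.trans h.symm) ?_
  have h1 : p ≤ f * f := by
    have := star_left_conjugate_le_conjugate hp1 f
    rwa [hf'.star_eq, h, h', mul_one] at this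
  refine h1.trans ?_
  have h2 : f * f = f ^ 2 := (sq f).symm
  have := CStarAlgebra.pow_antitone hf hf1 (show 1 ≤ 2 by norm_num)
  simpa [h2] using this

end Quasitrace

/-! ### Factorization of positive matrices -/

section Rect

variable {A : Type*} [CStarAlgebra A] [PartialOrder A] [StarOrderedRing A]

/-- `x⋆ x` is positive for a rectangular matrix `x`: it is the sum, over the rows of `x`, of the
products `r⋆ r` where `r` is the square matrix whose only nonzero row is the given one. -/
lemma conjTranspose_mul_self_nonneg {n m : ℕ} (x : Matrix (Fin m) (Fin n) A) :
    0 ≤ Mat.of (xᴴ * x) := by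
  rcases n with _ | n
  · have : Mat.of (xᴴ * x) = 0 := by
      apply Mat.of.symm.injective
      ext i
      exact i.elim0
    rw [this]
  · let r : Fin m → Mat (n + 1) A := fun k =>
      Mat.of (Matrix.of fun i j => if i = 0 then x k j else 0)
    have : Mat.of (xᴴ * x) = ∑ k, star (r k) * r k := by
      apply Mat.of.symm.injective
      have h1 : Mat.of.symm (∑ k, star (r k) * r k) =
          ∑ k, (r k).entriesᴴ * (r k).entries := rfl
      rw [h1]
      ext i j
      change (xᴴ * x) i j = _
      rw [Matrix.sum_apply, Matrix.mul_apply]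
      refine Finset.sum_congr rfl fun k _ => ?_
      rw [Matrix.mul_apply, Finset.sum_eq_single 0]
      · simp [r, Mat.entries]
      · intro b _ hb
        simp [r, Mat.entries, hb]
      · simp
    rw [this]
    exact Finset.sum_nonneg fun k _ => star_mul_self_nonneg _

lemma Mat.conj_nonneg {n m : ℕ} (x : Matrix (Fin m) (Fin n) A) {b : Mat m A} (hb : 0 ≤ b) :
    0 ≤ Mat.conj x b := by
  obtain ⟨c, rfl⟩ := CStarAlgebra.nonneg_iff_eq_star_mul_self.mp hb
  have := conjTranspose_mul_self_nonneg (c.entries * x)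
  rw [Matrix.conjTranspose_mul] at this
  simpa [Mat.conj, Mat.entries_mul, Mat.entries_star, Matrix.mul_assoc] using this

lemma Mat.norm_entries_le {n : ℕ} (a : Mat n A) (i j : Fin n) : ‖a.entries i j‖ ≤ ‖a‖ :=
  CStarMatrix.norm_entry_le_norm (M := (a : CStarMatrix (Fin n) (Fin n) A))

lemma norm_sq_entry_le {n m : ℕ} (x : Matrix (Fin m) (Fin n) A) (i : Fin m) (j : Fin n) :
    ‖x i j‖ ^ 2 ≤ ‖Mat.of (xᴴ * x)‖ := by
  have h1 : ‖x i j‖ ^ 2 = ‖star (x i j) * x i j‖ := by rw [CStarRing.norm_star_mul_self, sq]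
  rw [h1]
  refine le_trans ?_ (Mat.norm_entries_le (Mat.of (xᴴ * x)) j j)
  refine CStarAlgebra.norm_le_norm_of_nonneg_of_le (star_mul_self_nonneg _) ?_
  change _ ≤ (xᴴ * x) j j
  rw [Matrix.mul_apply]
  exact Finset.single_le_sum (f := fun k => xᴴ j k * x k j)
    (fun k _ => star_mul_self_nonneg (x k j)) (Finset.mem_univ i)

/-- If `s² ≤ y` then `‖s γ(y)² s‖` is controlled by the values of `t γ(t)²`. -/
lemma norm_conj_cfc_le {B : Type*} [CStarAlgebra B] [PartialOrder B] [StarOrderedRing B]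
    {s y : B} (hs : IsSelfAdjoint s) (hy : 0 ≤ y) (h : s * s ≤ y) {γ : ℝ → ℝ}
    (hγ : Continuous γ) {c : ℝ} (hc : 0 ≤ c) (hle : ∀ t ∈ spectrum ℝ y, t * γ t ^ 2 ≤ c) :
    ‖s * (cfc γ y * cfc γ y) * s‖ ≤ c := by
  have hg : IsSelfAdjoint (cfc γ y) := cfc_predicate γ y
  have h1 : s * (cfc γ y * cfc γ y) * s = star (cfc γ y * s) * (cfc γ y * s) := by
    simp only [star_mul, hs.star_eq, hg.star_eq, mul_assoc]
  have h2 : ‖star (cfc γ y * s) * (cfc γ y * s)‖ = ‖cfc γ y * s * star (cfc γ y * s)‖ := by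
    rw [CStarRing.norm_star_mul_self, CStarRing.norm_self_mul_star]
  have h3 : cfc γ y * s * star (cfc γ y * s) = cfc γ y * (s * s) * cfc γ y := by
    simp only [star_mul, hs.star_eq, hg.star_eq, mul_assoc]
  rw [h1, h2]
  have h4 : cfc γ y * y * cfc γ y = cfc (fun t => t * γ t ^ 2) y := by
    conv_lhs => enter [1, 2]; rw [← cfc_id' ℝ y]
    rw [← cfc_mul γ (fun t => t) y, ← cfc_mul (fun t => γ t * t) γ y]
    congr 1; ext t; ring
  refine (CStarAlgebra.norm_le_norm_of_nonneg_of_le (mul_star_self_nonneg _)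
    (b := cfc (fun t => t * γ t ^ 2) y) ?_).trans ?_
  · rw [h3, ← h4]
    have := star_left_conjugate_le_conjugate h (cfc γ y)
    rwa [hg.star_eq] at this
  · refine norm_cfc_le hc fun t ht => ?_
    rw [Real.norm_of_nonneg]
    · exact hle t ht
    · exact mul_nonneg (spectrum_nonneg_of_nonneg hy ht) (sq_nonneg _)

/-- Estimate for differences of the approximants in the Douglas factorization: `β` is a difference
of two functions `(√t + ν)⁻¹`. -/
lemma norm_star_mul_mul_cfc_le {B : Type*} [CStarAlgebra B] [PartialOrder B] [StarOrderedRing B]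
    {s y : B} (hs : IsSelfAdjoint s) (hy : 0 ≤ y) (h : s * s ≤ y) {β : ℝ → ℝ}
    (hβ : Continuous β) {c : ℝ} (hle : ∀ t, 0 ≤ t → |√t ^ 2 * β t| ≤ c) :
    ‖star (cfc β y * s) * y * (cfc β y * s)‖ ≤ c ^ 2 := by
  have h3 : star (cfc β y * s) * y * (cfc β y * s) =
      s * (cfc (fun t => √t * β t) y * cfc (fun t => √t * β t) y) * s := by
    have h4 : cfc (fun t => √t * β t) y * cfc (fun t => √t * β t) y =
        cfc β y * y * cfc β y := by
      conv_rhs => enter [1, 2]; rw [← cfc_id' ℝ y]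
      rw [← cfc_mul _ _ y (by fun_prop) (by fun_prop),
        ← cfc_mul _ _ y (by fun_prop) (by fun_prop), ← cfc_mul _ _ y (by fun_prop) (by fun_prop)]
      refine cfc_congr fun t ht => ?_
      have := Real.mul_self_sqrt (spectrum_nonneg_of_nonneg hy ht)
      linear_combination β t ^ 2 * this
    rw [h4, star_mul, hs.star_eq, (cfc_predicate β y : IsSelfAdjoint _).star_eq]
    simp only [mul_assoc]
  rw [h3]
  refine norm_conj_cfc_le hs hy h (by fun_prop) (sq_nonneg _) fun t ht => ?_
  have ht0 := spectrum_nonneg_of_nonneg hy ht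
  have e1 : t * (√t * β t) ^ 2 = (√t ^ 2 * β t) ^ 2 := by
    linear_combination (-(√t ^ 2 * β t ^ 2)) * Real.sq_sqrt ht0
  rw [e1]
  exact sq_le_sq.mpr ((hle t ht0).trans (le_abs_self c))

/-- If `s² ≤ y` and `t (1 - t β(t)²)` is small, then `x = β(y) s` nearly solves `x⋆ y x = s²`. -/
lemma norm_star_mul_mul_cfc_sub_le {B : Type*} [CStarAlgebra B] [PartialOrder B]
    [StarOrderedRing B] {s y : B} (hs : IsSelfAdjoint s) (hy : 0 ≤ y) (h : s * s ≤ y) {β : ℝ → ℝ}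
    (hβ : Continuous β) {c : ℝ} (hc : 0 ≤ c) (hη : ∀ t, 0 ≤ 1 - √t ^ 2 * β t ^ 2)
    (hle : ∀ t ∈ spectrum ℝ y, t * (1 - √t ^ 2 * β t ^ 2) ≤ c) :
    ‖star (cfc β y * s) * y * (cfc β y * s) - s * s‖ ≤ c := by
  have hcη : Continuous fun t => √(1 - √t ^ 2 * β t ^ 2) := by fun_prop
  have e2 : cfc (fun t => √(1 - √t ^ 2 * β t ^ 2)) y * cfc (fun t => √(1 - √t ^ 2 * β t ^ 2)) y =
      1 - cfc β y * y * cfc β y := by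
    conv_rhs => enter [2, 1, 2]; rw [← cfc_id' ℝ y]
    rw [← cfc_const_one ℝ y, ← cfc_mul _ _ y (by fun_prop) (by fun_prop),
      ← cfc_mul _ _ y (by fun_prop) (by fun_prop), ← cfc_mul _ _ y (by fun_prop) (by fun_prop),
      ← cfc_sub _ _ y (by fun_prop) (by fun_prop)]
    refine cfc_congr fun t ht => ?_
    have ht0 := Real.sq_sqrt (spectrum_nonneg_of_nonneg hy ht)
    rw [Real.mul_self_sqrt (hη t)]
    linear_combination (-(β t ^ 2)) * ht0
  have e1 : star (cfc β y * s) * y * (cfc β y * s) - s * s =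
      -(s * (cfc (fun t => √(1 - √t ^ 2 * β t ^ 2)) y *
        cfc (fun t => √(1 - √t ^ 2 * β t ^ 2)) y) * s) := by
    rw [e2, star_mul, hs.star_eq, (cfc_predicate β y : IsSelfAdjoint _).star_eq]
    noncomm_ring
  rw [e1, norm_neg]
  refine norm_conj_cfc_le hs hy h hcη hc fun t ht => ?_
  rw [Real.sq_sqrt (hη t)]
  exact hle t ht

section SqrtInv

variable {ν : ℝ}

lemma continuous_sqrt_add_inv (hν : 0 < ν) : Continuous fun t : ℝ => (√t + ν)⁻¹ := by
  refine (Real.continuous_sqrt.add continuous_const).inv₀ fun t => ?_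
  exact (add_pos_of_nonneg_of_pos (Real.sqrt_nonneg t) hν).ne'

lemma sqrt_sub_sq_mul_inv (hν : 0 < ν) (t : ℝ) :
    √t - √t ^ 2 * (√t + ν)⁻¹ = ν * (√t / (√t + ν)) := by
  field_simp; ring

lemma sqrt_sub_sq_mul_inv_nonneg (hν : 0 < ν) (t : ℝ) : 0 ≤ √t - √t ^ 2 * (√t + ν)⁻¹ := by
  rw [sqrt_sub_sq_mul_inv hν]; positivity

lemma sqrt_sub_sq_mul_inv_le (hν : 0 < ν) (t : ℝ) : √t - √t ^ 2 * (√t + ν)⁻¹ ≤ ν := by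
  rw [sqrt_sub_sq_mul_inv hν]
  refine mul_le_of_le_one_right hν.le ?_
  rw [div_le_one (by positivity)]
  linarith

lemma one_sub_sqrt_mul_inv_nonneg (hν : 0 < ν) (t : ℝ) :
    0 ≤ 1 - √t ^ 2 * (√t + ν)⁻¹ ^ 2 := by
  rw [← mul_pow, sub_nonneg, sq_le_one_iff₀ (by positivity), ← div_eq_mul_inv,
    div_le_one (by positivity)]
  linarith

lemma mul_one_sub_sqrt_mul_inv_le (hν : 0 < ν) {t C : ℝ} (ht : 0 ≤ t) (htC : t ≤ C) :
    t * (1 - √t ^ 2 * (√t + ν)⁻¹ ^ 2) ≤ 2 * √C * ν := by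
  have e4 : t * (1 - √t ^ 2 * (√t + ν)⁻¹ ^ 2) =
      (√t - √t ^ 2 * (√t + ν)⁻¹) * (√t + √t ^ 2 * (√t + ν)⁻¹) := by
    linear_combination (√t ^ 2 * (√t + ν)⁻¹ ^ 2 - 1) * Real.sq_sqrt ht
  have e6 := sqrt_sub_sq_mul_inv_nonneg hν t
  have e7 : √t ≤ √C := Real.sqrt_le_sqrt htC
  rw [e4]
  calc _ ≤ ν * (2 * √C) :=
        mul_le_mul (sqrt_sub_sq_mul_inv_le hν t) (by linarith) (by positivity) hν.le
    _ = _ := by ring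

end SqrtInv

/-- Douglas-type factorization: a positive matrix below `z⋆ z` is of the form `w⋆ w` for a
(rectangular) matrix `w` in the closure of `z M_n(A)`. It is the limit of
`z (√y + ν)⁻¹ f^{1/2}` as `ν → 0`, where `y = z⋆ z`. -/
lemma exists_conjTranspose_mul_self_eq {n m : ℕ} {f : Mat n A} (hf : 0 ≤ f)
    (z : Matrix (Fin m) (Fin n) A) (h : f ≤ Mat.of (zᴴ * z)) :
    ∃ w : Matrix (Fin m) (Fin n) A, Mat.of (wᴴ * w) = f ∧
      ∀ p : Matrix (Fin m) (Fin m) A, p * z = z → p * w = w := by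
  obtain ⟨y, hy_def⟩ : ∃ y, y = Mat.of (zᴴ * z) := ⟨_, rfl⟩
  rw [← hy_def] at h
  have hy : 0 ≤ y := hf.trans h
  obtain ⟨s, hs, hss⟩ : ∃ s : Mat n A, IsSelfAdjoint s ∧ s * s = f :=
    ⟨CFC.sqrt f, IsSelfAdjoint.of_nonneg (CFC.sqrt_nonneg f), CFC.sqrt_mul_sqrt_self f⟩
  have hsy : s * s ≤ y := hss.trans_le h
  let ν : ℕ → ℝ := fun i => 1 / ((i : ℝ) + 1)
  have hν : ∀ i, 0 < ν i := fun i => by positivity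
  let β : ℕ → ℝ → ℝ := fun i t => (√t + ν i)⁻¹
  have hβ : ∀ i, Continuous (β i) := fun i => continuous_sqrt_add_inv (hν i)
  let w : ℕ → Matrix (Fin m) (Fin n) A := fun i => z * (cfc (β i) y * s).entries
  have hsq : ∀ x : Mat n A, Mat.of ((z * x.entries)ᴴ * (z * x.entries)) = star x * y * x := by
    intro x
    have : star x * y * x = Mat.of (x.entriesᴴ * (zᴴ * z) * x.entries) := by rw [hy_def]; rfl
    rw [this, Matrix.conjTranspose_mul]
    simp only [Matrix.mul_assoc]
  have hdiff : ∀ i j p q, dist (w i p q) (w j p q) ≤ ν i + ν j := by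
    intro i j p q
    rw [dist_eq_norm]
    have h1 : w i - w j = z * (cfc (fun t => β i t - β j t) y * s).entries := by
      rw [cfc_sub (β i) (β j) y (hβ i).continuousOn (hβ j).continuousOn, sub_mul]
      exact (Matrix.mul_sub z _ _).symm
    have h2 : w i p q - w j p q = (z * (cfc (fun t => β i t - β j t) y * s).entries) p q := by
      rw [← h1]; rfl
    have hle := norm_sq_entry_le (z * (cfc (fun t => β i t - β j t) y * s).entries) p q
    rw [← h2, hsq] at hle
    have hνs : 0 ≤ ν i + ν j := add_nonneg (hν i).le (hν j).le
    refine (pow_le_pow_iff_left₀ (norm_nonneg _) hνs two_ne_zero).mp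
      (hle.trans (norm_star_mul_mul_cfc_le hs hy hsy ((hβ i).sub (hβ j)) fun t _ => ?_))
    have e1 : √t ^ 2 * (β i t - β j t) =
        (√t - √t ^ 2 * β j t) - (√t - √t ^ 2 * β i t) := by ring
    rw [Pi.sub_apply, e1, abs_le]
    have := sqrt_sub_sq_mul_inv_nonneg (hν i) t
    have := sqrt_sub_sq_mul_inv_nonneg (hν j) t
    have := sqrt_sub_sq_mul_inv_le (hν i) t
    have := sqrt_sub_sq_mul_inv_le (hν j) t
    constructor <;> linarith [hν i, hν j]
  have hν0 : Filter.Tendsto ν Filter.atTop (𝓝 0) := tendsto_one_div_add_atTop_nhds_zero_nat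
  have hνanti : Antitone ν := fun i j hij => by
    simp only [ν]; gcongr
  have hcauchy : ∀ p q, ∃ l, Filter.Tendsto (fun i => w i p q) Filter.atTop (𝓝 l) := by
    intro p q
    refine cauchySeq_tendsto_of_complete (cauchySeq_of_le_tendsto_0 (fun N => ν N + ν N) ?_ ?_)
    · intro i j N hi hj
      exact (hdiff i j p q).trans (add_le_add (hνanti hi) (hνanti hj))
    · simpa using hν0.add hν0
  choose l hl using hcauchy
  have hw : Filter.Tendsto w Filter.atTop (𝓝 (Matrix.of l)) :=
    tendsto_pi_nhds.mpr fun p => tendsto_pi_nhds.mpr fun q => hl p q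
  refine ⟨Matrix.of l, ?_, ?_⟩
  · have h1 : Filter.Tendsto (fun i => Mat.of ((w i)ᴴ * w i)) Filter.atTop
        (𝓝 (Mat.of ((Matrix.of l)ᴴ * Matrix.of l))) := by
      have hc : Continuous fun x : Matrix (Fin m) (Fin n) A => Mat.of (xᴴ * x) :=
        Mat.continuous_of.comp (by fun_prop)
      exact (hc.tendsto _).comp hw
    refine tendsto_nhds_unique h1 ?_
    rw [tendsto_iff_norm_sub_tendsto_zero]
    refine squeeze_zero (fun _ => norm_nonneg _) (g := fun i => 2 * √‖y‖ * ν i) ?_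
      (by simpa using hν0.const_mul (2 * √‖y‖))
    intro i
    rw [hsq, ← hss]
    refine norm_star_mul_mul_cfc_sub_le hs hy hsy (hβ i)
      (mul_nonneg (by positivity) (hν i).le) (one_sub_sqrt_mul_inv_nonneg (hν i)) fun t ht =>
        mul_one_sub_sqrt_mul_inv_le (hν i) (spectrum_nonneg_of_nonneg hy ht) (spectrum_le_norm ht)
  · intro p hp
    have h1 : Filter.Tendsto (fun i => p * w i) Filter.atTop (𝓝 (p * Matrix.of l)) := by
      have hc : Continuous fun x : Matrix (Fin m) (Fin n) A => p * x := by fun_prop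
      exact (hc.tendsto _).comp hw
    have h2 : ∀ i, p * w i = w i := fun i => by
      simp only [w]; rw [← Matrix.mul_assoc, hp]
    simp only [h2] at h1
    exact tendsto_nhds_unique h1 hw

end Rect

/-! ### Exact form of Cuntz comparison -/

section Comparison

variable {A : Type*} [CStarAlgebra A] [PartialOrder A] [StarOrderedRing A]

lemma Mat.conj_add {n m : ℕ} (x : Matrix (Fin m) (Fin n) A) (a b : Mat m A) :
    Mat.conj x (a + b) = Mat.conj x a + Mat.conj x b := by
  change Mat.of (xᴴ * (a.entries + b.entries) * x) =
    Mat.of (xᴴ * a.entries * x + xᴴ * b.entries * x)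
  rw [Matrix.mul_add, Matrix.add_mul]

/-- Exact form of Cuntz comparison: if `a ≾ b`, then a cut-down of `a` is of the form `w⋆ w` for a
matrix `w` on which a cut-down of `b` acts as a left unit. With `r = (b - δ)₊^{1/2}` and `x⋆ b x`
close to `a`, the element `a - ε/4` is below `x⋆ r² x`, so that a cut-down of `a` is below `z⋆ z` for
`z = r x k` with `k` in the subalgebra generated by `a`. -/
lemma CuntzLE.exists_factor {a b : PosMat A} (h : CuntzLE a b) {ε : ℝ} (hε : 0 < ε) :
    ∃ δ > 0, ∃ w : Matrix (Fin b.size) (Fin a.size) A,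
      Mat.of (wᴴ * w) = cfc (ramp ε) a.val ∧ (cfc (ramp δ) b.val).entries * w = w := by
  obtain ⟨x, hx⟩ : ∃ x, ‖Mat.conj x b.val - a.val‖ < ε / 8 := by
    obtain ⟨x, hx⟩ := h
    obtain ⟨j, hj⟩ := ((tendsto_iff_norm_sub_tendsto_zero.mp hx).eventually_lt_const
      (show 0 < ε / 8 by positivity)).exists
    exact ⟨x j, hj⟩
  obtain ⟨ρ, hρ, hcont⟩ := Metric.continuous_iff.mp (Mat.continuous_conj x) b.val (ε / 8)
    (by positivity)
  have hb := IsSelfAdjoint.of_nonneg b.nonneg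
  have ha := IsSelfAdjoint.of_nonneg a.nonneg
  set δ := ρ / 2 with hδ_def
  have hδ : 0 < δ := by positivity
  have hr_cont : Continuous fun t => √(max (t - δ) 0) := by fun_prop
  obtain ⟨r, hr_def⟩ : ∃ r, r = cfc (fun t => √(max (t - δ) 0)) b.val := ⟨_, rfl⟩
  have hr : IsSelfAdjoint r := by rw [hr_def]; exact cfc_predicate _ _
  have hrr : r * r = cfc (fun t => max (t - δ) 0) b.val := by
    rw [hr_def, ← cfc_mul _ _ b.val hr_cont.continuousOn hr_cont.continuousOn]
    exact cfc_congr fun t _ => Real.mul_self_sqrt (le_max_right _ _)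
  have hrb : ‖r * r - b.val‖ < ρ := by
    rw [hrr]
    refine (norm_cfc_sub_self_le hb (by fun_prop) hδ.le fun t ht => ?_).trans_lt
      (half_lt_self hρ)
    have := spectrum_nonneg_of_nonneg b.nonneg ht
    rcases max_cases (t - δ) 0 with ⟨h1, _⟩ | ⟨h1, _⟩ <;> rw [h1, abs_le] <;>
      constructor <;> linarith
  have hclose : ‖a.val - Mat.conj x (r * r)‖ ≤ ε / 4 := by
    have h1 := hcont (r * r) (by rwa [dist_eq_norm])
    rw [dist_eq_norm] at h1
    rw [norm_sub_rev]
    have := norm_sub_le_norm_sub_add_norm_sub (Mat.conj x (r * r)) (Mat.conj x b.val) a.val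
    linarith
  have hgr : cfc (ramp δ) b.val * r = r := by
    rw [hr_def]
    refine cfc_mul_self_of_eqOn_one _ (by fun_prop) (by fun_prop) fun t ht => ?_
    refine ramp_eq_one hδ ?_
    by_contra! h'
    exact ht (by simp [max_eq_right (show t - δ ≤ 0 by linarith)])
  have hkc : Continuous fun t => √(ramp ε t / max (t - ε / 4) (ε / 4)) := by
    refine Real.continuous_sqrt.comp ((continuous_ramp ε).div (by fun_prop) fun t => ?_)
    exact (lt_of_lt_of_le (show 0 < ε / 4 by positivity) (le_max_right _ _)).ne'
  obtain ⟨k, hk_def⟩ : ∃ k, k = cfc (fun t => √(ramp ε t / max (t - ε / 4) (ε / 4))) a.val :=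
    ⟨_, rfl⟩
  have hk : IsSelfAdjoint k := by rw [hk_def]; exact cfc_predicate _ _
  have hkak : k * (a.val - algebraMap ℝ _ (ε / 4)) * k = cfc (ramp ε) a.val := by
    have h1 : a.val - algebraMap ℝ _ (ε / 4) = cfc (fun t => t - ε / 4) a.val := by
      rw [cfc_sub (fun t => t) (fun _ => ε / 4) a.val, cfc_id' ℝ a.val, cfc_const _ a.val]
    rw [h1, hk_def, ← cfc_mul _ _ a.val hkc.continuousOn (by fun_prop),
      ← cfc_mul _ _ a.val (by fun_prop) hkc.continuousOn]
    refine cfc_congr fun t _ => ?_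
    by_cases h0 : ramp ε t = 0
    · simp [h0]
    · have h2 := half_lt_of_ramp_ne_zero hε h0
      have h3 : max (t - ε / 4) (ε / 4) = t - ε / 4 := max_eq_left (by linarith)
      have h4 : 0 < t - ε / 4 := by linarith
      have h5 := ramp_nonneg ε t
      rw [h3, mul_right_comm, Real.mul_self_sqrt (by positivity),
        div_mul_cancel₀ _ h4.ne']
  have hle : a.val - algebraMap ℝ _ (ε / 4) ≤ Mat.conj x (r * r) := by
    have hsa : IsSelfAdjoint (a.val - Mat.conj x (r * r)) := by
      refine ha.sub (IsSelfAdjoint.of_nonneg (Mat.conj_nonneg x ?_))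
      have := star_mul_self_nonneg r
      rwa [hr.star_eq] at this
    have h1 := hsa.le_algebraMap_norm_self
    have h2 : algebraMap ℝ (Mat a.size A) ‖a.val - Mat.conj x (r * r)‖ ≤ algebraMap ℝ _ (ε / 4) :=
      algebraMap_mono _ hclose
    have h3 := h1.trans h2
    rw [sub_le_iff_le_add] at h3 ⊢
    rwa [add_comm]
  have hfz : cfc (ramp ε) a.val ≤
      Mat.of ((r.entries * x * k.entries)ᴴ * (r.entries * x * k.entries)) := by
    have h1 := star_left_conjugate_le_conjugate hle k
    rw [hk.star_eq, hkak] at h1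
    refine h1.trans_eq ?_
    change Mat.of (k.entries * (xᴴ * (r.entries * r.entries) * x) * k.entries) = _
    have h2 : r.entriesᴴ = r.entries := by rw [← Mat.entries_star, hr.star_eq]
    have h3 : k.entriesᴴ = k.entries := by rw [← Mat.entries_star, hk.star_eq]
    simp only [Matrix.conjTranspose_mul, h2, h3, Matrix.mul_assoc]
  obtain ⟨w, hw, hp⟩ := exists_conjTranspose_mul_self_eq (cfc_ramp_nonneg _ _) _ hfz
  refine ⟨δ, hδ, w, hw, hp _ ?_⟩
  rw [← Matrix.mul_assoc, ← Matrix.mul_assoc, ← Mat.entries_mul, hgr]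

end Comparison

/-! ### Rectangular matrices and direct sums under a quasitrace -/

section Trace

variable {A : Type*} [CStarAlgebra A] [PartialOrder A] [StarOrderedRing A]

lemma conj_castSucc_eq_directSum {n : ℕ} (a : Mat n A) :
    Mat.conj ((1 : Matrix (Fin (n + 1)) (Fin (n + 1)) A).submatrix id Fin.castSucc)ᴴ a =
      a.directSum (0 : Mat 1 A) := by
  apply Mat.of.symm.injective
  ext i j
  have hcs : ∀ k : Fin n, Fin.castSucc k = finSumFinEquiv (Sum.inl k) := fun k => rfl
  obtain ⟨i, rfl⟩ := finSumFinEquiv.surjective i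
  obtain ⟨j, rfl⟩ := finSumFinEquiv.surjective j
  have h2 : Mat.of.symm (a.directSum (0 : Mat 1 A)) (finSumFinEquiv i) (finSumFinEquiv j) =
      Matrix.fromBlocks a.entries 0 0 (0 : Mat 1 A).entries i j := by
    change blockSum a.entries _ _ _ = _
    simp [blockSum]
  rw [h2]
  change ((((1 : Matrix (Fin (n + 1)) (Fin (n + 1)) A).submatrix id Fin.castSucc)ᴴᴴ * a.entries) *
    ((1 : Matrix (Fin (n + 1)) (Fin (n + 1)) A).submatrix id Fin.castSucc)ᴴ) _ _ = _
  rw [Matrix.conjTranspose_conjTranspose]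
  rcases i with i | i <;> rcases j with j | j <;>
    simp [Matrix.mul_apply, Matrix.one_apply, hcs, -finSumFinEquiv_apply_left,
      -finSumFinEquiv_apply_right]
  all_goals rfl

/-- Quasitraces are compatible with the standard embeddings `M_n(A) ⊆ M_N(A)`. -/
lemma NormalizedQuasitrace.exists_isometry (τ : NormalizedQuasitrace A) {n N : ℕ} (h : n ≤ N) :
    ∃ V : Matrix (Fin N) (Fin n) A, Vᴴ * V = 1 ∧
      ∀ a : Mat n A, τ.toFun N (Mat.conj Vᴴ a) = τ.toFun n a := by
  induction N, h using Nat.le_induction with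
  | base =>
    refine ⟨1, by simp, fun a => ?_⟩
    have : Mat.conj (1 : Matrix (Fin n) (Fin n) A)ᴴ a = a := by
      simp [Mat.conj]; rfl
    rw [this]
  | succ N _ ih =>
    obtain ⟨V, hV, hτ⟩ := ih
    set W : Matrix (Fin (N + 1)) (Fin N) A :=
      (1 : Matrix (Fin (N + 1)) (Fin (N + 1)) A).submatrix id Fin.castSucc with hW
    have hWW : Wᴴ * W = 1 := by
      ext i j
      simp [hW, Matrix.mul_apply, Matrix.one_apply, eq_comm]
    refine ⟨W * V, ?_, fun a => ?_⟩
    · rw [Matrix.conjTranspose_mul, Matrix.mul_assoc, ← Matrix.mul_assoc Wᴴ, hWW, Matrix.one_mul,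
        hV]
    · rw [Matrix.conjTranspose_mul, ← Mat.conj_conj, hW, conj_castSucc_eq_directSum, τ.corner, hτ]

/-- The trace property for rectangular matrices. -/
lemma NormalizedQuasitrace.conjTranspose_mul_comm (τ : NormalizedQuasitrace A) {n m : ℕ}
    (x : Matrix (Fin m) (Fin n) A) :
    τ.toFun n (Mat.of (xᴴ * x)) = τ.toFun m (Mat.of (x * xᴴ)) := by
  obtain ⟨V, hV, hτV⟩ := τ.exists_isometry (Nat.le_add_right n m)
  obtain ⟨W, hW, hτW⟩ := τ.exists_isometry (Nat.le_add_left m n)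
  have h := (τ.isQuasitrace (n + m)).comm (Mat.of (W * x * Vᴴ))
  have h1 : star (Mat.of (W * x * Vᴴ)) * Mat.of (W * x * Vᴴ) = Mat.conj Vᴴ (Mat.of (xᴴ * x)) := by
    rw [← Mat.of_conjTranspose, ← Mat.of_mul, Mat.conj]
    congr 1
    change _ = Vᴴᴴ * (xᴴ * x) * Vᴴ
    simp only [Matrix.conjTranspose_mul, Matrix.mul_assoc]
    rw [← Matrix.mul_assoc Wᴴ, hW, Matrix.one_mul]
  have h2 : Mat.of (W * x * Vᴴ) * star (Mat.of (W * x * Vᴴ)) = Mat.conj Wᴴ (Mat.of (x * xᴴ)) := by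
    rw [← Mat.of_conjTranspose, ← Mat.of_mul, Mat.conj]
    congr 1
    change _ = Wᴴᴴ * (x * xᴴ) * Wᴴ
    simp only [Matrix.conjTranspose_mul, Matrix.mul_assoc, Matrix.conjTranspose_conjTranspose]
    rw [← Matrix.mul_assoc Vᴴ, hV, Matrix.one_mul]
  rwa [h1, h2, hτV, hτW] at h

/-- The isometry of `A^n` onto the first summand of `A^(n+m)`. -/
def inlMatrix (A : Type*) [CStarAlgebra A] (n m : ℕ) : Matrix (Fin (n + m)) (Fin n) A :=
  Matrix.reindex finSumFinEquiv (Equiv.refl _) (Matrix.fromRows 1 0)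

/-- The isometry of `A^m` onto the second summand of `A^(n+m)`. -/
def inrMatrix (A : Type*) [CStarAlgebra A] (n m : ℕ) : Matrix (Fin (n + m)) (Fin m) A :=
  Matrix.reindex finSumFinEquiv (Equiv.refl _) (Matrix.fromRows 0 1)

lemma inl_blockSum_inl {n m : ℕ} (a : Matrix (Fin n) (Fin n) A) (b : Matrix (Fin m) (Fin m) A) :
    (inlMatrix A n m)ᴴ * blockSum a b * inlMatrix A n m = a := by
  simp [inlMatrix, blockSum, Matrix.submatrix_mul_equiv,
    Matrix.conjTranspose_fromRows_eq_fromCols_conjTranspose, Matrix.fromCols_mul_fromBlocks,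
    Matrix.fromCols_mul_fromRows]

lemma inl_blockSum_inr {n m : ℕ} (a : Matrix (Fin n) (Fin n) A) (b : Matrix (Fin m) (Fin m) A) :
    (inlMatrix A n m)ᴴ * blockSum a b * inrMatrix A n m = 0 := by
  simp [inlMatrix, inrMatrix, blockSum, Matrix.submatrix_mul_equiv,
    Matrix.conjTranspose_fromRows_eq_fromCols_conjTranspose, Matrix.fromCols_mul_fromBlocks,
    Matrix.fromCols_mul_fromRows]

lemma inr_blockSum_inl {n m : ℕ} (a : Matrix (Fin n) (Fin n) A) (b : Matrix (Fin m) (Fin m) A) :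
    (inrMatrix A n m)ᴴ * blockSum a b * inlMatrix A n m = 0 := by
  simp [inlMatrix, inrMatrix, blockSum, Matrix.submatrix_mul_equiv,
    Matrix.conjTranspose_fromRows_eq_fromCols_conjTranspose, Matrix.fromCols_mul_fromBlocks,
    Matrix.fromCols_mul_fromRows]

lemma inr_blockSum_inr {n m : ℕ} (a : Matrix (Fin n) (Fin n) A) (b : Matrix (Fin m) (Fin m) A) :
    (inrMatrix A n m)ᴴ * blockSum a b * inrMatrix A n m = b := by
  simp [inrMatrix, blockSum, Matrix.submatrix_mul_equiv,
    Matrix.conjTranspose_fromRows_eq_fromCols_conjTranspose, Matrix.fromCols_mul_fromBlocks,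
    Matrix.fromCols_mul_fromRows]

lemma inlMatrix_mul {n m : ℕ} (c : Matrix (Fin n) (Fin n) A) :
    inlMatrix A n m * c =
      Matrix.reindex finSumFinEquiv (Equiv.refl _) (Matrix.fromRows c 0) := by
  ext i j
  obtain ⟨i, rfl⟩ := finSumFinEquiv.surjective i
  rcases i with i | i <;> simp [inlMatrix, Matrix.mul_apply, Matrix.one_apply]

lemma inrMatrix_mul {n m : ℕ} (c : Matrix (Fin m) (Fin m) A) :
    inrMatrix A n m * c =
      Matrix.reindex finSumFinEquiv (Equiv.refl _) (Matrix.fromRows 0 c) := by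
  ext i j
  obtain ⟨i, rfl⟩ := finSumFinEquiv.surjective i
  rcases i with i | i <;> simp [inrMatrix, Matrix.mul_apply, Matrix.one_apply]

lemma blockSum_one {n m : ℕ} :
    blockSum (1 : Matrix (Fin n) (Fin n) A) (1 : Matrix (Fin m) (Fin m) A) = 1 := by
  simp [blockSum]

lemma blockSum_add {n m : ℕ} (a a' : Matrix (Fin n) (Fin n) A) (b b' : Matrix (Fin m) (Fin m) A) :
    blockSum a b + blockSum a' b' = blockSum (a + a') (b + b') := by
  ext i j
  obtain ⟨i, rfl⟩ := finSumFinEquiv.surjective i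
  obtain ⟨j, rfl⟩ := finSumFinEquiv.surjective j
  rcases i with i | i <;> rcases j with j | j <;> simp [blockSum]

lemma blockSum_smul {n m : ℕ} (c : ℂ) (a : Matrix (Fin n) (Fin n) A)
    (b : Matrix (Fin m) (Fin m) A) : c • blockSum a b = blockSum (c • a) (c • b) := by
  ext i j
  obtain ⟨i, rfl⟩ := finSumFinEquiv.surjective i
  obtain ⟨j, rfl⟩ := finSumFinEquiv.surjective j
  rcases i with i | i <;> rcases j with j | j <;> simp [blockSum]

lemma inlMatrix_mul_mul {n m : ℕ} (c : Matrix (Fin n) (Fin n) A) :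
    inlMatrix A n m * c * (inlMatrix A n m)ᴴ = blockSum c 0 := by
  rw [inlMatrix_mul]
  simp only [inlMatrix, blockSum, Matrix.conjTranspose_fromRows_eq_fromCols_conjTranspose,
    Matrix.reindex_apply, Matrix.conjTranspose_submatrix, Matrix.submatrix_mul_equiv,
    Matrix.fromRows_mul_fromCols]
  simp

lemma inrMatrix_mul_mul {n m : ℕ} (c : Matrix (Fin m) (Fin m) A) :
    inrMatrix A n m * c * (inrMatrix A n m)ᴴ = blockSum 0 c := by
  rw [inrMatrix_mul]
  simp only [inrMatrix, blockSum, Matrix.conjTranspose_fromRows_eq_fromCols_conjTranspose,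
    Matrix.reindex_apply, Matrix.conjTranspose_submatrix, Matrix.submatrix_mul_equiv,
    Matrix.fromRows_mul_fromCols]
  simp

/-- The block diagonal embedding `M_n(A) × M_m(A) → M_{n+m}(A)`. -/
def directSumHom (A : Type*) [CStarAlgebra A] [PartialOrder A] [StarOrderedRing A] (n m : ℕ) :
    (Mat n A × Mat m A) →⋆ₐ[ℂ] Mat (n + m) A where
  toFun p := p.1.directSum p.2
  map_one' := blockSum_one
  map_mul' p q := (blockSum_mul p.1.entries p.2.entries q.1.entries q.2.entries).symm
  map_zero' := by
    change Mat.of (blockSum (0 : Matrix (Fin n) (Fin n) A) (0 : Matrix (Fin m) (Fin m) A)) = 0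
    simp [blockSum]; rfl
  map_add' p q := (blockSum_add p.1.entries q.1.entries p.2.entries q.2.entries).symm
  commutes' c := by
    have := (blockSum_smul c (1 : Matrix (Fin n) (Fin n) A) (1 : Matrix (Fin m) (Fin m) A)).symm
    rw [blockSum_one] at this
    rw [Algebra.algebraMap_eq_smul_one, Algebra.algebraMap_eq_smul_one]
    exact this
  map_star' p := (blockSum_conjTranspose p.1.entries p.2.entries).symm

lemma continuous_directSumHom (n m : ℕ) : Continuous (directSumHom A n m) := by
  rw [continuous_iff_continuousAt]
  intro p
  exact Mat.tendsto_directSum (continuous_fst.tendsto p) (continuous_snd.tendsto p)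

lemma cfc_directSum {n m : ℕ} {a : Mat n A} {b : Mat m A} (ha : IsSelfAdjoint a)
    (hb : IsSelfAdjoint b) {f : ℝ → ℝ} (hf : Continuous f) :
    cfc f (a.directSum b) = (cfc f a).directSum (cfc f b) := by
  have hab : IsSelfAdjoint ((a, b) : Mat n A × Mat m A) := by
    rw [IsSelfAdjoint, Prod.star_def, ha.star_eq, hb.star_eq]
  have hfc : Continuous fun z : ℂ => (f z.re : ℂ) := by fun_prop
  have h2 := StarAlgHomClass.map_cfc (directSumHom A n m) (fun z : ℂ => (f z.re : ℂ)) (a, b)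
    hfc.continuousOn (continuous_directSumHom n m) hab.isStarNormal
    (hab.map (directSumHom A n m)).isStarNormal
  have h3 : cfc (fun z : ℂ => (f z.re : ℂ)) ((a, b) : Mat n A × Mat m A) = (cfc f a, cfc f b) := by
    rw [cfc_real_eq_complex f ha, cfc_real_eq_complex f hb]
    exact cfc_map_prod (S := ℂ) _ a b hfc.continuousOn hab.isStarNormal ha.isStarNormal
      hb.isStarNormal
  have h1 : IsSelfAdjoint (a.directSum b) := hab.map (directSumHom A n m)
  rw [cfc_real_eq_complex f h1]
  refine h2.symm.trans ?_
  rw [h3]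
  rfl

/-- Quasitraces are additive on direct sums, whose summands are orthogonal and hence commute. -/
lemma NormalizedQuasitrace.directSum (τ : NormalizedQuasitrace A) {n m : ℕ} {a : Mat n A}
    {b : Mat m A} (ha : 0 ≤ a) (hb : 0 ≤ b) :
    τ.toFun (n + m) (a.directSum b) = τ.toFun n a + τ.toFun m b := by
  have h1 : a.directSum b = a.directSum (0 : Mat m A) + (0 : Mat n A).directSum b := by
    have : a.directSum (0 : Mat m A) + (0 : Mat n A).directSum b =
      Mat.of (blockSum (a.entries + 0) (0 + b.entries)) := blockSum_add _ _ _ _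
    rw [this, add_zero, zero_add]; rfl
  have hl : (0 : Mat m A) ≤ 0 := le_rfl
  have hl' : (0 : Mat n A) ≤ 0 := le_rfl
  have hz : a.directSum (0 : Mat m A) * (0 : Mat n A).directSum b = 0 ∧
      (0 : Mat n A).directSum b * a.directSum (0 : Mat m A) = 0 := by
    constructor
    · refine (blockSum_mul _ _ _ _).trans ?_
      change Mat.of (blockSum (a.entries * 0) (0 * b.entries)) = 0
      simp [blockSum]; rfl
    · refine (blockSum_mul _ _ _ _).trans ?_
      change Mat.of (blockSum (0 * a.entries) (b.entries * 0)) = 0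
      simp [blockSum]; rfl
  rw [h1, (τ.isQuasitrace _).map_add (.of_nonneg (Mat.directSum_nonneg ha hl))
    (.of_nonneg (Mat.directSum_nonneg hl' hb)) (hz.1.trans hz.2.symm)]
  congr 1
  · obtain ⟨c, rfl⟩ := CStarAlgebra.nonneg_iff_eq_mul_star_self.mp ha
    have h2 := τ.conjTranspose_mul_comm (inlMatrix A n m * c.entries)
    have h3 : (inlMatrix A n m * c.entries)ᴴ * (inlMatrix A n m * c.entries) =
        (star c * c).entries := by
      have := inl_blockSum_inl (1 : Matrix (Fin n) (Fin n) A) (1 : Matrix (Fin m) (Fin m) A)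
      rw [blockSum_one, Matrix.mul_one] at this
      rw [Matrix.conjTranspose_mul, Matrix.mul_assoc, ← Matrix.mul_assoc _ _ c.entries, this,
        Matrix.one_mul]
      rfl
    have h4 : (inlMatrix A n m * c.entries) * (inlMatrix A n m * c.entries)ᴴ =
        blockSum (c * star c).entries 0 := by
      rw [Matrix.conjTranspose_mul, ← inlMatrix_mul_mul, Mat.entries_mul, Mat.entries_star]
      simp only [Matrix.mul_assoc]
    rw [h3, h4] at h2
    exact h2.symm.trans ((τ.isQuasitrace n).comm c)
  · obtain ⟨c, rfl⟩ := CStarAlgebra.nonneg_iff_eq_mul_star_self.mp hb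
    have h2 := τ.conjTranspose_mul_comm (inrMatrix A n m * c.entries)
    have h3 : (inrMatrix A n m * c.entries)ᴴ * (inrMatrix A n m * c.entries) =
        (star c * c).entries := by
      have := inr_blockSum_inr (1 : Matrix (Fin n) (Fin n) A) (1 : Matrix (Fin m) (Fin m) A)
      rw [blockSum_one, Matrix.mul_one] at this
      rw [Matrix.conjTranspose_mul, Matrix.mul_assoc, ← Matrix.mul_assoc _ _ c.entries, this,
        Matrix.one_mul]
      rfl
    have h4 : (inrMatrix A n m * c.entries) * (inrMatrix A n m * c.entries)ᴴ =
        blockSum 0 (c * star c).entries := by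
      rw [Matrix.conjTranspose_mul, ← inrMatrix_mul_mul, Mat.entries_mul, Mat.entries_star]
      simp only [Matrix.mul_assoc]
    rw [h3, h4] at h2
    exact h2.symm.trans ((τ.isQuasitrace m).comm c)

lemma NormalizedQuasitrace.map_one (τ : NormalizedQuasitrace A) (n : ℕ) :
    τ.toFun n 1 = n := by
  induction n with
  | zero =>
    have h : (1 : Mat 0 A) = 0 := Mat.of.symm.injective (by ext i; exact i.elim0)
    rw [h, (τ.isQuasitrace 0).map_zero, Nat.cast_zero]
  | succ n ih =>
    have h : (1 : Mat (n + 1) A) = (1 : Mat n A).directSum (1 : Mat 1 A) := blockSum_one.symm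
    rw [h, τ.directSum zero_le_one zero_le_one, ih, τ.normalized]
    push_cast; rfl

end Trace

/-! ### The rank of a positive element -/

section Dimension

variable {A : Type*} [CStarAlgebra A] [PartialOrder A] [StarOrderedRing A]

lemma Mat.conj_mono {n m : ℕ} (x : Matrix (Fin m) (Fin n) A) {a b : Mat m A} (h : a ≤ b) :
    Mat.conj x a ≤ Mat.conj x b := by
  have h1 : Mat.conj x b = Mat.conj x a + Mat.conj x (b - a) := by
    rw [← Mat.conj_add, add_sub_cancel]
  rw [h1]
  exact le_add_of_nonneg_right (Mat.conj_nonneg x (sub_nonneg.mpr h))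

lemma le_one_of_mul_self_le {B : Type*} [CStarAlgebra B] [PartialOrder B] [StarOrderedRing B]
    {p : B} (hp : 0 ≤ p) (h : p * p ≤ p) : p ≤ 1 := by
  have hs := IsSelfAdjoint.of_nonneg hp
  have h0 : 0 ≤ p * p := by
    have := star_mul_self_nonneg p
    rwa [hs.star_eq] at this
  have h1 := CStarAlgebra.norm_le_norm_of_nonneg_of_le h0 h
  have h2 : ‖p * p‖ = ‖p‖ * ‖p‖ := by
    have := CStarRing.norm_star_mul_self (x := p)
    rwa [hs.star_eq] at this
  rw [h2] at h1
  refine (CStarAlgebra.norm_le_one_iff_of_nonneg p).mp ?_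
  nlinarith [norm_nonneg p]

lemma mul_conjTranspose_le_one {n m : ℕ} {w : Matrix (Fin m) (Fin n) A}
    (h : Mat.of (wᴴ * w) ≤ 1) : Mat.of (w * wᴴ) ≤ 1 := by
  have h0 := conjTranspose_mul_self_nonneg wᴴ
  rw [Matrix.conjTranspose_conjTranspose] at h0
  refine le_one_of_mul_self_le h0 ?_
  have h1 := Mat.conj_mono wᴴ h
  have h2 : Mat.conj wᴴ (Mat.of (wᴴ * w)) = Mat.of (w * wᴴ) * Mat.of (w * wᴴ) := by
    change Mat.of (wᴴᴴ * (wᴴ * w) * wᴴ) = Mat.of ((w * wᴴ) * (w * wᴴ))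
    simp only [Matrix.conjTranspose_conjTranspose, Matrix.mul_assoc]
  have h3 : Mat.conj wᴴ (1 : Mat n A) = Mat.of (w * wᴴ) := by
    change Mat.of (wᴴᴴ * 1 * wᴴ) = _
    rw [Matrix.conjTranspose_conjTranspose, Matrix.mul_one]
  rwa [h2, h3] at h1

/-- If `w⋆ w` is a contraction and `f` acts as a left unit on `w`, then `τ(w⋆ w) ≤ τ(f)`. -/
lemma NormalizedQuasitrace.re_le_of_mul_eq (τ : NormalizedQuasitrace A) {n m : ℕ}
    {w : Matrix (Fin m) (Fin n) A} {f : Mat m A} (hw : Mat.of (wᴴ * w) ≤ 1) (hf : 0 ≤ f)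
    (hf1 : f ≤ 1) (h : f.entries * w = w) :
    (τ.toFun n (Mat.of (wᴴ * w))).re ≤ (τ.toFun m f).re := by
  rw [τ.conjTranspose_mul_comm]
  have h0 := conjTranspose_mul_self_nonneg wᴴ
  rw [Matrix.conjTranspose_conjTranspose] at h0
  refine (τ.isQuasitrace m).re_le_of_mul_eq h0 (mul_conjTranspose_le_one hw) hf hf1 ?_
  change Mat.of (f.entries * (w * wᴴ)) = _
  rw [← Matrix.mul_assoc, h]

/-- The value `τ(g_δ(a))` of a quasitrace on the cut-down of `a` by the function `ramp δ`. -/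
noncomputable def NormalizedQuasitrace.cut (τ : NormalizedQuasitrace A) (δ : ℝ) (a : PosMat A) :
    ℝ :=
  (τ.toFun a.size (cfc (ramp δ) a.val)).re

/-- The rank of `a` with respect to `τ`, i.e. the supremum of the values `τ(g_δ(a))`, taken
over `δ = 2⁻ʲ`. -/
noncomputable def NormalizedQuasitrace.rank (τ : NormalizedQuasitrace A) (a : PosMat A) : ℝ :=
  ⨆ j : ℕ, τ.cut ((1 / 2) ^ j) a

namespace NormalizedQuasitrace

variable (τ : NormalizedQuasitrace A)

lemma cut_nonneg (δ : ℝ) (a : PosMat A) : 0 ≤ τ.cut δ a :=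
  (τ.isQuasitrace _).re_nonneg (cfc_ramp_nonneg _ _)

lemma cut_le_size (δ : ℝ) (a : PosMat A) : τ.cut δ a ≤ a.size := by
  have h := (τ.isQuasitrace a.size).re_le_of_le_smul_one (cfc_predicate (ramp δ) a.val) (c := 1)
    (by simpa using cfc_ramp_le_one a.val δ)
  simpa [τ.map_one, cut] using h

lemma cut_anti {δ δ' : ℝ} (hδ' : 0 < δ') (h : δ' ≤ δ) (a : PosMat A) : τ.cut δ a ≤ τ.cut δ' a :=
  (τ.isQuasitrace _).re_cfc_mono (continuous_ramp δ) (continuous_ramp δ') fun _ ht =>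
    ramp_le_ramp (spectrum_nonneg_of_nonneg a.nonneg ht) hδ' h

lemma bddAbove_cut (a : PosMat A) : BddAbove (Set.range fun j : ℕ => τ.cut ((1 / 2) ^ j) a) :=
  ⟨a.size, by rintro _ ⟨j, rfl⟩; exact τ.cut_le_size _ a⟩

lemma cut_le_rank {δ : ℝ} (hδ : 0 < δ) (a : PosMat A) : τ.cut δ a ≤ τ.rank a := by
  obtain ⟨j, hj⟩ := exists_pow_lt_of_lt_one hδ (show (1 / 2 : ℝ) < 1 by norm_num)
  exact (τ.cut_anti (by positivity) hj.le a).trans (le_ciSup (τ.bddAbove_cut a) j)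

lemma rank_le {a : PosMat A} {c : ℝ} (h : ∀ δ > 0, τ.cut δ a ≤ c) : τ.rank a ≤ c :=
  ciSup_le fun j => h _ (by positivity)

lemma tendsto_cut (a : PosMat A) :
    Filter.Tendsto (fun j : ℕ => τ.cut ((1 / 2) ^ j) a) Filter.atTop (𝓝 (τ.rank a)) := by
  refine tendsto_atTop_ciSup (fun i j hij => τ.cut_anti (by positivity) ?_ a) (τ.bddAbove_cut a)
  exact pow_le_pow_of_le_one (by norm_num) (by norm_num) hij

lemma rank_nonneg (a : PosMat A) : 0 ≤ τ.rank a :=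
  (τ.cut_nonneg 1 a).trans (τ.cut_le_rank one_pos a)

/-- The number `δ` depends on `a`, `b` and `ε` only, not on the quasitrace. -/
lemma cut_le_cut_of_cuntzLE {a b : PosMat A} (h : CuntzLE a b) {ε : ℝ} (hε : 0 < ε) :
    ∃ δ > 0, ∀ τ : NormalizedQuasitrace A, τ.cut ε a ≤ τ.cut δ b := by
  obtain ⟨δ, hδ, w, hw, hfw⟩ := h.exists_factor hε
  refine ⟨δ, hδ, fun τ => ?_⟩
  have := τ.re_le_of_mul_eq (w := w) (f := cfc (ramp δ) b.val)
    (by rw [hw]; exact cfc_ramp_le_one _ _) (cfc_ramp_nonneg _ _) (cfc_ramp_le_one _ _) hfw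
  rwa [hw] at this

lemma rank_mono {a b : PosMat A} (h : CuntzLE a b) : τ.rank a ≤ τ.rank b := by
  refine τ.rank_le fun ε hε => ?_
  obtain ⟨δ, hδ, hle⟩ := cut_le_cut_of_cuntzLE h hε
  exact (hle τ).trans (τ.cut_le_rank hδ b)

lemma cut_add (δ : ℝ) (a b : PosMat A) : τ.cut δ (a + b) = τ.cut δ a + τ.cut δ b := by
  have h : cfc (ramp δ) (a + b).val = (cfc (ramp δ) a.val).directSum (cfc (ramp δ) b.val) :=
    cfc_directSum (.of_nonneg a.nonneg) (.of_nonneg b.nonneg) (continuous_ramp δ)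
  unfold cut
  rw [h]
  have h2 := τ.directSum (cfc_ramp_nonneg a.val δ) (cfc_ramp_nonneg b.val δ)
  rw [← Complex.add_re, ← h2]
  rfl

lemma rank_add (a b : PosMat A) : τ.rank (a + b) = τ.rank a + τ.rank b := by
  refine tendsto_nhds_unique (τ.tendsto_cut (a + b)) ?_
  simp only [cut_add]
  exact (τ.tendsto_cut a).add (τ.tendsto_cut b)

lemma cut_zero (δ : ℝ) : τ.cut δ (0 : PosMat A) = 0 :=
  le_antisymm (by simpa using! τ.cut_le_size δ (0 : PosMat A)) (τ.cut_nonneg δ 0)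

lemma rank_zero : τ.rank (0 : PosMat A) = 0 :=
  le_antisymm (τ.rank_le fun δ _ => (τ.cut_zero δ).le)
    (τ.rank_nonneg 0)

/-- The functional on the Cuntz semigroup induced by a quasitrace. -/
noncomputable def rankHom : CuntzSemigroup A →+ ℝ where
  toFun := Quotient.lift τ.rank fun _ _ h => le_antisymm (τ.rank_mono h.1) (τ.rank_mono h.2)
  map_zero' := τ.rank_zero
  map_add' := by
    rintro ⟨a⟩ ⟨b⟩
    exact τ.rank_add a b

lemma rankHom_cuntzClass (a : PosMat A) : τ.rankHom (cuntzClass a) = τ.rank a := rfl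

lemma rankHom_mono {x y : CuntzSemigroup A} (h : x ≤ y) : τ.rankHom x ≤ τ.rankHom y := by
  obtain ⟨a, rfl⟩ := cuntzClass_surjective x
  obtain ⟨b, rfl⟩ := cuntzClass_surjective y
  exact τ.rank_mono (cuntzClass_le_iff.mp h)

lemma eval_le_cut_add {a : PosMat A} (ha : ‖a.val‖ ≤ 1) {δ : ℝ} (hδ : 0 < δ) :
    τ.eval a ≤ τ.cut δ a + δ * a.size := by
  have hs := IsSelfAdjoint.of_nonneg a.nonneg
  have h1 := (τ.isQuasitrace a.size).re_cfc_mono (a := a.val) continuous_id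
    ((continuous_ramp δ).add continuous_const) (g := fun t => ramp δ t + δ)
    fun t ht => le_ramp_add hδ ((spectrum_le_norm ht).trans ha)
  rw [(τ.isQuasitrace a.size).re_cfc_add_const hs (continuous_ramp δ), cfc_id ℝ a.val,
    τ.map_one] at h1
  exact h1

lemma eval_le_rank {a : PosMat A} (ha : ‖a.val‖ ≤ 1) : τ.eval a ≤ τ.rank a := by
  have h : Filter.Tendsto (fun j : ℕ => τ.cut ((1 / 2) ^ j) a + (1 / 2) ^ j * a.size) Filter.atTop
      (𝓝 (τ.rank a + 0 * a.size)) :=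
    (τ.tendsto_cut a).add ((tendsto_pow_atTop_nhds_zero_of_lt_one (by norm_num)
      (by norm_num)).mul_const _)
  have h2 := ge_of_tendsto' h fun j =>
    τ.eval_le_cut_add ha (show (0 : ℝ) < (1 / 2) ^ j by positivity)
  simpa using h2

lemma rpow_le_cut_add {a : PosMat A} (ha : ‖a.val‖ ≤ 1) {δ r : ℝ} (hδ : 0 < δ) (hr : 0 < r) :
    (τ.toFun a.size (a.val ^ r)).re ≤ τ.cut δ a + δ ^ r * a.size := by
  have hs := IsSelfAdjoint.of_nonneg a.nonneg
  rw [CFC.rpow_eq_cfc_real a.nonneg]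
  have h1 := (τ.isQuasitrace a.size).re_cfc_mono (a := a.val) (f := fun t => t ^ r)
    (Real.continuous_rpow_const hr.le) ((continuous_ramp δ).add continuous_const)
    (g := fun t => ramp δ t + δ ^ r) fun t ht => by
      have ht0 := spectrum_nonneg_of_nonneg a.nonneg ht
      rcases le_total δ t with h | h
      · rw [ramp_eq_one hδ h]
        have := Real.rpow_le_one ht0 ((spectrum_le_norm ht).trans ha) hr.le
        have := Real.rpow_nonneg hδ.le r
        linarith
      · have := Real.rpow_le_rpow ht0 h hr.le
        have := ramp_nonneg δ t
        linarith
  rw [(τ.isQuasitrace a.size).re_cfc_add_const hs (continuous_ramp δ), τ.map_one] at h1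
  exact h1

lemma cut_le_rpow (a : PosMat A) {δ r : ℝ} (hδ : 0 < δ) (hr : 0 < r) :
    (δ / 2) ^ r * τ.cut δ a ≤ (τ.toFun a.size (a.val ^ r)).re := by
  rw [CFC.rpow_eq_cfc_real a.nonneg, cut,
    ← (τ.isQuasitrace a.size).re_cfc_const_mul _ (continuous_ramp δ)]
  refine (τ.isQuasitrace a.size).re_cfc_mono (by fun_prop) (Real.continuous_rpow_const hr.le)
    fun t ht => ?_
  have ht0 := spectrum_nonneg_of_nonneg a.nonneg ht
  by_cases h0 : ramp δ t = 0
  · rw [h0, mul_zero]; exact Real.rpow_nonneg ht0 r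
  · have h2 := half_lt_of_ramp_ne_zero hδ h0
    have h3 := Real.rpow_le_rpow (by positivity) h2.le hr.le
    have h4 := Real.rpow_nonneg (show 0 ≤ δ / 2 by positivity) r
    exact (mul_le_of_le_one_right h4 (ramp_le_one δ t)).trans h3

lemma tendsto_rpow_one_div {δ : ℝ} (hδ : 0 < δ) :
    Filter.Tendsto (fun n : ℕ => δ ^ (1 / (n + 1 : ℝ))) Filter.atTop (𝓝 1) := by
  have h := (Real.continuousAt_const_rpow hδ.ne' (b := 0)).tendsto.comp
    tendsto_one_div_add_atTop_nhds_zero_nat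
  simpa using! h

lemma rpow_le_rank {a : PosMat A} (ha : ‖a.val‖ ≤ 1) {r : ℝ} (hr : 0 < r) :
    (τ.toFun a.size (a.val ^ r)).re ≤ τ.rank a := by
  have h0 : Filter.Tendsto (fun j : ℕ => ((1 / 2 : ℝ) ^ j) ^ r) Filter.atTop (𝓝 0) := by
    have := (tendsto_pow_atTop_nhds_zero_of_lt_one (r := (1 / 2 : ℝ)) (by norm_num)
      (by norm_num)).rpow_const (p := r) (Or.inr hr.le)
    rwa [Real.zero_rpow hr.ne'] at this
  have h := (τ.tendsto_cut a).add (h0.mul_const (a.size : ℝ))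
  have h2 := ge_of_tendsto' h fun j => τ.rpow_le_cut_add ha
    (show (0 : ℝ) < (1 / 2) ^ j by positivity) hr
  simpa using h2

/-- On contractions, the dimension function `d_τ` is the rank. -/
lemma dim_eq_rank {a : PosMat A} (ha : ‖a.val‖ ≤ 1) : τ.dim a = τ.rank a := by
  refine Filter.Tendsto.limUnder_eq (tendsto_order.mpr ⟨fun c hc => ?_, fun c hc => ?_⟩)
  · obtain ⟨j, hj⟩ := ((τ.tendsto_cut a).eventually_const_lt hc).exists
    have hδ : (0 : ℝ) < (1 / 2) ^ j := by positivity
    have h := (tendsto_rpow_one_div (half_pos hδ)).mul_const (τ.cut ((1 / 2) ^ j) a)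
    rw [one_mul] at h
    filter_upwards [h.eventually_const_lt hj] with n hn
    exact hn.trans_le (τ.cut_le_rpow a hδ (by positivity))
  · exact Filter.Eventually.of_forall fun n => (τ.rpow_le_rank ha (by positivity)).trans_lt hc

end NormalizedQuasitrace
end Dimension

/-! ### Construction of maps of order zero -/

section MatrixUnits

variable {B : Type*} [CStarAlgebra B] [PartialOrder B] [StarOrderedRing B] {k : ℕ}

/-- The linear map `M_k(ℂ) → B` given by `e_ij ↦ u_i b u_j⋆`. -/
noncomputable def rowMap (u : Fin k → B) (b : B) : Mat k ℂ →ₗ[ℂ] B where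
  toFun x := ∑ i, ∑ j, x.entries i j • (u i * b * star (u j))
  map_add' x y := by
    simp only [← Finset.sum_add_distrib]
    refine Finset.sum_congr rfl fun i _ => Finset.sum_congr rfl fun j _ => ?_
    rw [← add_smul]; rfl
  map_smul' c x := by
    simp only [Finset.smul_sum, RingHom.id_apply]
    refine Finset.sum_congr rfl fun i _ => Finset.sum_congr rfl fun j _ => ?_
    rw [← mul_smul]; rfl

lemma rowMap_apply (u : Fin k → B) (b : B) (x : Mat k ℂ) :
    rowMap u b x = ∑ i, ∑ j, x.entries i j • (u i * b * star (u j)) := rfl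

lemma rowMap_one (u : Fin k → B) (b : B) : rowMap u b 1 = ∑ i, u i * b * star (u i) := by
  rw [rowMap_apply]
  refine Finset.sum_congr rfl fun i _ => ?_
  rw [Finset.sum_eq_single i]
  · have : (1 : Mat k ℂ).entries i i = 1 := Matrix.one_apply_eq i
    rw [this, one_smul]
  · intro j _ hj
    have : (1 : Mat k ℂ).entries i j = 0 := Matrix.one_apply_ne hj.symm
    rw [this, zero_smul]
  · simp

lemma star_rowMap (u : Fin k → B) {b : B} (hb : IsSelfAdjoint b) (x : Mat k ℂ) :
    star (rowMap u b x) = rowMap u b (star x) := by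
  rw [rowMap_apply, rowMap_apply, star_sum, Finset.sum_comm]
  simp only [star_sum]
  rw [Finset.sum_comm]
  rw [Finset.sum_comm]
  refine Finset.sum_congr rfl fun i _ => Finset.sum_congr rfl fun j _ => ?_
  rw [star_smul, star_mul, star_mul, star_star, hb.star_eq, mul_assoc]
  rfl

lemma rowMap_mul_of_orthogonal {u v : Fin k → B} (h : ∀ i j, star (u i) * v j = 0) (b c : B)
    (x y : Mat k ℂ) : rowMap u b x * rowMap v c y = 0 := by
  rw [rowMap_apply, rowMap_apply, Finset.sum_mul]
  refine Finset.sum_eq_zero fun i _ => ?_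
  rw [Finset.sum_mul]
  refine Finset.sum_eq_zero fun j _ => ?_
  rw [Finset.mul_sum]
  refine Finset.sum_eq_zero fun i' _ => ?_
  rw [Finset.mul_sum]
  refine Finset.sum_eq_zero fun j' _ => ?_
  rw [smul_mul_smul_comm]
  have : u i * b * star (u j) * (v i' * c * star (v j')) =
      u i * b * (star (u j) * v i') * c * star (v j') := by simp only [mul_assoc]
  rw [this, h]
  simp

lemma rowMap_mul_rowMap {u : Fin k → B} {c : B}
    (h : ∀ i j, star (u i) * u j = if i = j then c else 0) (x y : Mat k ℂ) :
    rowMap u 1 x * rowMap u 1 y = rowMap u c (x * y) := by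
  have hxy : ∀ i j, (x * y).entries i j = ∑ l, x.entries i l * y.entries l j := fun i j =>
    Matrix.mul_apply (M := x.entries) (N := y.entries)
  simp only [rowMap_apply, hxy, mul_one]
  rw [Finset.sum_mul]
  refine Finset.sum_congr rfl fun i _ => ?_
  rw [Finset.sum_mul]
  simp only [Finset.sum_smul]
  conv_rhs => rw [Finset.sum_comm]
  refine Finset.sum_congr rfl fun j _ => ?_
  rw [Finset.mul_sum, Finset.sum_eq_single j]
  · rw [Finset.mul_sum]
    refine Finset.sum_congr rfl fun j' _ => ?_
    rw [smul_mul_smul_comm]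
    congr 1
    have : u i * star (u j) * (u j * star (u j')) = u i * (star (u j) * u j) * star (u j') := by
      simp only [mul_assoc]
    rw [this, h, if_pos rfl]
  · intro i' _ hi'
    rw [Finset.mul_sum]
    refine Finset.sum_eq_zero fun j' _ => ?_
    rw [smul_mul_smul_comm]
    have : u i * star (u j) * (u i' * star (u j')) = u i * (star (u j) * u i') * star (u j') := by
      simp only [mul_assoc]
    rw [this, h, if_neg hi'.symm]
    simp
  · simp

/-- Complete positivity of `e_ij ↦ u_i u_j⋆`: applied to the entries of `C⋆ C` it gives
`∑ X_m⋆ X_m`, where the entries of `X_m` are `∑_j (C_qs)_mj u_j⋆`. -/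
lemma rowMap_completelyPositive (u : Fin k → B) (p : ℕ)
    (M : CStarMatrix (Fin p) (Fin p) (Mat k ℂ)) (hM : 0 ≤ M) : 0 ≤ M.map (rowMap u 1) := by
  have hM' : (0 : Mat p (Mat k ℂ)) ≤ Mat.of M := hM
  obtain ⟨C, hC⟩ := CStarAlgebra.nonneg_iff_eq_star_mul_self.mp hM'
  let X : Fin k → Mat p B := fun m =>
    Mat.of (Matrix.of fun q s => ∑ j, (C.entries q s).entries m j • star (u j))
  have h : (Mat.of (M.map (rowMap u 1)) : Mat p B) = ∑ m, star (X m) * X m := by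
    apply Mat.of.symm.injective
    have h1 : Mat.of.symm (∑ m, star (X m) * X m) = ∑ m, (X m).entriesᴴ * (X m).entries := rfl
    rw [h1]
    ext r s
    rw [Matrix.sum_apply]
    have hM : M r s = ∑ q, star (C.entries q r) * C.entries q s := by
      have : (Mat.of M).entries r s = (C.entriesᴴ * C.entries) r s := by rw [hC]; rfl
      rw [Matrix.mul_apply] at this
      exact this
    have hX : ∀ m, ((X m).entriesᴴ * (X m).entries) r s =
        ∑ q, star ((X m).entries q r) * (X m).entries q s := fun m => Matrix.mul_apply
    change rowMap u 1 (M r s) = _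
    simp only [hM, hX, map_sum]
    rw [Finset.sum_comm]
    refine Finset.sum_congr rfl fun q _ => ?_
    have hq : ∀ i j, (star (C.entries q r) * C.entries q s).entries i j =
        ∑ m, star ((C.entries q r).entries m i) * (C.entries q s).entries m j := fun i j =>
      Matrix.mul_apply (M := (C.entries q r).entriesᴴ) (N := (C.entries q s).entries)
    have hXe : ∀ m q s, (X m).entries q s = ∑ j, (C.entries q s).entries m j • star (u j) :=
      fun _ _ _ => rfl
    rw [rowMap_apply]
    simp only [hq, hXe, mul_one, star_sum, star_smul, star_star, Finset.sum_mul, Finset.mul_sum,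
      Finset.sum_smul, smul_mul_smul_comm]
    conv_lhs => enter [2, i]; rw [Finset.sum_comm]
    rw [Finset.sum_comm]
    refine Finset.sum_congr rfl fun m _ => ?_
    rw [Finset.sum_comm]
  change (0 : Mat p B) ≤ Mat.of (M.map (rowMap u 1))
  rw [h]
  exact Finset.sum_nonneg fun m _ => star_mul_self_nonneg _

lemma rowMap_nonneg (u : Fin k → B) {x : Mat k ℂ} (hx : 0 ≤ x) : 0 ≤ rowMap u 1 x := by
  obtain ⟨c, rfl⟩ := CStarAlgebra.nonneg_iff_eq_star_mul_self.mp hx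
  have hq : ∀ i j, (star c * c).entries i j = ∑ m, star (c.entries m i) * c.entries m j :=
    fun i j => Matrix.mul_apply (M := c.entriesᴴ) (N := c.entries)
  have : rowMap u 1 (star c * c) =
      ∑ m, star (∑ j, c.entries m j • star (u j)) * ∑ j, c.entries m j • star (u j) := by
    rw [rowMap_apply]
    simp only [hq, mul_one, star_sum, star_smul, star_star, Finset.sum_mul, Finset.mul_sum,
      Finset.sum_smul, smul_mul_smul_comm]
    conv_lhs => enter [2, i]; rw [Finset.sum_comm]
    rw [Finset.sum_comm]
    refine Finset.sum_congr rfl fun m _ => ?_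
    rw [Finset.sum_comm]
  rw [this]
  exact Finset.sum_nonneg fun m _ => star_mul_self_nonneg _

lemma rowMap_eq_of_sqrt (u : Fin k → B) {c s : B} (hs : IsSelfAdjoint s) (h : s * s = c) :
    rowMap u c = rowMap (fun i => u i * s) 1 := by
  ext x
  simp only [rowMap_apply, mul_one, star_mul, hs.star_eq, ← h, mul_assoc]

/-- The map `x ↦ ∑_l ∑_ij x_ij u_il u_jl⋆` of order zero defined by a system of elements `u_il`
with `u_il⋆ u_jm = δ_ij δ_lm c`. -/
noncomputable def orderZeroMap {N : ℕ} (u : Fin k → Fin N → B) :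
    CompletelyPositiveMap (Mat k ℂ) B where
  toLinearMap := ∑ l, rowMap (fun i => u i l) 1
  map_cstarMatrix_nonneg' p M hM := by
    have h : (Mat.of (M.map (∑ l, rowMap (fun i => u i l) 1 : Mat k ℂ →ₗ[ℂ] B)) : Mat p B) =
        ∑ l, Mat.of (M.map (rowMap (fun i => u i l) 1)) := by
      apply Mat.of.symm.injective
      have h1 : Mat.of.symm (∑ l, Mat.of (M.map (rowMap (fun i => u i l) 1))) =
        ∑ l, Matrix.of (fun r s => rowMap (fun i => u i l) 1 (M r s)) := rfl
      rw [h1]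
      ext r s
      rw [Matrix.sum_apply]
      exact LinearMap.sum_apply _ _ _
    change (0 : Mat p B) ≤ Mat.of (M.map (∑ l, rowMap (fun i => u i l) 1 : Mat k ℂ →ₗ[ℂ] B))
    rw [h]
    exact Finset.sum_nonneg fun l _ => rowMap_completelyPositive _ p M hM

lemma orderZeroMap_apply {N : ℕ} (u : Fin k → Fin N → B) (x : Mat k ℂ) :
    orderZeroMap u x = ∑ l, rowMap (fun i => u i l) 1 x :=
  LinearMap.sum_apply _ _ _

section OrderZero

variable {N : ℕ} {u : Fin k → Fin N → B} {c : B}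

lemma orderZeroMap_mul
    (h : ∀ i l j m, star (u i l) * u j m = if i = j ∧ l = m then c else 0) (x y : Mat k ℂ) :
    orderZeroMap u x * orderZeroMap u y = ∑ l, rowMap (fun i => u i l) c (x * y) := by
  rw [orderZeroMap_apply, orderZeroMap_apply, Finset.sum_mul]
  refine Finset.sum_congr rfl fun l _ => ?_
  rw [Finset.mul_sum, Finset.sum_eq_single l]
  · exact rowMap_mul_rowMap (fun i j => by rw [h]; simp) x y
  · intro m _ hm
    exact rowMap_mul_of_orthogonal (fun i j => by rw [h]; simp [hm.symm]) _ _ _ _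
  · simp

/-- The product of two values of `orderZeroMap u` at `x` and `y` depends on `x y` only, whence
orthogonality is preserved. -/
lemma isContractiveOrderZero_orderZeroMap (hc : 0 ≤ c) (hc1 : c ≤ 1)
    (h : ∀ i l j m, star (u i l) * u j m = if i = j ∧ l = m then c else 0) :
    IsContractiveOrderZero (orderZeroMap u) := by
  obtain ⟨s, hs, hss⟩ : ∃ s : B, IsSelfAdjoint s ∧ s * s = c :=
    ⟨CFC.sqrt c, IsSelfAdjoint.of_nonneg (CFC.sqrt_nonneg c), CFC.sqrt_mul_sqrt_self c⟩
  set Φ : Mat k ℂ → B := fun x => ∑ l, rowMap (fun i => u i l) c x with hΦ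
  have hΦnn : ∀ x, 0 ≤ x → 0 ≤ Φ x := fun x hx => Finset.sum_nonneg fun l _ => by
    rw [rowMap_eq_of_sqrt _ hs hss]
    exact rowMap_nonneg _ hx
  have hstar : ∀ x, star (orderZeroMap u x) = orderZeroMap u (star x) := fun x => by
    rw [orderZeroMap_apply, orderZeroMap_apply, star_sum]
    exact Finset.sum_congr rfl fun l _ => star_rowMap _ (IsSelfAdjoint.one B) x
  have hone : 0 ≤ orderZeroMap u 1 := by
    rw [orderZeroMap_apply]
    exact Finset.sum_nonneg fun l _ => rowMap_nonneg _ zero_le_one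
  have hone' : orderZeroMap u 1 ≤ 1 := by
    refine le_one_of_mul_self_le hone ?_
    rw [orderZeroMap_mul h, orderZeroMap_apply, mul_one]
    refine Finset.sum_le_sum fun l _ => ?_
    rw [rowMap_one, rowMap_one]
    refine Finset.sum_le_sum fun i _ => ?_
    exact star_right_conjugate_le_conjugate hc1 (u i l)
  have hone'' : ‖orderZeroMap u 1‖ ≤ 1 := (CStarAlgebra.norm_le_one_iff_of_nonneg _).mpr hone'
  refine ⟨fun x => ?_, fun x y _ _ hxy => ?_⟩
  · have h1 : star (orderZeroMap u x) * orderZeroMap u x = Φ (star x * x) := by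
      rw [hstar, orderZeroMap_mul h]
    have h2 : Φ 1 = orderZeroMap u 1 * orderZeroMap u 1 := by rw [orderZeroMap_mul h, mul_one]
    have h3 : Φ (star x * x) ≤ (‖x‖ ^ 2 : ℝ) • Φ 1 := by
      have h4 : 0 ≤ algebraMap ℝ (Mat k ℂ) (‖x‖ ^ 2) - star x * x :=
        sub_nonneg.mpr CStarAlgebra.star_mul_le_algebraMap_norm_sq
      have h5 := hΦnn _ h4
      have h6 : Φ (algebraMap ℝ (Mat k ℂ) (‖x‖ ^ 2) - star x * x) =
          (‖x‖ ^ 2 : ℝ) • Φ 1 - Φ (star x * x) := by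
        simp only [hΦ, map_sub, Finset.sum_sub_distrib, Algebra.algebraMap_eq_smul_one,
          Finset.smul_sum]
        congr 1
        refine Finset.sum_congr rfl fun l _ => ?_
        have := (rowMap (fun i => u i l) c).map_smul ((‖x‖ ^ 2 : ℝ) : ℂ) 1
        rwa [Complex.coe_smul, Complex.coe_smul] at this
      rw [h6] at h5
      exact sub_nonneg.mp h5
    have h7 : ‖orderZeroMap u x‖ ^ 2 ≤ ‖x‖ ^ 2 := by
      rw [sq ‖orderZeroMap u x‖, ← CStarRing.norm_star_mul_self, h1]
      refine (CStarAlgebra.norm_le_norm_of_nonneg_of_le (hΦnn _ (star_mul_self_nonneg x))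
        h3).trans ?_
      rw [norm_smul, Real.norm_of_nonneg (sq_nonneg _), h2]
      refine mul_le_of_le_one_right (sq_nonneg _) ((norm_mul_le _ _).trans ?_)
      exact mul_le_one₀ hone'' (norm_nonneg _) hone''
    exact (pow_le_pow_iff_left₀ (norm_nonneg _) (norm_nonneg _) two_ne_zero).mp h7
  · rw [orderZeroMap_mul h, hxy]
    simp

end OrderZero

end MatrixUnits

/-! ### From almost divisibility to tracial almost divisibility -/

section Divisible

variable {A : Type*} [CStarAlgebra A] [PartialOrder A] [StarOrderedRing A]

lemma cfc_ramp_add (δ : ℝ) (a b : PosMat A) :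
    (cfc (ramp δ) (a + b).val).entries =
      blockSum (cfc (ramp δ) a.val).entries (cfc (ramp δ) b.val).entries :=
  congrArg Mat.entries
    (cfc_directSum (.of_nonneg a.nonneg) (.of_nonneg b.nonneg) (continuous_ramp δ))

/-- A representative of `K ⟨e⟩` with the isometries onto its `K` diagonal blocks. -/
lemma exists_nsmul_representative (e : PosMat A) (K : ℕ) :
    ∃ (F : PosMat A) (J : Fin K → Matrix (Fin F.size) (Fin e.size) A),
      cuntzClass F = K • cuntzClass e ∧
      (∀ δ i j, (J i)ᴴ * (cfc (ramp δ) F.val).entries * J j =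
        if i = j then (cfc (ramp δ) e.val).entries else 0) ∧
      ∀ (τ : NormalizedQuasitrace A) δ, τ.cut δ F = K * τ.cut δ e := by
  induction K with
  | zero =>
    refine ⟨0, fun i => i.elim0, by rw [zero_nsmul]; rfl, fun _ i => i.elim0, fun τ δ => ?_⟩
    rw [τ.cut_zero, Nat.cast_zero, zero_mul]
  | succ K ih =>
    obtain ⟨F, J, hF, hJ, hτ⟩ := ih
    refine ⟨F + e, Fin.lastCases (inrMatrix A F.size e.size)
      fun i => inlMatrix A F.size e.size * J i, ?_, fun δ i j => ?_, fun τ δ => ?_⟩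
    · rw [cuntzClass_add, hF, succ_nsmul]
    · rw [cfc_ramp_add]
      set P := (cfc (ramp δ) F.val).entries
      set Q := (cfc (ramp δ) e.val).entries
      have hll := inl_blockSum_inl P Q
      have hlr := inl_blockSum_inr P Q
      have hrl := inr_blockSum_inl P Q
      have hrr := inr_blockSum_inr P Q
      refine Fin.lastCases ?_ (fun i => ?_) i <;> refine Fin.lastCases ?_ (fun j => ?_) j
      · simp only [Fin.lastCases_last, if_true]
        exact hrr
      · simp only [Fin.lastCases_last, Fin.lastCases_castSucc, (Fin.castSucc_lt_last j).ne',
          if_false]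
        rw [← Matrix.mul_assoc]
        refine (congrArg (· * J j) hrl).trans ?_
        exact Matrix.zero_mul _
      · simp only [Fin.lastCases_last, Fin.lastCases_castSucc, (Fin.castSucc_lt_last i).ne,
          if_false, Matrix.conjTranspose_mul, Matrix.mul_assoc]
        rw [Matrix.mul_assoc] at hlr
        refine (congrArg ((J i)ᴴ * ·) hlr).trans ?_
        exact Matrix.mul_zero _
      · simp only [Fin.lastCases_castSucc, Fin.castSucc_inj]
        rw [← hJ δ i j, Matrix.conjTranspose_mul]
        have : (J i)ᴴ * (inlMatrix A F.size e.size)ᴴ * blockSum P Q *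
            (inlMatrix A F.size e.size * J j) = (J i)ᴴ * ((inlMatrix A F.size e.size)ᴴ *
              blockSum P Q * inlMatrix A F.size e.size) * J j := by
          simp only [Matrix.mul_assoc]
        refine this.trans ?_
        rw [hll]
    · rw [τ.cut_add, hτ]
      push_cast; ring

/-- If `K ⟨e⟩ ≤ ⟨a⟩` then `her(a)` contains a system of `K` elements with orthogonal ranges, whose
common source is large compared to `e`. If `w` implements the comparison and `v_i` are the blocks of
`w`, then `v_i⋆ v_j = δ_ij g_δ(e)`; the elements `u_i = v_i v_o⋆`, for a fixed index `o`, are square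
matrices with the same kind of relations. -/
lemma exists_orthogonal_system {a e : PosMat A} {K : ℕ} (hK : 0 < K)
    (h : K • cuntzClass e ≤ cuntzClass a) {δ : ℝ} (hδ : 0 < δ) :
    ∃ (u : Fin K → Mat a.size A) (c : Mat a.size A), 0 ≤ c ∧ c ≤ 1 ∧
      (∀ i j, star (u i) * u j = if i = j then c else 0) ∧
      (∃ ρ > 0, ∀ i, cfc (ramp ρ) a.val * u i = u i) ∧
      ∀ (τ : NormalizedQuasitrace A) i,
        τ.cut (2 * δ) e ≤ (τ.toFun a.size (u i * star (u i))).re := by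
  obtain ⟨F, J, hF, hJ, -⟩ := exists_nsmul_representative e K
  rw [← hF, cuntzClass_le_iff] at h
  obtain ⟨ρ, hρ, w, hw, hρw⟩ := h.exists_factor hδ
  have hw' : wᴴ * w = (cfc (ramp δ) F.val).entries := hw
  obtain ⟨g, hg⟩ : ∃ g, g = cfc (ramp δ) e.val := ⟨_, rfl⟩
  have hg0 : 0 ≤ g := hg ▸ cfc_ramp_nonneg _ _
  have hg1 : g ≤ 1 := hg ▸ cfc_ramp_le_one _ _
  let v : Fin K → Matrix (Fin a.size) (Fin e.size) A := fun i => w * J i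
  have hv : ∀ i j, (v i)ᴴ * v j = if i = j then g.entries else 0 := fun i j => by
    rw [hg, ← hJ δ i j, ← hw']
    simp only [v, Matrix.conjTranspose_mul, Matrix.mul_assoc]
  let o : Fin K := ⟨0, hK⟩
  have hsg : g.entriesᴴ = g.entries := by
    rw [← Mat.entries_star, (IsSelfAdjoint.of_nonneg hg0).star_eq]
  have hvo : Mat.of ((v o)ᴴ * v o) ≤ 1 := by rw [hv, if_pos rfl]; exact hg1
  have hvo' : Mat.conj (v o)ᴴ (1 : Mat e.size A) ≤ 1 := by
    refine le_of_eq_of_le ?_ (mul_conjTranspose_le_one hvo)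
    change Mat.of ((v o)ᴴᴴ * 1 * (v o)ᴴ) = _
    rw [Matrix.conjTranspose_conjTranspose, Matrix.mul_one]
  refine ⟨fun i => Mat.of (v i * (v o)ᴴ), Mat.conj (v o)ᴴ g, Mat.conj_nonneg _ hg0,
    (Mat.conj_mono _ hg1).trans hvo', fun i j => ?_, ⟨ρ, hρ, fun i => ?_⟩, fun τ i => ?_⟩
  · change Mat.of ((v i * (v o)ᴴ)ᴴ * (v j * (v o)ᴴ)) = _
    have : (v i * (v o)ᴴ)ᴴ * (v j * (v o)ᴴ) = (v o)ᴴᴴ * ((v i)ᴴ * v j) * (v o)ᴴ := by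
      simp only [Matrix.conjTranspose_mul, Matrix.mul_assoc]
    rw [this, hv]
    split_ifs
    · rfl
    · rw [Matrix.mul_zero, Matrix.zero_mul]; rfl
  · change Mat.of ((cfc (ramp ρ) a.val).entries * (w * J i * (v o)ᴴ)) = Mat.of (w * J i * (v o)ᴴ)
    congr 1
    rw [← Matrix.mul_assoc, ← Matrix.mul_assoc, hρw]
  · obtain ⟨s, hs⟩ : ∃ s, s = cfc (fun t => √(ramp δ t)) e.val := ⟨_, rfl⟩
    have hs' : s.entriesᴴ = s.entries := by
      rw [← Mat.entries_star, hs,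
        (cfc_predicate (fun t => √(ramp δ t)) e.val : IsSelfAdjoint _).star_eq]
    have hss : s.entries * s.entries = g.entries := by
      rw [← Mat.entries_mul, hs, ← cfc_mul _ _ e.val (by fun_prop) (by fun_prop), hg]
      congr 1
      exact cfc_congr fun t _ => Real.mul_self_sqrt (ramp_nonneg _ _)
    have h1 := τ.conjTranspose_mul_comm (v i * s.entries)
    have h2 : (v i * s.entries) * (v i * s.entries)ᴴ = (v i * (v o)ᴴ) * (v i * (v o)ᴴ)ᴴ := by
      have e1 : (v i * s.entries) * (v i * s.entries)ᴴ =
          v i * (s.entries * s.entries) * (v i)ᴴ := by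
        simp only [Matrix.conjTranspose_mul, hs', Matrix.mul_assoc]
      have e2 : (v i * (v o)ᴴ) * (v i * (v o)ᴴ)ᴴ = v i * ((v o)ᴴ * v o) * (v i)ᴴ := by
        simp only [Matrix.conjTranspose_mul, Matrix.conjTranspose_conjTranspose, Matrix.mul_assoc]
      rw [e1, e2, hss, hv, if_pos rfl]
    have h3 : Mat.of ((v i * s.entries)ᴴ * (v i * s.entries)) = s * g * s := by
      have e1 : (v i * s.entries)ᴴ * (v i * s.entries) =
          s.entries * ((v i)ᴴ * v i) * s.entries := by
        simp only [Matrix.conjTranspose_mul, hs', Matrix.mul_assoc]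
      rw [e1, hv, if_pos rfl]; rfl
    have h4 : s * g * s = cfc (fun t => ramp δ t * ramp δ t) e.val := by
      rw [hs, hg, ← cfc_mul _ _ e.val (by fun_prop) (by fun_prop),
        ← cfc_mul _ _ e.val (by fun_prop) (by fun_prop)]
      refine cfc_congr fun t _ => ?_
      change √(ramp δ t) * ramp δ t * √(ramp δ t) = _
      rw [mul_right_comm, Real.mul_self_sqrt (ramp_nonneg _ _)]
    rw [h2, h3, h4] at h1
    refine le_of_le_of_eq ?_ (congrArg Complex.re h1)
    refine (τ.isQuasitrace e.size).re_cfc_mono (by fun_prop) (by fun_prop) fun t _ => ?_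
    by_cases h0 : ramp (2 * δ) t = 0
    · rw [h0]; exact mul_self_nonneg _
    · have := half_lt_of_ramp_ne_zero (by positivity) h0
      rw [ramp_eq_one hδ (by linarith), one_mul]
      exact ramp_le_one _ _

/-- Elements on which a cut-down of `a` acts as a two-sided unit lie in `her(a)`. -/
lemma mem_her_of_mul_eq {B : Type*} [CStarAlgebra B] [PartialOrder B] [StarOrderedRing B] {a y : B}
    (ha : 0 ≤ a) {ρ : ℝ} (hρ : 0 < ρ) (h : cfc (ramp ρ) a * y = y) (h' : y * cfc (ramp ρ) a = y) :
    y ∈ her a := by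
  have hc : Continuous fun t => ramp ρ t / max t (ρ / 2) :=
    (continuous_ramp ρ).div (by fun_prop) fun t =>
      (lt_of_lt_of_le (show 0 < ρ / 2 by positivity) (le_max_right _ _)).ne'
  have key : ∀ t, t * (ramp ρ t / max t (ρ / 2)) = ramp ρ t := fun t => by
    by_cases h0 : ramp ρ t = 0
    · simp [h0]
    · have := half_lt_of_ramp_ne_zero hρ h0
      rw [max_eq_left this.le, mul_div_cancel₀]
      linarith
  have h1 : a * cfc (fun t => ramp ρ t / max t (ρ / 2)) a = cfc (ramp ρ) a := by
    conv_lhs => enter [1]; rw [← cfc_id' ℝ a]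
    rw [← cfc_mul _ _ a (by fun_prop) hc.continuousOn]
    exact cfc_congr fun t _ => key t
  have h2 : cfc (fun t => ramp ρ t / max t (ρ / 2)) a * a = cfc (ramp ρ) a := by
    conv_lhs => enter [2]; rw [← cfc_id' ℝ a]
    rw [← cfc_mul _ _ a hc.continuousOn (by fun_prop)]
    exact cfc_congr fun t _ => (mul_comm _ _).trans (key t)
  refine subset_closure ⟨cfc (fun t => ramp ρ t / max t (ρ / 2)) a * y *
    cfc (fun t => ramp ρ t / max t (ρ / 2)) a, ?_⟩
  change a * (cfc (fun t => ramp ρ t / max t (ρ / 2)) a * y *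
    cfc (fun t => ramp ρ t / max t (ρ / 2)) a) * a = y
  rw [mul_assoc _ y, ← mul_assoc a, h1, mul_assoc, mul_assoc, h2, h', h]

/-- Almost divisibility of the Cuntz semigroup implies tracial almost divisibility. -/
lemma IsAlmostDivisible.isTraciallyAlmostDivisible (hA : IsAlmostDivisible A 0) :
    IsTraciallyAlmostDivisible A 0 := by
  intro a ha ε hε k hk
  -- dividing by `K = k N` with `N` large makes the loss factor `K / (K + 1)` negligible
  obtain ⟨N, hN⟩ := exists_nat_gt ((a.size : ℝ) * 2 / ε)
  obtain ⟨K, hKdef⟩ : ∃ K, K = k * (N + 1) := ⟨_, rfl⟩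
  have hK : 0 < K := hKdef ▸ Nat.mul_pos (Nat.pos_of_ne_zero hk) N.succ_pos
  obtain ⟨x, hx1, hx2⟩ := hA a ha K hK.ne'
  obtain ⟨e, rfl⟩ := cuntzClass_surjective x
  obtain ⟨F, -, hF, -, hFτ⟩ := exists_nsmul_representative e (K + 1)
  rw [zero_add, mul_one, ← hF, cuntzClass_le_iff] at hx2
  obtain ⟨η, hη, hηs⟩ : ∃ η > 0, η * a.size ≤ ε / 2 := by
    refine ⟨ε / 2 / (a.size + 1), by positivity, ?_⟩
    rw [div_mul_eq_mul_div, div_le_iff₀ (by positivity)]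
    nlinarith
  obtain ⟨δ, hδ, hle⟩ := NormalizedQuasitrace.cut_le_cut_of_cuntzLE hx2 hη
  obtain ⟨u, c, hc, hc1, hu, ⟨ρ, hρ, hρu⟩, huτ⟩ :=
    exists_orthogonal_system hK hx1 (half_pos hδ)
  rw [mul_div_cancel₀ _ (two_ne_zero)] at huτ
  subst hKdef
  let u' : Fin k → Fin (N + 1) → Mat a.size A := fun i l => u (finProdFinEquiv (i, l))
  have hu' : ∀ i l j m, star (u' i l) * u' j m = if i = j ∧ l = m then c else 0 := by
    intro i l j m
    simp only [u', hu, EmbeddingLike.apply_eq_iff_eq, Prod.mk.injEq]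
  refine ⟨orderZeroMap u', isContractiveOrderZero_orderZeroMap hc hc1 hu', fun y => ?_, fun τ => ?_⟩
  · refine mem_her_of_mul_eq a.nonneg hρ ?_ ?_
    · rw [orderZeroMap_apply, Finset.mul_sum]
      simp only [rowMap_apply, Finset.mul_sum, mul_smul_comm, mul_one, ← mul_assoc, u', hρu]
    · rw [orderZeroMap_apply, Finset.sum_mul]
      have : ∀ i, star (u i) * cfc (ramp ρ) a.val = star (u i) := fun i => by
        have h1 := congrArg star (hρu i)
        rwa [star_mul, (IsSelfAdjoint.of_nonneg (cfc_ramp_nonneg a.val ρ)).star_eq] at h1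
      simp only [rowMap_apply, Finset.sum_mul, smul_mul_assoc, mul_one, mul_assoc, u', this]
  · have h1 : orderZeroMap u' 1 = ∑ p, u p * star (u p) := by
      rw [orderZeroMap_apply, ← finProdFinEquiv.sum_comp, Fintype.sum_prod_type_right]
      simp only [rowMap_one, mul_one, u']
    have h2 : (τ.toFun a.size (orderZeroMap u' 1)).re =
        ∑ p, (τ.toFun a.size (u p * star (u p))).re := by
      rw [h1, (τ.isQuasitrace _).re_sum _ _ fun i _ => IsSelfAdjoint.mul_star_self _]
      intro i _ j _
      have h3 : ∀ i j, i ≠ j → u i * star (u i) * (u j * star (u j)) = 0 := fun i j hij => by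
        rw [mul_assoc, ← mul_assoc (star (u i)), hu, if_neg hij, zero_mul, mul_zero]
      by_cases hij : i = j
      · rw [hij]
      · exact (h3 i j hij).trans (h3 j i (Ne.symm hij)).symm
    have h4 : (k * (N + 1) : ℕ) * τ.cut δ e ≤ (τ.toFun a.size (orderZeroMap u' 1)).re := by
      rw [h2]
      have := Finset.card_nsmul_le_sum Finset.univ
        (fun p => (τ.toFun a.size (u p * star (u p))).re) _ fun p _ => huτ τ p
      simpa [nsmul_eq_mul] using this
    -- the loss is at most the trace of one copy of `e`, and `K` copies of it fit into `a`
    have h5 := hle τ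
    rw [hFτ] at h5
    have h6 := τ.eval_le_cut_add ha hη
    have h7 : (k * (N + 1) : ℕ) * τ.rank e ≤ a.size := by
      have := τ.rankHom_mono hx1
      rw [map_nsmul, nsmul_eq_mul, τ.rankHom_cuntzClass, τ.rankHom_cuntzClass] at this
      exact this.trans (τ.rank_le fun δ _ => τ.cut_le_size δ a)
    have h8 : τ.cut δ e ≤ ε / 2 := by
      have e1 := τ.cut_le_rank hδ e
      have e2 := τ.cut_nonneg δ e
      have e3 : (N + 1 : ℝ) ≤ (k * (N + 1) : ℕ) := by
        exact_mod_cast Nat.le_mul_of_pos_left _ (Nat.pos_of_ne_zero hk)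
      have e4 : (N + 1 : ℝ) * τ.cut δ e ≤ a.size :=
        (mul_le_mul e3 e1 e2 (by positivity)).trans h7
      rw [div_lt_iff₀ hε] at hN
      by_contra! h9
      have : (N + 1 : ℝ) * (ε / 2) < (N + 1) * τ.cut δ e := by gcongr
      linarith
    push_cast at *
    simp only [zero_add, div_one, one_mul]
    linarith

end Divisible

/-! ### Criteria for Cuntz comparison -/

section CuntzTools

variable {A : Type*} [CStarAlgebra A] [PartialOrder A] [StarOrderedRing A]

/-- The positive element of `M_∞(A)` given by a positive matrix. -/
abbrev posMat {n : ℕ} (a : Mat n A) (ha : 0 ≤ a) : PosMat A := ⟨n, a, ha⟩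

lemma CuntzLE.of_conj {a b : PosMat A} (x : Matrix (Fin b.size) (Fin a.size) A)
    (h : Mat.conj x b.val = a.val) : CuntzLE a b :=
  ⟨fun _ => x, by simp only [h]; exact tendsto_const_nhds⟩

lemma CuntzLE.of_val_eq_zero {a : PosMat A} (b : PosMat A) (h : a.val = 0) : CuntzLE a b :=
  CuntzLE.of_conj 0 (by rw [h]; simp [Mat.conj]; rfl)

lemma CuntzLE.of_star_mul_mul {n : ℕ} {a b : Mat n A} (ha : 0 ≤ a) (hb : 0 ≤ b) (x : Mat n A)
    (h : star x * b * x = a) : CuntzLE (posMat a ha) (posMat b hb) :=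
  CuntzLE.of_conj (a := posMat a ha) (b := posMat b hb) x.entries h

/-- Cuntz comparison may be checked on arbitrarily good approximants. -/
lemma CuntzLE.of_forall_approx {n : ℕ} {a : Mat n A} (ha : 0 ≤ a) {b : PosMat A}
    (h : ∀ ε > 0, ∃ (c : Mat n A) (hc : 0 ≤ c), ‖c - a‖ ≤ ε ∧ CuntzLE (posMat c hc) b) :
    CuntzLE (posMat a ha) b := by
  rw [cuntzLE_iff_mem_closure, ← closure_closure, Metric.mem_closure_iff]
  intro ε hε
  obtain ⟨c, hc, hca, hcb⟩ := h (ε / 2) (half_pos hε)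
  refine ⟨c, cuntzLE_iff_mem_closure.mp hcb, ?_⟩
  rw [dist_comm, dist_eq_norm]
  change ‖c - a‖ < ε
  linarith

/-- `f(a) ≾ g(a)` if `g` is bounded below on the support of `f`. -/
lemma CuntzLE.cfc_cfc {n : ℕ} (a : Mat n A) {f g : ℝ → ℝ} (hf : Continuous f)
    (hg : Continuous g) (hf0 : ∀ t, 0 ≤ f t) (hfa : 0 ≤ cfc f a) (hga : 0 ≤ cfc g a) {c : ℝ}
    (hc : 0 < c) (h : ∀ t, f t ≠ 0 → c ≤ g t) :
    CuntzLE (posMat (cfc f a) hfa) (posMat (cfc g a) hga) := by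
  have hrc : Continuous fun t => √(f t / max (g t) c) :=
    Real.continuous_sqrt.comp (hf.div (by fun_prop) fun t =>
      (lt_of_lt_of_le hc (le_max_right _ _)).ne')
  refine CuntzLE.of_star_mul_mul _ _ (cfc (fun t => √(f t / max (g t) c)) a) ?_
  rw [(cfc_predicate (fun t => √(f t / max (g t) c)) a : IsSelfAdjoint _).star_eq,
    ← cfc_mul _ _ a hrc.continuousOn (by fun_prop), ← cfc_mul _ _ a (by fun_prop) hrc.continuousOn]
  refine cfc_congr fun t _ => ?_
  by_cases h0 : f t = 0
  · simp [h0]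
  · have h1 := h t h0
    have h2 : 0 < g t := hc.trans_le h1
    change √(f t / max (g t) c) * g t * √(f t / max (g t) c) = f t
    rw [max_eq_left h1, mul_right_comm, Real.mul_self_sqrt (div_nonneg (hf0 t) h2.le),
      div_mul_cancel₀ _ h2.ne']

lemma norm_cfc_sub_sub_self_le {B : Type*} [CStarAlgebra B] [PartialOrder B] [StarOrderedRing B]
    {a : B} (ha : 0 ≤ a) {ε : ℝ} (hε : 0 < ε) : ‖cfc (fun t => max (t - ε) 0) a - a‖ ≤ ε := by
  refine norm_cfc_sub_self_le (.of_nonneg ha) (by fun_prop) hε.le fun t ht => ?_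
  have := spectrum_nonneg_of_nonneg ha ht
  rcases max_cases (t - ε) 0 with ⟨h1, _⟩ | ⟨h1, _⟩ <;> rw [h1, abs_le] <;>
    constructor <;> linarith

lemma cuntzLE_pow {n : ℕ} {a : Mat n A} (ha : 0 ≤ a) (m : ℕ) (ham : 0 ≤ a ^ m) :
    CuntzLE (posMat a ha) (posMat (a ^ m) ham) := by
  refine CuntzLE.of_forall_approx ha fun ε hε => ⟨cfc (fun t => max (t - ε) 0) a,
    cfc_nonneg fun _ _ => le_max_right _ _, norm_cfc_sub_sub_self_le ha hε, ?_⟩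
  have h1 : cfc (fun t : ℝ => t ^ m) a = a ^ m := cfc_pow_id a m
  have h := CuntzLE.cfc_cfc a (f := fun t => max (t - ε) 0) (g := fun t => t ^ m) (by fun_prop)
    (by fun_prop) (fun _ => le_max_right _ _) (cfc_nonneg fun _ _ => le_max_right _ _)
    (h1 ▸ ham) (pow_pos hε m) fun t ht => by
      have : ε ≤ t := by
        by_contra! h'
        exact ht (max_eq_right (by linarith))
      gcongr
  simpa only [h1] using h

lemma cuntzLE_ramp (b : PosMat A) {δ : ℝ} (hδ : 0 < δ) :
    CuntzLE (posMat (cfc (ramp δ) b.val) (cfc_ramp_nonneg _ _)) b := by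
  have h1 : cfc (fun t : ℝ => t) b.val = b.val := cfc_id' ℝ b.val (.of_nonneg b.nonneg)
  have h := CuntzLE.cfc_cfc b.val (f := ramp δ) (g := fun t => t) (by fun_prop) (by fun_prop)
    (ramp_nonneg δ) (cfc_ramp_nonneg _ _) (h1.symm ▸ b.nonneg) (half_pos hδ)
    fun t ht => (half_lt_of_ramp_ne_zero hδ ht).le
  simpa only [h1] using h

lemma CuntzLE.smul {n : ℕ} {a : Mat n A} (ha : 0 ≤ a) {c : ℝ} (hc : 0 ≤ c) (hca : 0 ≤ c • a) :
    CuntzLE (posMat (c • a) hca) (posMat a ha) := by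
  refine CuntzLE.of_star_mul_mul _ _ (√c • 1) ?_
  rw [star_smul, star_one, star_trivial, smul_mul_assoc, one_mul, smul_mul_assoc, mul_smul_comm,
    mul_one, ← mul_smul, Real.mul_self_sqrt hc]

/-- A positive element below `b` is Cuntz subequivalent to `b`. -/
lemma CuntzLE.of_le {n : ℕ} {a b : Mat n A} (ha : 0 ≤ a) (hb : 0 ≤ b) (h : a ≤ b) :
    CuntzLE (posMat a ha) (posMat b hb) := by
  obtain ⟨s, hs, hss⟩ : ∃ s : Mat n A, IsSelfAdjoint s ∧ s * s = a :=
    ⟨CFC.sqrt a, IsSelfAdjoint.of_nonneg (CFC.sqrt_nonneg a), CFC.sqrt_mul_sqrt_self a⟩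
  let ν : ℕ → ℝ := fun i => 1 / ((i : ℝ) + 1)
  have hν : ∀ i, 0 < ν i := fun i => by positivity
  have hν0 : Filter.Tendsto ν Filter.atTop (𝓝 0) := tendsto_one_div_add_atTop_nhds_zero_nat
  refine ⟨fun i => (cfc (fun t => (√t + ν i)⁻¹) b * s).entries, ?_⟩
  rw [tendsto_iff_norm_sub_tendsto_zero]
  refine squeeze_zero (fun _ => norm_nonneg _) (g := fun i => 2 * √‖b‖ * ν i) ?_
    (by simpa using hν0.const_mul (2 * √‖b‖))
  intro i
  change ‖star (cfc (fun t => (√t + ν i)⁻¹) b * s) * b *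
    (cfc (fun t => (√t + ν i)⁻¹) b * s) - a‖ ≤ _
  rw [← hss]
  exact norm_star_mul_mul_cfc_sub_le hs hb (hss.trans_le h) (continuous_sqrt_add_inv (hν i))
    (mul_nonneg (by positivity) (hν i).le) (one_sub_sqrt_mul_inv_nonneg (hν i))
    fun t ht => mul_one_sub_sqrt_mul_inv_le (hν i) (spectrum_nonneg_of_nonneg hb ht)
      (spectrum_le_norm ht)

end CuntzTools

/-! ### Compactness of the space of quasitraces -/

section Limits

variable {A : Type*} [CStarAlgebra A] [PartialOrder A] [StarOrderedRing A]

/-- Compactness of the space of normalized quasitraces: ultrafilter limits exist. -/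
lemma NormalizedQuasitrace.exists_tendsto (T : ℕ → NormalizedQuasitrace A) (U : Ultrafilter ℕ) :
    ∃ τ : NormalizedQuasitrace A, ∀ n x,
      Filter.Tendsto (fun j => (T j).toFun n x) U (𝓝 (τ.toFun n x)) := by
  have hlim : ∀ n (x : Mat n A), ∃ l : ℂ, Filter.Tendsto (fun j => (T j).toFun n x) U (𝓝 l) := by
    intro n x
    have hmem : ∀ j, (T j).toFun n x ∈ Metric.closedBall (0 : ℂ) (2 * ‖x‖ * n) := fun j => by
      have := ((T j).isQuasitrace n).norm_le x
      rw [(T j).map_one] at this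
      simpa using this
    obtain ⟨l, -, hl⟩ := (isCompact_closedBall (0 : ℂ) (2 * ‖x‖ * n)).ultrafilter_le_nhds
      (U.map fun j => (T j).toFun n x) (by
        rw [Filter.le_principal_iff]
        exact Filter.mem_map.mpr (Filter.univ_mem' hmem))
    exact ⟨l, hl⟩
  choose l hl using hlim
  have huniq : ∀ {n} {x : Mat n A} {c : ℂ}, Filter.Tendsto (fun j => (T j).toFun n x) U (𝓝 c) →
      l n x = c := fun h => tendsto_nhds_unique (hl _ _) h
  refine ⟨⟨l, fun n => ⟨fun x => ?_, fun x => ?_, fun x y hx hy => ?_,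
    fun C hC hcomm c x hx y hy => ?_⟩, fun n a => ?_, ?_⟩, hl⟩
  · exact ge_of_tendsto' (hl n _) fun j => ((T j).isQuasitrace n).nonneg x
  · refine huniq ?_
    simp only [((T _).isQuasitrace n).comm x]
    exact hl n _
  · refine huniq ?_
    simp only [((T _).isQuasitrace n).re_add_im x y hx hy]
    exact (hl n x).add ((hl n y).const_mul _)
  · refine huniq ?_
    simp only [((T _).isQuasitrace n).linear_on_comm C hC hcomm c x hx y hy]
    exact ((hl n x).const_mul _).add (hl n y)
  · refine huniq ?_
    simp only [(T _).corner]
    exact hl n a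
  · refine huniq ?_
    simp only [(T _).normalized]
    exact tendsto_const_nhds

/-- Dini's argument on the compact space of quasitraces: if `τ(g_ε(a))` is dominated by the rank
of `b` for every `τ`, then it is uniformly dominated by some `τ(g_δ(b))`. -/
lemma NormalizedQuasitrace.exists_cut_lt_cut {a b : PosMat A} {ε : ℝ}
    (h : ∀ τ : NormalizedQuasitrace A, τ.cut ε a < τ.rank b) :
    ∃ δ > 0, ∀ τ : NormalizedQuasitrace A, τ.cut ε a < τ.cut δ b := by
  by_contra! hcon
  choose T hT using fun j : ℕ => hcon ((1 / 2) ^ j) (by positivity)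
  obtain ⟨τ, hτ⟩ := NormalizedQuasitrace.exists_tendsto T (Filter.hyperfilter ℕ)
  have hcut : ∀ δ (c : PosMat A), Filter.Tendsto (fun j => (T j).cut δ c)
      (Filter.hyperfilter ℕ) (𝓝 (τ.cut δ c)) := fun δ c =>
    (Complex.continuous_re.tendsto _).comp (hτ _ _)
  refine (h τ).not_ge (ciSup_le fun i => ?_)
  refine le_of_tendsto_of_tendsto (hcut _ b) (hcut ε a) ?_
  have hge : ∀ᶠ j in (Filter.hyperfilter ℕ : Filter ℕ), i ≤ j :=
    (Nat.hyperfilter_le_atTop) (Filter.eventually_ge_atTop i)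
  filter_upwards [hge] with j hj
  refine ((T j).cut_anti (by positivity) ?_ b).trans (hT j)
  exact pow_le_pow_of_le_one (by norm_num) (by norm_num) hj

end Limits

/-! ### Comparison and strong tracial comparison -/

section Comparison

variable {A : Type*} [CStarAlgebra A] [PartialOrder A] [StarOrderedRing A]

lemma HasComparison.hasStrongTracialComparison (hA : HasComparison A 0) :
    HasStrongTracialComparison A 0 := by
  intro a b ha hb h
  have := hA a (fun _ => b) ha (fun _ => hb) fun τ _ => by
    have h1 := h τ
    simp only [Nat.cast_zero, zero_add, div_one, one_mul] at h1
    rw [τ.dim_eq_rank hb.2]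
    exact h1.trans_le (τ.eval_le_rank hb.2)
  simpa [cuntzClass_le_iff] using this

lemma NormalizedQuasitrace.rank_cfc_sub_le (τ : NormalizedQuasitrace A) (a : PosMat A) {ε : ℝ}
    (hε : 0 < ε) (h : 0 ≤ cfc (fun t => max (t - ε) 0) a.val) :
    τ.rank (posMat (cfc (fun t => max (t - ε) 0) a.val) h) ≤ τ.cut ε a := by
  refine τ.rank_le fun δ hδ => ?_
  unfold NormalizedQuasitrace.cut
  change (τ.toFun a.size (cfc (ramp δ) (cfc (fun t => max (t - ε) 0) a.val))).re ≤ _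
  rw [← cfc_comp' (ramp δ) (fun t => max (t - ε) 0) a.val (by fun_prop) (by fun_prop)
    (.of_nonneg a.nonneg)]
  refine (τ.isQuasitrace _).re_cfc_mono (by fun_prop) (by fun_prop) fun t _ => ?_
  rcases le_total t ε with ht | ht
  · rw [max_eq_right (by linarith), ramp_eq_zero hδ (by positivity)]
    exact ramp_nonneg _ _
  · rw [ramp_eq_one hε ht]
    exact ramp_le_one _ _

lemma cfc_ramp_ne_zero {B : Type*} [CStarAlgebra B] [PartialOrder B] [StarOrderedRing B] {b : B}
    (hb : 0 ≤ b) {δ : ℝ} (hδ : 0 < δ) (h : δ ≤ ‖b‖) : cfc (ramp δ) b ≠ 0 := by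
  intro h0
  have hb0 : b ≠ 0 := fun hb0 => by simp [hb0] at h; linarith
  have : Nontrivial B := ⟨b, 0, hb0⟩
  have h1 := (norm_cfc_le_iff (ramp δ) b le_rfl).mp (by rw [h0, norm_zero]) ‖b‖
    (CStarAlgebra.norm_mem_spectrum_of_nonneg hb)
  rw [ramp_eq_one hδ h] at h1
  norm_num at h1

/-- Strong tracial comparison gives comparison in terms of ranks, for contractions. -/
lemma HasStrongTracialComparison.cuntzLE (hA : HasStrongTracialComparison A 0) {a b : PosMat A}
    (ha : ‖a.val‖ ≤ 1) (hb : b.val ≠ 0) (h : ∀ τ : NormalizedQuasitrace A, τ.rank a < τ.rank b) :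
    CuntzLE a b := by
  refine CuntzLE.of_forall_approx a.nonneg fun ε hε => ⟨cfc (fun t => max (t - ε) 0) a.val,
    cfc_nonneg fun _ _ => le_max_right _ _, norm_cfc_sub_sub_self_le a.nonneg hε, ?_⟩
  by_cases h0 : cfc (fun t => max (t - ε) 0) a.val = 0
  · exact CuntzLE.of_val_eq_zero _ h0
  obtain ⟨δ, hδ, hlt⟩ := NormalizedQuasitrace.exists_cut_lt_cut (ε := ε)
    fun τ => (τ.cut_le_rank hε a).trans_lt (h τ)
  -- below `‖b‖` the cut-down of `b` is nonzero, as strong tracial comparison requires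
  have hδ' : 0 < min δ ‖b.val‖ := lt_min hδ (norm_pos_iff.mpr hb)
  have hnorm : ‖cfc (fun t => max (t - ε) 0) a.val‖ ≤ 1 := norm_cfc_le zero_le_one fun t ht => by
    rw [Real.norm_of_nonneg (le_max_right _ _)]
    exact max_le (by linarith [spectrum_le_norm ht]) zero_le_one
  have hnn : 0 ≤ cfc (fun t => max (t - ε) 0) a.val := cfc_nonneg fun _ _ => le_max_right _ _
  have hdim := fun τ : NormalizedQuasitrace A =>
    (τ.dim_eq_rank (a := posMat _ hnn) hnorm).trans_le (τ.rank_cfc_sub_le a hε hnn)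
  have heval : ∀ τ : NormalizedQuasitrace A, τ.cut ε a <
      τ.eval (posMat (cfc (ramp (min δ ‖b.val‖)) b.val) (cfc_ramp_nonneg _ _)) := fun τ =>
    (hlt τ).trans_le (τ.cut_anti hδ' (min_le_left _ _) b)
  have key : CuntzLE (posMat _ hnn)
      (posMat (cfc (ramp (min δ ‖b.val‖)) b.val) (cfc_ramp_nonneg _ _)) := by
    refine hA _ _ ⟨h0, hnorm⟩ ⟨cfc_ramp_ne_zero b.nonneg hδ' (min_le_right _ _),
      norm_cfc_ramp_le_one _ _⟩ fun τ => ?_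
    rw [Nat.cast_zero, zero_add, div_one, one_mul]
    exact (hdim τ).trans_lt (heval τ)
  exact key.trans (cuntzLE_ramp b hδ')

lemma HasStrongTracialComparison.hasComparison (hA : HasStrongTracialComparison A 0) :
    HasComparison A 0 := by
  intro a b ha hb h
  have := hA.cuntzLE ha.2 (hb 0).1 fun τ => by
    rw [← τ.dim_eq_rank ha.2, ← τ.dim_eq_rank (hb 0).2]
    exact h τ 0
  simpa [cuntzClass_le_iff] using this

/-- The normalization of a nonzero positive element represents the same class. -/
lemma exists_contraction_representative (a : PosMat A) :
    ∃ b : PosMat A, ‖b.val‖ ≤ 1 ∧ cuntzClass b = cuntzClass a := by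
  by_cases h0 : a.val = 0
  · exact ⟨a, by simp [h0], rfl⟩
  have hpos : 0 < ‖a.val‖ := norm_pos_iff.mpr h0
  have hnn : 0 ≤ ‖a.val‖⁻¹ • a.val := smul_nonneg (by positivity) a.nonneg
  refine ⟨posMat (‖a.val‖⁻¹ • a.val) hnn, ?_, le_antisymm ?_ ?_⟩
  · change ‖‖a.val‖⁻¹ • a.val‖ ≤ 1
    rw [norm_smul, norm_inv, norm_norm, inv_mul_cancel₀ hpos.ne']
  · exact CuntzLE.smul a.nonneg (by positivity) hnn
  · have h1 : ‖a.val‖ • (‖a.val‖⁻¹ • a.val) = a.val := by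
      rw [smul_smul, mul_inv_cancel₀ hpos.ne', one_smul]
    have h2 := CuntzLE.smul hnn hpos.le (h1.symm ▸ a.nonneg)
    simp only [h1] at h2
    exact h2

/-- Strong tracial comparison in terms of classes in the Cuntz semigroup. -/
lemma HasStrongTracialComparison.le (hA : HasStrongTracialComparison A 0) {x : CuntzSemigroup A}
    {b : PosMat A} (hb : b.val ≠ 0)
    (h : ∀ τ : NormalizedQuasitrace A, τ.rankHom x < τ.rank b) : x ≤ cuntzClass b := by
  obtain ⟨a, rfl⟩ := cuntzClass_surjective x
  obtain ⟨a', ha', haa'⟩ := exists_contraction_representative a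
  rw [← haa', cuntzClass_le_iff]
  refine hA.cuntzLE ha' hb fun τ => ?_
  rw [← τ.rankHom_cuntzClass a', haa']
  exact h τ

end Comparison

/-! ### Orthogonal sums in the Cuntz semigroup -/

section Orthogonal

variable {A : Type*} [CStarAlgebra A] [PartialOrder A] [StarOrderedRing A] {n : ℕ}

/-- The class in `W(A)` of a positive matrix over `A`. -/
noncomputable abbrev matClass (a : Mat n A) (ha : 0 ≤ a) : CuntzSemigroup A :=
  cuntzClass (posMat a ha)

/-- The comparison of `z³ ⊕ w³` with `z + w` is implemented by the row `(z, w)`, because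
`z (z + w) z = z³` and `z (z + w) w = 0`. -/
lemma matClass_add_le_of_orthogonal {z w : Mat n A} (hz : 0 ≤ z) (hw : 0 ≤ w) (h : z * w = 0)
    (hzw : 0 ≤ z + w) : matClass z hz + matClass w hw ≤ matClass (z + w) hzw := by
  have hz3 : 0 ≤ z ^ 3 := CStarAlgebra.pow_nonneg hz 3
  have hw3 : 0 ≤ w ^ 3 := CStarAlgebra.pow_nonneg hw 3
  have hzs : z.entriesᴴ = z.entries := by
    rw [← Mat.entries_star, (IsSelfAdjoint.of_nonneg hz).star_eq]
  have hws : w.entriesᴴ = w.entries := by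
    rw [← Mat.entries_star, (IsSelfAdjoint.of_nonneg hw).star_eq]
  have h' : w * z = 0 := by
    have := congrArg star h
    rwa [star_mul, (IsSelfAdjoint.of_nonneg hz).star_eq, (IsSelfAdjoint.of_nonneg hw).star_eq,
      star_zero] at this
  have key : CuntzLE (posMat (z ^ 3) hz3 + posMat (w ^ 3) hw3) (posMat (z + w) hzw) := by
    refine CuntzLE.of_conj (a := posMat (z ^ 3) hz3 + posMat (w ^ 3) hw3)
      (z.entries * (inlMatrix A n n)ᴴ + w.entries * (inrMatrix A n n)ᴴ) ?_
    change Mat.of (_ᴴ * (z + w).entries * _) =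
      Mat.of (blockSum (z ^ 3).entries (w ^ 3).entries)
    congr 1
    have e1 : (z ^ 3).entries = (z * (z + w) * z).entries := by
      congr 1; rw [mul_assoc, add_mul, h', add_zero]; noncomm_ring
    have e2 : (w ^ 3).entries = (w * (z + w) * w).entries := by
      congr 1; rw [mul_assoc, add_mul, h, zero_add]; noncomm_ring
    have e3 : (z * (z + w) * w) = 0 := by
      rw [mul_add, add_mul, mul_assoc, h, mul_zero, zero_mul, zero_add]
    have e4 : (w * (z + w) * z) = 0 := by
      rw [mul_add, add_mul, h', zero_mul, zero_add, mul_assoc, h', mul_zero]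
    have e3' : z.entries * (z + w).entries * w.entries = 0 := congrArg Mat.entries e3
    have e4' : w.entries * (z + w).entries * z.entries = 0 := congrArg Mat.entries e4
    rw [e1, e2, ← add_zero (z * (z + w) * z).entries, ← zero_add (w * (z + w) * w).entries,
      ← blockSum_add, ← inlMatrix_mul_mul, ← inrMatrix_mul_mul]
    simp only [Matrix.conjTranspose_add, Matrix.conjTranspose_mul,
      Matrix.conjTranspose_conjTranspose, hzs, hws, Mat.entries_mul]
    simp only [Matrix.add_mul, Matrix.mul_add]
    have f1 : inlMatrix A n n * z.entries * (z + w).entries * (w.entries * (inrMatrix A n n)ᴴ) =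
        inlMatrix A n n * (z.entries * (z + w).entries * w.entries) * (inrMatrix A n n)ᴴ := by
      simp only [Matrix.mul_assoc]
    have f2 : inrMatrix A n n * w.entries * (z + w).entries * (z.entries * (inlMatrix A n n)ᴴ) =
        inrMatrix A n n * (w.entries * (z + w).entries * z.entries) * (inlMatrix A n n)ᴴ := by
      simp only [Matrix.mul_assoc]
    rw [f1, f2, e3', e4']
    simp only [Matrix.mul_zero, Matrix.zero_mul, zero_add, add_zero, Matrix.mul_assoc]
  have h1 : matClass z hz ≤ matClass (z ^ 3) hz3 := cuntzLE_pow hz 3 hz3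
  have h2 : matClass w hw ≤ matClass (w ^ 3) hw3 := cuntzLE_pow hw 3 hw3
  obtain hle : posMat z hz + posMat w hw ≤ posMat (z ^ 3) hz3 + posMat (w ^ 3) hw3 :=
    PosMat.add_le_add h1 h2
  exact hle.trans key

lemma matClass_add_le {z w : Mat n A} (hz : 0 ≤ z) (hw : 0 ≤ w) (hzw : 0 ≤ z + w) :
    matClass (z + w) hzw ≤ matClass z hz + matClass w hw := by
  refine CuntzLE.of_conj (a := posMat (z + w) hzw) (b := posMat z hz + posMat w hw)
    (inlMatrix A n n + inrMatrix A n n) ?_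
  change Mat.of ((inlMatrix A n n + inrMatrix A n n)ᴴ * blockSum z.entries w.entries *
    (inlMatrix A n n + inrMatrix A n n)) = Mat.of (z.entries + w.entries)
  congr 1
  simp only [Matrix.conjTranspose_add, Matrix.add_mul, Matrix.mul_add, inl_blockSum_inl,
    inl_blockSum_inr, inr_blockSum_inl, inr_blockSum_inr]
  simp

lemma cuntz_add_le_add {x y x' y' : CuntzSemigroup A} (h : x ≤ x') (h' : y ≤ y') :
    x + y ≤ x' + y' := by
  obtain ⟨a, rfl⟩ := cuntzClass_surjective x
  obtain ⟨b, rfl⟩ := cuntzClass_surjective y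
  obtain ⟨a', rfl⟩ := cuntzClass_surjective x'
  obtain ⟨b', rfl⟩ := cuntzClass_surjective y'
  exact PosMat.add_le_add h h'

lemma sum_matClass_le {ι : Type*} (s : Finset ι) (z : ι → Mat n A) (hz : ∀ i, 0 ≤ z i)
    (h : ∀ i j, i ≠ j → z i * z j = 0) :
    ∑ i ∈ s, matClass (z i) (hz i) ≤
      matClass (∑ i ∈ s, z i) (Finset.sum_nonneg fun i _ => hz i) := by
  classical
  induction s using Finset.induction_on with
  | empty => exact CuntzLE.of_val_eq_zero _ rfl
  | insert i s hi ih =>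
    simp only [Finset.sum_insert hi]
    have hs : 0 ≤ ∑ j ∈ s, z j := Finset.sum_nonneg fun i _ => hz i
    refine le_trans ?_ (matClass_add_le_of_orthogonal (hz i) hs ?_ (add_nonneg (hz i) hs))
    · exact cuntz_add_le_add le_rfl ih
    · rw [Finset.mul_sum]
      exact Finset.sum_eq_zero fun j hj => h i j fun hij => hi (hij ▸ hj)

lemma matClass_sum_le {ι : Type*} (s : Finset ι) (z : ι → Mat n A) (hz : ∀ i, 0 ≤ z i) :
    matClass (∑ i ∈ s, z i) (Finset.sum_nonneg fun i _ => hz i) ≤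
      ∑ i ∈ s, matClass (z i) (hz i) := by
  classical
  induction s using Finset.induction_on with
  | empty => exact CuntzLE.of_val_eq_zero _ rfl
  | insert i s hi ih =>
    simp only [Finset.sum_insert hi]
    have hs : 0 ≤ ∑ j ∈ s, z j := Finset.sum_nonneg fun i _ => hz i
    exact (matClass_add_le (hz i) hs (add_nonneg (hz i) hs)).trans (cuntz_add_le_add le_rfl ih)

lemma cuntzLE_mul_star {y : Mat n A} :
    CuntzLE (posMat (y * star y) (mul_star_self_nonneg y))
      (posMat (star y * y) (star_mul_self_nonneg y)) := by
  have h2 : 0 ≤ (y * star y) ^ 2 := CStarAlgebra.pow_nonneg (mul_star_self_nonneg y) 2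
  refine (cuntzLE_pow (mul_star_self_nonneg y) 2 h2).trans
    (CuntzLE.of_star_mul_mul _ _ (star y) ?_)
  rw [star_star, sq]
  simp only [mul_assoc]

lemma matClass_le_of_mem_her {a z : Mat n A} (ha : 0 ≤ a) (hz : 0 ≤ z) (h : z ∈ her a) :
    matClass z hz ≤ matClass a ha := by
  obtain ⟨s, hs, hss⟩ : ∃ s : Mat n A, IsSelfAdjoint s ∧ s * s = a :=
    ⟨CFC.sqrt a, IsSelfAdjoint.of_nonneg (CFC.sqrt_nonneg a), CFC.sqrt_mul_sqrt_self a⟩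
  have hz2 : 0 ≤ z ^ 2 := CStarAlgebra.pow_nonneg hz 2
  obtain ⟨x, hx, hlim⟩ := mem_closure_iff_seq_limit.mp h
  choose y hy using hx
  refine (cuntzLE_pow hz 2 hz2).trans ⟨fun j => (s * y j * a).entries, ?_⟩
  have h1 : Filter.Tendsto (fun j => star (x j) * x j) Filter.atTop (𝓝 (z ^ 2)) := by
    have := hlim.star.mul hlim
    rwa [(IsSelfAdjoint.of_nonneg hz).star_eq, ← sq] at this
  refine h1.congr fun j => ?_
  change _ = star (s * y j * a) * a * (s * y j * a)
  rw [← hy j]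
  simp only [star_mul, hs.star_eq, ← hss, mul_assoc]

/-- In particular the hereditary subalgebra is a closed subspace. -/
lemma her_eq_topologicalClosure {B : Type*} [CStarAlgebra B] (a : B) :
    her a = ((LinearMap.range (LinearMap.mulLeftRight ℂ (a, a))).topologicalClosure : Set B) := by
  rw [Submodule.topologicalClosure_coe, her]
  congr 1

lemma mul_eq_zero_of_mem_her {B : Type*} [CStarAlgebra B] {a b x y : B} (hab : a * b = 0)
    (hx : x ∈ her a) (hy : y ∈ her b) : x * y = 0 := by
  have h1 : ∀ x ∈ her a, x * b = 0 := fun x hx => by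
    refine closure_minimal (t := {x | x * b = 0}) ?_ (isClosed_eq (by fun_prop) (by fun_prop)) hx
    rintro _ ⟨y, rfl⟩
    change a * y * a * b = 0
    rw [mul_assoc, hab, mul_zero]
  refine closure_minimal (t := {y | x * y = 0}) ?_ (isClosed_eq (by fun_prop) (by fun_prop)) hy
  rintro _ ⟨y, rfl⟩
  change x * (b * y * b) = 0
  rw [← mul_assoc, ← mul_assoc, h1 x hx, zero_mul, zero_mul]

lemma her_subset_her {B : Type*} [CStarAlgebra B] [PartialOrder B] [StarOrderedRing B] {a b : B}
    (ha : 0 ≤ a) {ρ : ℝ} (hρ : 0 < ρ) (hb : cfc (ramp ρ) a * b = b)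
    (hb' : b * cfc (ramp ρ) a = b) : her b ⊆ her a := by
  refine closure_minimal ?_ isClosed_closure
  rintro _ ⟨y, rfl⟩
  refine mem_her_of_mul_eq ha hρ ?_ ?_
  · change _ * (b * y * b) = b * y * b
    rw [← mul_assoc, ← mul_assoc, hb]
  · change (b * y * b) * _ = b * y * b
    rw [mul_assoc, hb']

end Orthogonal

section Sums

variable {A : Type*} [CStarAlgebra A] [PartialOrder A] [StarOrderedRing A] {n : ℕ}

lemma tsum_mul_tsum_of_orthogonal {B : Type*} [CStarAlgebra B] {x y : ℕ → B} (hx : Summable x)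
    (hy : Summable y) (h : ∀ i j, i ≠ j → x i * y j = 0) :
    (∑' i, x i) * (∑' i, y i) = ∑' i, x i * y i := by
  rw [← hx.tsum_mul_right]
  refine tsum_congr fun i => ?_
  rw [← hy.tsum_mul_left, tsum_eq_single i fun j hj => h i j hj.symm]

lemma summable_of_geometric {B : Type*} [CStarAlgebra B] {x : ℕ → B}
    (h : ∀ l, ‖x l‖ ≤ (1 / 2) ^ l) : Summable x :=
  Summable.of_norm_bounded (summable_geometric_of_lt_one (by norm_num) (by norm_num)) h

/-- Comparison of orthogonal series: the elements `y_l` which implement `p_l ≾ q_l` add up. The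
terms are assumed to decay geometrically in order to make all series converge. -/
lemma matClass_tsum_le {p q y : ℕ → Mat n A} (hp' : ∀ l, ‖p l‖ ≤ (1 / 2) ^ l)
    (hq : Summable q) (hy' : ∀ l, ‖y l‖ ≤ (1 / 2) ^ l) (hpp : ∀ l m, l ≠ m → p l * p m = 0)
    (hy1 : ∀ l m, l ≠ m → y l * star (y m) = 0) (hy2 : ∀ l m, l ≠ m → star (y l) * y m = 0)
    (h1 : ∀ l, y l * star (y l) = p l ^ 4) (h2 : ∀ l, star (y l) * y l ≤ q l)
    (hp0 : 0 ≤ ∑' l, p l) (hq0 : 0 ≤ ∑' l, q l) :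
    matClass (∑' l, p l) hp0 ≤ matClass (∑' l, q l) hq0 := by
  have hsq : ∀ l, ((1 : ℝ) / 2) ^ l * (1 / 2) ^ l ≤ (1 / 2) ^ l := fun l =>
    mul_le_of_le_one_left (by positivity) (pow_le_one₀ (by norm_num) (by norm_num))
  have hp := summable_of_geometric hp'
  have hy := summable_of_geometric hy'
  have e1 : (∑' l, y l) * star (∑' l, y l) = (∑' l, p l) ^ 4 := by
    rw [tsum_star, tsum_mul_tsum_of_orthogonal hy hy.star hy1]
    have s2 := tsum_mul_tsum_of_orthogonal hp hp hpp
    have hs2 : Summable fun l => p l * p l := summable_of_geometric fun l =>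
      (norm_mul_le _ _).trans ((mul_le_mul (hp' l) (hp' l) (norm_nonneg _) (by positivity)).trans
        (hsq l))
    have s4 := tsum_mul_tsum_of_orthogonal hs2 hs2 fun i j hij => by
      rw [mul_assoc, ← mul_assoc (p i) (p j), hpp i j hij, zero_mul, mul_zero]
    rw [show (∑' l, p l) ^ 4 = ((∑' l, p l) * (∑' l, p l)) * ((∑' l, p l) * (∑' l, p l)) by
      noncomm_ring, s2, s4]
    refine tsum_congr fun l => ?_
    rw [h1]; noncomm_ring
  have e2 : star (∑' l, y l) * (∑' l, y l) ≤ ∑' l, q l := by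
    rw [tsum_star, tsum_mul_tsum_of_orthogonal hy.star hy hy2]
    refine Summable.tsum_le_tsum h2 (summable_of_geometric fun l => ?_) hq
    refine (norm_mul_le _ _).trans (le_trans ?_ (hsq l))
    rw [norm_star]
    exact mul_le_mul (hy' l) (hy' l) (norm_nonneg _) (by positivity)
  have h4 : 0 ≤ (∑' l, p l) ^ 4 := CStarAlgebra.pow_nonneg hp0 4
  refine (cuntzLE_pow hp0 4 h4).trans ?_
  have := cuntzLE_mul_star (y := ∑' l, y l)
  simp only [e1] at this
  exact this.trans (CuntzLE.of_le _ hq0 e2)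

end Sums

/-! ### The structure of maps of order zero -/

section TwoPositive

variable {C B : Type*} [CStarAlgebra C] [PartialOrder C] [StarOrderedRing C] [CStarAlgebra B]
  [PartialOrder B] [StarOrderedRing B] (ψ : CompletelyPositiveMap C B)

/-- The matrix with entries `ψ (x⋆ x), ψ (x⋆ y), ψ (y⋆ x), ψ (y⋆ y)` is positive, being of the form
`D⋆ D`. -/
lemma exists_star_mul_self_of_completelyPositive (x y : C) : ∃ D : Mat 2 B,
    ∀ i j, ψ (star (![x, y] i) * ![x, y] j) = ∑ q, star (D.entries q i) * D.entries q j := by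
  let R : Mat 2 C := Mat.of (Matrix.of fun q i => if q = 0 then ![x, y] i else 0)
  have hR : (0 : Mat 2 C) ≤ star R * R := star_mul_self_nonneg R
  have h := ψ.map_cstarMatrix_nonneg' 2 (star R * R) hR
  obtain ⟨D, hD⟩ := CStarAlgebra.nonneg_iff_eq_star_mul_self.mp
    (show (0 : Mat 2 B) ≤ Mat.of (CStarMatrix.map (star R * R) ψ) from h)
  refine ⟨D, fun i j => ?_⟩
  have h1 : (Mat.of (CStarMatrix.map (star R * R) ψ)).entries i j =
      (D.entriesᴴ * D.entries) i j := by rw [hD]; rfl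
  rw [Matrix.mul_apply] at h1
  have h2 : (star R * R).entries i j = ∑ q, star (R.entries q i) * R.entries q j :=
    Matrix.mul_apply (M := R.entriesᴴ) (N := R.entries)
  have h3 : ∀ q i, R.entries q i = if q = 0 then ![x, y] i else 0 := fun _ _ => rfl
  simp only [h3, Fin.sum_univ_two] at h2
  simp only [if_true, Fin.isValue, one_ne_zero, if_false, mul_zero, add_zero] at h2
  rw [← h2]
  exact h1

lemma CompletelyPositiveMap.map_star_mul (x y : C) : ψ (star y * x) = star (ψ (star x * y)) := by
  obtain ⟨D, hD⟩ := exists_star_mul_self_of_completelyPositive ψ x y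
  have h1 := hD 1 0
  have h2 := hD 0 1
  simp only [Matrix.cons_val_zero, Matrix.cons_val_one] at h1 h2
  rw [h1, h2, star_sum]
  simp only [star_mul, star_star]

/-- The positivity of the `2 × 2` matrix of `ψ`, tested on the column with entries `-c` and `1`. -/
lemma CompletelyPositiveMap.column_nonneg (x y : C) (c : B) :
    0 ≤ star c * ψ (star x * x) * c - star c * ψ (star x * y) - ψ (star y * x) * c +
      ψ (star y * y) := by
  obtain ⟨D, hD⟩ := exists_star_mul_self_of_completelyPositive ψ x y
  have h00 := hD 0 0
  have h01 := hD 0 1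
  have h10 := hD 1 0
  have h11 := hD 1 1
  simp only [Matrix.cons_val_zero, Matrix.cons_val_one] at h00 h01 h10 h11
  have : star c * ψ (star x * x) * c - star c * ψ (star x * y) - ψ (star y * x) * c +
      ψ (star y * y) =
      ∑ q, star (D.entries q 1 - D.entries q 0 * c) * (D.entries q 1 - D.entries q 0 * c) := by
    rw [h00, h01, h10, h11]
    simp only [Fin.sum_univ_two, star_sub, star_mul]
    noncomm_ring
  rw [this]
  exact Finset.sum_nonneg fun q _ => star_mul_self_nonneg _

end TwoPositive

section MatrixUnits

variable {K : ℕ}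

/-- The matrix units of `M_K(ℂ)`. -/
def matrixUnit (i j : Fin K) : Mat K ℂ := Mat.of (Matrix.single i j 1)

lemma star_matrixUnit (i j : Fin K) : star (matrixUnit i j) = matrixUnit j i := by
  rw [matrixUnit, ← Mat.of_conjTranspose, Matrix.conjTranspose_single, star_one]
  rfl

lemma matrixUnit_mul_same (i j l : Fin K) : matrixUnit i j * matrixUnit j l = matrixUnit i l := by
  rw [matrixUnit, matrixUnit, ← Mat.of_mul, Matrix.single_mul_single_same, one_mul]
  rfl

lemma matrixUnit_mul_of_ne (i l : Fin K) {j j' : Fin K} (h : j ≠ j') :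
    matrixUnit i j * matrixUnit j' l = 0 := by
  rw [matrixUnit, matrixUnit, ← Mat.of_mul, Matrix.single_mul_single_of_ne _ _ _ _ h]
  rfl

lemma sum_matrixUnit : ∑ i : Fin K, matrixUnit i i = 1 := by
  have : ∑ i : Fin K, (Matrix.single i i 1 : Matrix (Fin K) (Fin K) ℂ) = 1 :=
    Matrix.sum_single_one
  exact this

lemma matrixUnit_nonneg (i : Fin K) : 0 ≤ matrixUnit i i := by
  rw [← matrixUnit_mul_same i i i]
  nth_rw 1 [← star_matrixUnit i i]
  exact star_mul_self_nonneg _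

lemma norm_matrixUnit_le (i j : Fin K) : ‖matrixUnit i j‖ ≤ 1 := by
  have h : ∀ i : Fin K, ‖matrixUnit i i‖ ≤ 1 := fun i => by
    have h1 : ‖matrixUnit i i‖ * ‖matrixUnit i i‖ = ‖matrixUnit i i‖ := by
      rw [← CStarRing.norm_star_mul_self, star_matrixUnit, matrixUnit_mul_same]
    nlinarith [norm_nonneg (matrixUnit i i)]
  have h2 := CStarRing.norm_star_mul_self (x := matrixUnit i j)
  rw [star_matrixUnit, matrixUnit_mul_same] at h2
  nlinarith [h j, norm_nonneg (matrixUnit i j)]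

end MatrixUnits

section OrderZero

variable {K : ℕ} {B : Type*} [CStarAlgebra B] [PartialOrder B] [StarOrderedRing B]
  {ψ : CompletelyPositiveMap (Mat K ℂ) B}

lemma eq_zero_of_star_mul_self_le {x : B} (h : star x * x ≤ 0) : x = 0 :=
  CStarRing.star_mul_self_eq_zero_iff x |>.mp (le_antisymm h (star_mul_self_nonneg x))

lemma orderZero_star (ψ : CompletelyPositiveMap (Mat K ℂ) B) (i j : Fin K) :
    star (ψ (matrixUnit i j)) = ψ (matrixUnit j i) := by
  have := CompletelyPositiveMap.map_star_mul ψ (matrixUnit i i) (matrixUnit i j)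
  rw [star_matrixUnit, star_matrixUnit, matrixUnit_mul_same, matrixUnit_mul_same] at this
  exact this.symm

lemma orderZero_nonneg (ψ : CompletelyPositiveMap (Mat K ℂ) B) (i : Fin K) :
    0 ≤ ψ (matrixUnit i i) := map_nonneg ψ (matrixUnit_nonneg i)

lemma orderZero_norm_le (hψ : IsContractiveOrderZero ψ) (i j : Fin K) :
    ‖ψ (matrixUnit i j)‖ ≤ 1 :=
  (hψ.1 _).trans (norm_matrixUnit_le i j)

lemma orderZero_mul_eq_zero (hψ : IsContractiveOrderZero ψ) {i j : Fin K} (hij : i ≠ j) :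
    ψ (matrixUnit i i) * ψ (matrixUnit j j) = 0 :=
  hψ.2 _ _ (matrixUnit_nonneg i) (matrixUnit_nonneg j) (matrixUnit_mul_of_ne i j hij)

/-- The compression of `ψ(e_ii) ≤ 1` by `t = ψ(e_ij)`, and the positivity of the `2 × 2` matrix with
rows `ψ(e_ii), t` and `t⋆, ψ(e_jj)` on the column with entries `-t, 1`, together give
`t⋆ t ≤ ψ(e_jj)`. -/
lemma orderZero_star_mul_le (hψ : IsContractiveOrderZero ψ) (i j : Fin K) :
    star (ψ (matrixUnit i j)) * ψ (matrixUnit i j) ≤ ψ (matrixUnit j j) := by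
  have h1 := CompletelyPositiveMap.column_nonneg ψ (matrixUnit i i) (matrixUnit i j)
    (ψ (matrixUnit i j))
  simp only [star_matrixUnit, matrixUnit_mul_same] at h1
  rw [← orderZero_star ψ i j] at h1
  have hle : ψ (matrixUnit i i) ≤ 1 :=
    (CStarAlgebra.norm_le_one_iff_of_nonneg _ (orderZero_nonneg ψ i)).mp (orderZero_norm_le hψ i i)
  have h2 := star_left_conjugate_le_conjugate hle (ψ (matrixUnit i j))
  rw [mul_one] at h2
  have h3 := add_nonneg h1 (sub_nonneg.mpr h2)
  rw [← sub_nonneg]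
  convert h3 using 1
  abel

lemma orderZero_star_mul_mul_le (hψ : IsContractiveOrderZero ψ) (i j : Fin K) :
    star (ψ (matrixUnit i i) * ψ (matrixUnit i j)) * (ψ (matrixUnit i i) * ψ (matrixUnit i j)) ≤
      ψ (matrixUnit j j) := by
  have hs := orderZero_star ψ i i
  have h1 : star (ψ (matrixUnit i i)) * ψ (matrixUnit i i) ≤ 1 := by
    refine (CStarAlgebra.norm_le_one_iff_of_nonneg _ (star_mul_self_nonneg _)).mp ?_
    rw [CStarRing.norm_star_mul_self]
    exact mul_le_one₀ (orderZero_norm_le hψ i i) (norm_nonneg _) (orderZero_norm_le hψ i i)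
  have h2 := star_left_conjugate_le_conjugate h1 (ψ (matrixUnit i j))
  rw [mul_one] at h2
  refine le_trans (le_of_eq ?_) (h2.trans (orderZero_star_mul_le hψ i j))
  rw [star_mul]
  simp only [mul_assoc]

/-- A map of order zero sends `e_ij` to an element whose right support is orthogonal to the image
of `e_ii`. -/
lemma orderZero_unit_mul (hψ : IsContractiveOrderZero ψ) {i j : Fin K} (hij : i ≠ j) :
    ψ (matrixUnit i j) * ψ (matrixUnit i i) = 0 := by
  refine eq_zero_of_star_mul_self_le ?_
  have hs := orderZero_star ψ i i
  have h1 := star_left_conjugate_le_conjugate (orderZero_star_mul_le hψ i j) (ψ (matrixUnit i i))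
  rw [hs, mul_assoc (ψ (matrixUnit i i)) (ψ (matrixUnit j j)),
    orderZero_mul_eq_zero hψ hij.symm, mul_zero] at h1
  rw [star_mul, hs]
  simpa only [mul_assoc] using h1

/-- The structure of a map of order zero: if `h` is the image of `e_ii` and `t` the one of
`e_ij`, then `(h t) (h t)⋆ = h⁴`. This follows from the orthogonality of the images of the
projections `(e_ii + e_jj ± (e_ij + e_ji)) / 2`. -/
lemma orderZero_mul_mul_star (hψ : IsContractiveOrderZero ψ) {i j : Fin K} (hij : i ≠ j) :
    ψ (matrixUnit i i) * ψ (matrixUnit i j) * star (ψ (matrixUnit i i) * ψ (matrixUnit i j)) =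
      ψ (matrixUnit i i) ^ 4 := by
  have hmul : ∀ p q r s : Fin K, matrixUnit p q * matrixUnit r s =
      if q = r then matrixUnit p s else 0 := fun p q r s => by
    split_ifs with h
    · rw [h, matrixUnit_mul_same]
    · exact matrixUnit_mul_of_ne p s h
  set P : Mat K ℂ := matrixUnit i i + matrixUnit j j + (matrixUnit i j + matrixUnit j i) with hP
  set Q : Mat K ℂ := matrixUnit i i + matrixUnit j j - (matrixUnit i j + matrixUnit j i) with hQ
  have hP0 : 0 ≤ P := by
    have : P = star (matrixUnit i i + matrixUnit i j) * (matrixUnit i i + matrixUnit i j) := by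
      simp only [hP, star_add, star_matrixUnit, add_mul, mul_add, hmul, if_true]
      abel
    rw [this]; exact star_mul_self_nonneg _
  have hQ0 : 0 ≤ Q := by
    have : Q = star (matrixUnit i i - matrixUnit i j) * (matrixUnit i i - matrixUnit i j) := by
      simp only [hQ, star_sub, star_matrixUnit, sub_mul, mul_sub, hmul, if_true]
      abel
    rw [this]; exact star_mul_self_nonneg _
  have hPQ : P * Q = 0 := by
    simp only [hP, hQ, add_mul, mul_add, mul_sub, hmul, if_true, hij, hij.symm, if_false]
    abel
  have hQP : Q * P = 0 := by
    simp only [hP, hQ, add_mul, mul_add, sub_mul, hmul, if_true, hij, hij.symm, if_false]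
    abel
  have h1 := hψ.2 P Q hP0 hQ0 hPQ
  have h2 := hψ.2 Q P hQ0 hP0 hQP
  have ht := orderZero_star ψ i j
  have hs := orderZero_star ψ i i
  have o1 := orderZero_mul_eq_zero hψ hij
  have o2 := orderZero_mul_eq_zero hψ hij.symm
  have o3 := orderZero_unit_mul hψ hij
  have o4 : ψ (matrixUnit i i) * ψ (matrixUnit j i) = 0 := by
    have := congrArg star o3
    rwa [star_mul, hs, ht, star_zero] at this
  simp only [hP, hQ, map_add, map_sub] at h1 h2
  rw [star_mul, ht, hs]
  generalize ψ (matrixUnit i i) = h at *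
  generalize ψ (matrixUnit j j) = h' at *
  generalize ψ (matrixUnit i j) = t at *
  generalize ψ (matrixUnit j i) = t' at *
  -- the two orthogonality relations add up to `(h + h')² = (t + t⋆)²`; compress it by `h`
  have h3 : (2 : ℂ) • ((h + h') * (h + h')) = (2 : ℂ) • ((t + t') * (t + t')) := by
    rw [two_smul, two_smul]
    have := congrArg₂ (· + ·) h1 h2
    simp only [add_zero] at this
    rw [← sub_eq_zero, ← this]
    noncomm_ring
  have h4 := smul_right_injective B (two_ne_zero (α := ℂ)) h3
  have e1 : h * ((h + h') * (h + h')) * h = h ^ 4 := by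
    have e : h * ((h + h') * (h + h')) * h =
      h ^ 4 + h * h * (h' * h) + (h * h') * h * h + (h * h') * (h' * h) := by noncomm_ring
    rw [e, o2, o1]
    simp
  have e2 : h * ((t + t') * (t + t')) * h = h * t * (t' * h) := by
    have e : h * ((t + t') * (t + t')) * h =
      h * t * (t' * h) + h * t * (t * h) + (h * t') * (t + t') * h := by noncomm_ring
    rw [e, o3, o4]
    simp
  rw [← e1, ← e2]
  exact congrArg (fun x => h * x * h) h4.symm

end OrderZero

/-! ### Gluing maps of order zero -/

section Glue

variable {A : Type*} [CStarAlgebra A] [PartialOrder A] [StarOrderedRing A] {n K : ℕ}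

instance : IsOrderedAddMonoid (CuntzSemigroup A) where
  add_le_add_left _ _ h _ := cuntz_add_le_add h le_rfl

/-- The images of the diagonal matrix units under a map of order zero have the same class. -/
lemma orderZero_matClass_le {ψ : CompletelyPositiveMap (Mat K ℂ) (Mat n A)}
    (hψ : IsContractiveOrderZero ψ) (i j : Fin K) :
    matClass _ (orderZero_nonneg ψ i) ≤ matClass _ (orderZero_nonneg ψ j) := by
  rcases eq_or_ne i j with rfl | hij
  · exact le_rfl
  have h4 : 0 ≤ ψ (matrixUnit i i) ^ 4 := CStarAlgebra.pow_nonneg (orderZero_nonneg ψ i) 4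
  refine (cuntzLE_pow (orderZero_nonneg ψ i) 4 h4).trans ?_
  have h := cuntzLE_mul_star (y := ψ (matrixUnit i i) * ψ (matrixUnit i j))
  simp only [orderZero_mul_mul_star hψ hij] at h
  exact h.trans (CuntzLE.of_le _ (orderZero_nonneg ψ j) (orderZero_star_mul_mul_le hψ i j))

lemma tsum_mem_her {a : Mat n A} {x : ℕ → Mat n A} (hx : Summable x) (h : ∀ l, x l ∈ her a) :
    ∑' l, x l ∈ her a := by
  rw [her_eq_topologicalClosure] at *
  exact (Submodule.isClosed_topologicalClosure _).mem_of_tendsto hx.hasSum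
    (Filter.Eventually.of_forall fun s => Submodule.sum_mem _ fun l _ => h l)

lemma sum_mem_her {a : Mat n A} {ι : Type*} (s : Finset ι) {x : ι → Mat n A}
    (h : ∀ l, x l ∈ her a) : ∑ l ∈ s, x l ∈ her a := by
  rw [her_eq_topologicalClosure] at *
  exact Submodule.sum_mem _ fun l _ => h l

lemma smul_mem_her {a x : Mat n A} (h : x ∈ her a) (c : ℝ) : c • x ∈ her a := by
  rw [her_eq_topologicalClosure] at *
  exact Submodule.smul_mem _ (c : ℂ) h

/-- A sequence of maps of order zero on `M_K(ℂ)`, with values in orthogonal hereditary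
subalgebras of `her(a)`, is glued to an element `z` with `K ⟨z⟩ ≤ ⟨a⟩`, whose rank is at least
`K⁻¹` times the sum of the traces of the images of the units. -/
lemma exists_of_orthogonal_orderZero {a : Mat n A} (ha : 0 ≤ a) {b : ℕ → Mat n A}
    (hbb : ∀ l m, l ≠ m → b l * b m = 0) (hba : ∀ l, her (b l) ⊆ her a) (hK : 0 < K)
    {ψ : ℕ → CompletelyPositiveMap (Mat K ℂ) (Mat n A)} (hψ : ∀ l, IsContractiveOrderZero (ψ l))
    (hmem : ∀ l x, ψ l x ∈ her (b l)) :
    ∃ z : PosMat A, K • cuntzClass z ≤ matClass a ha ∧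
      ∀ (τ : NormalizedQuasitrace A) (I : ℕ),
        ∑ l ∈ Finset.range I, (τ.toFun n (ψ l 1)).re ≤ K * τ.rank z := by
  -- the weights `2⁻ˡ` make the series of the glued elements converge
  set w : ℕ → ℝ := fun l => (1 / 2) ^ l with hw
  have hw0 : ∀ l, 0 ≤ w l := fun l => by positivity
  have hw1 : ∀ l, w l ≤ 1 := fun l => pow_le_one₀ (by norm_num) (by norm_num)
  set p : Fin K → ℕ → Mat n A := fun j l => w l • ψ l (matrixUnit j j) with hp
  have hp0 : ∀ j l, 0 ≤ p j l := fun j l => smul_nonneg (hw0 l) (orderZero_nonneg _ j)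
  have hpn : ∀ j l, ‖p j l‖ ≤ (1 / 2) ^ l := fun j l => by
    rw [hp, norm_smul, Real.norm_of_nonneg (hw0 l)]
    exact mul_le_of_le_one_right (hw0 l) (orderZero_norm_le (hψ l) j j)
  have hps : ∀ j, Summable (p j) := fun j => summable_of_geometric (hpn j)
  have hψψ : ∀ l m, l ≠ m → ∀ x y, ψ l x * ψ m y = 0 := fun l m hlm x y =>
    mul_eq_zero_of_mem_her (hbb l m hlm) (hmem l x) (hmem m y)
  have hpp : ∀ i j l m, l ≠ m → p i l * p j m = 0 := fun i j l m hlm => by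
    simp only [hp, smul_mul_smul_comm, hψψ l m hlm, smul_zero]
  have hZ0 : ∀ j, 0 ≤ ∑' l, p j l := fun j => tsum_nonneg (hp0 j)
  have hZorth : ∀ i j, i ≠ j → (∑' l, p i l) * (∑' l, p j l) = 0 := fun i j hij => by
    rw [tsum_mul_tsum_of_orthogonal (hps i) (hps j) (hpp i j)]
    simp only [hp, smul_mul_smul_comm, orderZero_mul_eq_zero (hψ _) hij, smul_zero, tsum_zero]
  have hpmem : ∀ j l, p j l ∈ her a := fun j l => smul_mem_her (hba l (hmem l _)) _
  have hle : ∀ i j, matClass _ (hZ0 i) ≤ matClass _ (hZ0 j) := fun i j => by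
    rcases eq_or_ne i j with rfl | hij
    · exact le_rfl
    refine matClass_tsum_le
      (y := fun l => (w l ^ 2) • (ψ l (matrixUnit i i) * ψ l (matrixUnit i j)))
      (hpn i) (hps j) (fun l => ?_) (hpp i i) (fun l m hlm => ?_) (fun l m hlm => ?_)
      (fun l => ?_) (fun l => ?_) _ _
    · rw [norm_smul, Real.norm_of_nonneg (sq_nonneg _), sq, mul_assoc]
      refine mul_le_of_le_one_right (hw0 l) (mul_le_one₀ (hw1 l) (norm_nonneg _) ?_)
      exact (norm_mul_le _ _).trans (mul_le_one₀ (orderZero_norm_le (hψ l) _ _) (norm_nonneg _)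
        (orderZero_norm_le (hψ l) _ _))
    · rw [star_smul, star_mul, smul_mul_smul_comm, orderZero_star, mul_assoc,
        ← mul_assoc (ψ l (matrixUnit i j)), hψψ l m hlm, zero_mul, mul_zero, smul_zero]
    · rw [star_smul, star_mul, smul_mul_smul_comm, orderZero_star, mul_assoc,
        ← mul_assoc (star (ψ l (matrixUnit i i))), orderZero_star, hψψ l m hlm, zero_mul, mul_zero,
        smul_zero]
    · rw [star_smul, smul_mul_smul_comm, orderZero_mul_mul_star (hψ l) hij, hp, smul_pow]
      congr 1
      simp only [star_trivial]
      ring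
    · rw [star_smul, smul_mul_smul_comm]
      refine le_trans (smul_le_smul_of_nonneg_left (orderZero_star_mul_mul_le (hψ l) i j)
        (by simp only [star_trivial]; positivity)) ?_
      refine smul_le_smul_of_nonneg_right ?_ (orderZero_nonneg _ j)
      simp only [star_trivial]
      have := mul_le_one₀ (hw1 l) (sq_nonneg (w l)) (pow_le_one₀ (hw0 l) (hw1 l))
      nlinarith [hw0 l]
  refine ⟨posMat _ (hZ0 ⟨0, hK⟩), ?_, fun τ I => ?_⟩
  · have hsum0 : 0 ≤ ∑ j, ∑' l, p j l := Finset.sum_nonneg fun j _ => hZ0 j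
    calc K • matClass _ (hZ0 ⟨0, hK⟩)
        = ∑ _j : Fin K, matClass _ (hZ0 ⟨0, hK⟩) := by simp
      _ ≤ ∑ j, matClass _ (hZ0 j) := Finset.sum_le_sum fun j _ => hle _ j
      _ ≤ matClass _ hsum0 := sum_matClass_le _ _ hZ0 hZorth
      _ ≤ matClass a ha := matClass_le_of_mem_her ha hsum0
        (sum_mem_her _ fun j => tsum_mem_her (hps j) (hpmem j))
  · set j₀ : Fin K := ⟨0, hK⟩
    have h1 : ∀ l, (τ.toFun n (ψ l 1)).re ≤ K * τ.rankHom (matClass _ (hp0 j₀ l)) := fun l => by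
      have h0 : 0 ≤ ψ l 1 := map_nonneg (ψ l) zero_le_one
      have e : ψ l 1 = ∑ j, ψ l (matrixUnit j j) := by rw [← sum_matrixUnit, map_sum]
      have hn : ‖ψ l 1‖ ≤ 1 := ((hψ l).1 1).trans (CStarAlgebra.norm_le_one_iff_of_nonneg _
        zero_le_one |>.mpr le_rfl)
      calc (τ.toFun n (ψ l 1)).re ≤ τ.rankHom (matClass _ h0) :=
            τ.eval_le_rank (a := posMat _ h0) hn
        _ ≤ τ.rankHom (∑ j, matClass _ (orderZero_nonneg (ψ l) j)) := by
            refine τ.rankHom_mono ?_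
            simp only [e]
            exact matClass_sum_le _ _ _
        _ ≤ ∑ _j : Fin K, τ.rankHom (matClass _ (hp0 j₀ l)) := by
            rw [map_sum]
            refine Finset.sum_le_sum fun j _ => τ.rankHom_mono ?_
            refine (orderZero_matClass_le (hψ l) j j₀).trans ?_
            have hwpos : 0 < w l := by positivity
            have e2 : (w l)⁻¹ • p j₀ l = ψ l (matrixUnit j₀ j₀) := by
              simp only [hp, smul_smul, inv_mul_cancel₀ hwpos.ne', one_smul]
            have := CuntzLE.smul (hp0 j₀ l) (inv_nonneg.mpr (hw0 l))
              (e2.symm ▸ orderZero_nonneg _ j₀)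
            simp only [e2] at this
            exact this
        _ = K * τ.rankHom (matClass _ (hp0 j₀ l)) := by simp
    have hS : 0 ≤ ∑ l ∈ Finset.range I, p j₀ l := Finset.sum_nonneg fun l _ => hp0 j₀ l
    calc ∑ l ∈ Finset.range I, (τ.toFun n (ψ l 1)).re
        ≤ ∑ l ∈ Finset.range I, K * τ.rankHom (matClass _ (hp0 j₀ l)) :=
          Finset.sum_le_sum fun l _ => h1 l
      _ = K * τ.rankHom (∑ l ∈ Finset.range I, matClass _ (hp0 j₀ l)) := by
          rw [map_sum, Finset.mul_sum]
      _ ≤ K * τ.rankHom (matClass _ hS) := by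
          refine mul_le_mul_of_nonneg_left (τ.rankHom_mono ?_) (Nat.cast_nonneg K)
          refine sum_matClass_le _ _ (hp0 j₀) ?_
          exact fun l m hlm => hpp _ _ l m hlm
      _ ≤ K * τ.rankHom (matClass _ (hZ0 j₀)) := by
          refine mul_le_mul_of_nonneg_left (τ.rankHom_mono ?_) (Nat.cast_nonneg K)
          exact CuntzLE.of_le hS (hZ0 j₀) ((hps j₀).sum_le_tsum _ fun l _ => hp0 j₀ l)

end Glue

/-! ### Bands -/

section Bands

/-- For fixed `s` the functions `band M s i`, `i = 0, 1, …`, have disjoint supports in `(0, ∞)`.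
Each of the differences `g_{N+1} - g_N` of the functions `g_N = ramp (1/2)^N` is left out of their
sum for `N = s` modulo `M` only. Summing over the residues `s`, these gaps add up to at most `1`,
while the functions add up to nearly `M - 1`. -/
noncomputable def band (M s : ℕ) : ℕ → ℝ → ℝ
  | 0 => ramp ((1 / 2) ^ s)
  | i + 1 => fun t => ramp ((1 / 2) ^ ((i + 1) * M + s)) t - ramp ((1 / 2) ^ (i * M + s + 1)) t

lemma band_succ_apply (M s i : ℕ) (t : ℝ) : band M s (i + 1) t =
    ramp ((1 / 2) ^ ((i + 1) * M + s)) t - ramp ((1 / 2) ^ (i * M + s + 1)) t := rfl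

@[fun_prop]
lemma continuous_band (M s i : ℕ) : Continuous (band M s i) := by
  cases i <;> unfold band <;> fun_prop

lemma half_pow_le {i j : ℕ} (h : i ≤ j) : ((1 : ℝ) / 2) ^ j ≤ (1 / 2) ^ i :=
  pow_le_pow_of_le_one (by norm_num) (by norm_num) h

lemma ramp_half_pow_le {i j : ℕ} (h : i ≤ j) {t : ℝ} (ht : 0 ≤ t) :
    ramp ((1 / 2) ^ i) t ≤ ramp ((1 / 2) ^ j) t :=
  ramp_le_ramp ht (by positivity) (half_pow_le h)

lemma band_nonneg {M : ℕ} (hM : 0 < M) (s i : ℕ) {t : ℝ} (ht : 0 ≤ t) : 0 ≤ band M s i t := by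
  cases i with
  | zero => exact ramp_nonneg _ _
  | succ i =>
    refine sub_nonneg.mpr (ramp_half_pow_le ?_ ht)
    rw [add_mul]; omega

lemma band_le_one (M s i : ℕ) (t : ℝ) : band M s i t ≤ 1 := by
  cases i with
  | zero => exact ramp_le_one _ _
  | succ i => exact (sub_le_self _ (ramp_nonneg _ _)).trans (ramp_le_one _ _)

lemma lt_of_band_ne_zero {M : ℕ} (hM : 0 < M) {s i : ℕ} {t : ℝ} (ht : 0 ≤ t)
    (h : band M s i t ≠ 0) : (1 / 2 : ℝ) ^ (i * M + s + 1) < t := by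
  have key : ramp ((1 / 2) ^ (i * M + s)) t ≠ 0 := by
    cases i with
    | zero => simpa [band] using h
    | succ i =>
      intro h0
      have h1 := ramp_half_pow_le (show i * M + s + 1 ≤ (i + 1) * M + s by rw [add_mul]; omega) ht
      rw [h0] at h1
      exact h (by rw [band_succ_apply, h0, le_antisymm h1 (ramp_nonneg _ _), sub_zero])
  have := half_lt_of_ramp_ne_zero (by positivity) key
  rwa [pow_succ, mul_one_div]

lemma lt_of_band_succ_ne_zero {M : ℕ} (hM : 0 < M) {s i : ℕ} {t : ℝ} (ht : 0 ≤ t)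
    (h : band M s (i + 1) t ≠ 0) : t < (1 / 2 : ℝ) ^ (i * M + s + 1) := by
  by_contra! h'
  have h1 := ramp_half_pow_le (show i * M + s + 1 ≤ (i + 1) * M + s by rw [add_mul]; omega) ht
  have h2 := ramp_eq_one (by positivity) h'
  rw [h2] at h1
  exact h (by rw [band_succ_apply, h2, le_antisymm (ramp_le_one _ _) h1, sub_self])

lemma band_mul_band {M : ℕ} (hM : 0 < M) (s : ℕ) {i j : ℕ} (hij : i ≠ j) {t : ℝ} (ht : 0 ≤ t) :
    band M s i t * band M s j t = 0 := by
  wlog h : i < j generalizing i j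
  · rw [mul_comm]
    exact this hij.symm (by omega)
  by_contra h0
  obtain ⟨j, rfl⟩ : ∃ k, j = k + 1 := ⟨j - 1, by omega⟩
  have h1 := lt_of_band_ne_zero hM ht (left_ne_zero_of_mul h0)
  have h2 := lt_of_band_succ_ne_zero hM ht (right_ne_zero_of_mul h0)
  have h3 : i * M + s + 1 ≤ j * M + s + 1 := by gcongr; omega
  linarith [half_pow_le h3]

lemma ramp_mul_band {M : ℕ} (hM : 0 < M) (s i : ℕ) {t : ℝ} (ht : 0 ≤ t) :
    ramp ((1 / 2) ^ (i * M + s + 1)) t * band M s i t = band M s i t := by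
  by_cases h0 : band M s i t = 0
  · rw [h0, mul_zero]
  · rw [ramp_eq_one (by positivity) (lt_of_band_ne_zero hM ht h0).le, one_mul]

section cfc

variable {B : Type*} [CStarAlgebra B] [PartialOrder B] [StarOrderedRing B] {a : B} {M : ℕ}

lemma cfc_band_nonneg (ha : 0 ≤ a) (hM : 0 < M) (s i : ℕ) : 0 ≤ cfc (band M s i) a :=
  cfc_nonneg fun _ ht => band_nonneg hM s i (spectrum_nonneg_of_nonneg ha ht)

lemma norm_cfc_band_le_one (ha : 0 ≤ a) (hM : 0 < M) (s i : ℕ) : ‖cfc (band M s i) a‖ ≤ 1 :=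
  norm_cfc_le zero_le_one fun t ht => by
    rw [Real.norm_of_nonneg (band_nonneg hM s i (spectrum_nonneg_of_nonneg ha ht))]
    exact band_le_one M s i t

lemma cfc_band_mul_cfc_band (ha : 0 ≤ a) (hM : 0 < M) (s : ℕ) {i j : ℕ} (hij : i ≠ j) :
    cfc (band M s i) a * cfc (band M s j) a = 0 := by
  rw [← cfc_mul _ _ a (by fun_prop) (by fun_prop), ← cfc_zero ℝ a]
  exact cfc_congr fun t ht => band_mul_band hM s hij (spectrum_nonneg_of_nonneg ha ht)

lemma her_cfc_band_subset (ha : 0 ≤ a) (hM : 0 < M) (s i : ℕ) :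
    her (cfc (band M s i) a) ⊆ her a := by
  have h : cfc (ramp ((1 / 2) ^ (i * M + s + 1))) a * cfc (band M s i) a =
      cfc (band M s i) a := by
    rw [← cfc_mul _ _ a (by fun_prop) (by fun_prop)]
    exact cfc_congr fun t ht => ramp_mul_band hM s i (spectrum_nonneg_of_nonneg ha ht)
  refine her_subset_her ha (by positivity) h ?_
  rw [← (cfc_commute_cfc _ _ a).eq, h]

end cfc

lemma sum_sum_telescope (γ : ℕ → ℝ) (M I : ℕ) :
    ∑ s ∈ Finset.range M, (γ s + ∑ i ∈ Finset.range I, (γ ((i + 1) * M + s) - γ (i * M + s + 1))) =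
      ∑ s ∈ Finset.range M, γ (I * M + s) + γ 0 - γ (I * M) := by
  induction I with
  | zero => simp
  | succ I ih =>
    simp only [Finset.sum_range_succ _ I, ← add_assoc]
    rw [Finset.sum_add_distrib, ih, Finset.sum_sub_distrib]
    have h1 := Finset.sum_range_succ (fun s => γ (I * M + s)) M
    have h2 := Finset.sum_range_succ' (fun s => γ (I * M + s)) M
    simp only [← add_assoc, add_zero] at h2
    rw [show (I + 1) * M = I * M + M by ring]
    linarith

variable {A : Type*} [CStarAlgebra A] [PartialOrder A] [StarOrderedRing A]

lemma NormalizedQuasitrace.sum_band (τ : NormalizedQuasitrace A) (a : PosMat A) (M s I : ℕ) :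
    ∑ i ∈ Finset.range (I + 1), (τ.toFun a.size (cfc (band M s i) a.val)).re =
      τ.cut ((1 / 2) ^ s) a + ∑ i ∈ Finset.range I,
        (τ.cut ((1 / 2) ^ ((i + 1) * M + s)) a - τ.cut ((1 / 2) ^ (i * M + s + 1)) a) := by
  rw [Finset.sum_range_succ', add_comm]
  congr 1
  exact Finset.sum_congr rfl fun i _ =>
    (τ.isQuasitrace _).re_cfc_sub a.val (continuous_ramp _) (continuous_ramp _)

/-- The functions `band M s i` of `a`, for `s < M`, have traces which add up to nearly `M - 1`
times the rank of `a`. -/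
lemma NormalizedQuasitrace.le_sum_band (τ : NormalizedQuasitrace A) (a : PosMat A) (M I : ℕ) :
    (M - 1) * τ.cut ((1 / 2) ^ (I * M)) a ≤ ∑ s ∈ Finset.range M, ∑ i ∈ Finset.range (I + 1),
      (τ.toFun a.size (cfc (band M s i) a.val)).re := by
  simp only [τ.sum_band]
  rw [sum_sum_telescope (fun j => τ.cut ((1 / 2) ^ j) a)]
  have h1 : ∑ _s ∈ Finset.range M, τ.cut ((1 / 2) ^ (I * M)) a ≤
      ∑ s ∈ Finset.range M, τ.cut ((1 / 2) ^ (I * M + s)) a :=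
    Finset.sum_le_sum fun s _ => τ.cut_anti (by positivity) (half_pow_le (by omega)) a
  rw [Finset.sum_const, Finset.card_range, nsmul_eq_mul] at h1
  have h2 := τ.cut_nonneg ((1 / 2) ^ 0) a
  linarith

/-- Tracial almost divisibility, upgraded from the trace of `a` to its rank. -/
lemma IsTraciallyAlmostDivisible.exists_rank (hA : IsTraciallyAlmostDivisible A 0) (a : PosMat A)
    {M K : ℕ} (hM : 0 < M) (hK : 0 < K) {ε : ℝ} (hε : 0 < ε) :
    ∃ x : CuntzSemigroup A, K • x ≤ M • cuntzClass a ∧ ∀ τ : NormalizedQuasitrace A,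
      (M - 1) * τ.rank a - M * ε ≤ K * τ.rankHom x := by
  have hψ : ∀ s i, ∃ ψ : CompletelyPositiveMap (Mat K ℂ) (Mat a.size A),
      IsContractiveOrderZero ψ ∧ (∀ x, ψ x ∈ her (cfc (band M s i) a.val)) ∧
      ∀ τ : NormalizedQuasitrace A, (τ.toFun a.size (cfc (band M s i) a.val)).re -
        ε / 2 * (1 / 2) ^ i ≤ (τ.toFun a.size (ψ 1)).re := fun s i => by
    obtain ⟨ψ, h1, h2, h3⟩ := hA (posMat _ (cfc_band_nonneg a.nonneg hM s i))
      (norm_cfc_band_le_one a.nonneg hM s i) (ε / 2 * (1 / 2) ^ i) (by positivity) K hK.ne'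
    refine ⟨ψ, h1, h2, fun τ => ?_⟩
    have := h3 τ
    rwa [Nat.cast_zero, zero_add, div_one, one_mul] at this
  choose ψ hψ0 hψmem hψτ using hψ
  have hz : ∀ s, ∃ z : PosMat A, K • cuntzClass z ≤ cuntzClass a ∧
      ∀ (τ : NormalizedQuasitrace A) (I : ℕ),
        ∑ i ∈ Finset.range I, (τ.toFun a.size (ψ s i 1)).re ≤ K * τ.rank z := fun s =>
    exists_of_orthogonal_orderZero a.nonneg
      (fun i j hij => cfc_band_mul_cfc_band a.nonneg hM s hij)
      (fun i => her_cfc_band_subset a.nonneg hM s i) hK (hψ0 s) (hψmem s)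
  choose z hza hzτ using hz
  refine ⟨∑ s ∈ Finset.range M, cuntzClass (z s), ?_, fun τ => ?_⟩
  · rw [Finset.smul_sum]
    refine (Finset.sum_le_sum fun s _ => hza s).trans (le_of_eq ?_)
    rw [Finset.sum_const, Finset.card_range]
  · have key : ∀ I : ℕ, (M - 1) * τ.cut ((1 / 2) ^ (I * M)) a - M * ε ≤
        K * τ.rankHom (∑ s ∈ Finset.range M, cuntzClass (z s)) := fun I => by
      have hgeom : ∑ i ∈ Finset.range (I + 1), ε / 2 * (1 / 2 : ℝ) ^ i ≤ ε := by
        rw [← Finset.mul_sum]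
        have := (summable_geometric_of_lt_one (r := (1 : ℝ) / 2) (by norm_num)
          (by norm_num)).sum_le_tsum (Finset.range (I + 1)) fun _ _ => by positivity
        rw [tsum_geometric_two] at this
        nlinarith
      have h1 : ∀ s, ∑ i ∈ Finset.range (I + 1), (τ.toFun a.size (cfc (band M s i) a.val)).re - ε ≤
          K * τ.rank (z s) := fun s => by
        refine le_trans ?_ (hzτ s τ (I + 1))
        have := Finset.sum_le_sum fun i (_ : i ∈ Finset.range (I + 1)) => hψτ s i τ
        rw [Finset.sum_sub_distrib] at this
        linarith
      have h2 := Finset.sum_le_sum fun s (_ : s ∈ Finset.range M) => h1 s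
      rw [Finset.sum_sub_distrib, Finset.sum_const, Finset.card_range, nsmul_eq_mul,
        ← Finset.mul_sum] at h2
      rw [map_sum]
      simp only [τ.rankHom_cuntzClass]
      linarith [τ.le_sum_band a M I]
    have hIM : Filter.Tendsto (fun I => I * M) Filter.atTop Filter.atTop :=
      Filter.tendsto_atTop_mono (fun I => Nat.le_mul_of_pos_right I hM) Filter.tendsto_id
    have hlim := (((τ.tendsto_cut a).comp hIM).const_mul ((M : ℝ) - 1)).sub_const (M * ε)
    exact le_of_tendsto' hlim key

end Bands

/-! ### Simplicity -/

section Simple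

variable {A : Type*} [CStarAlgebra A] [PartialOrder A] [StarOrderedRing A]

/-- An element of `A`, as a `1 × 1` matrix. -/
def single (x : A) : Mat 1 A := Mat.of (Matrix.of fun _ _ => x)

lemma single_add (x y : A) : single (x + y) = single x + single y := rfl

lemma single_neg (x : A) : single (-x) = -single x := rfl

lemma single_zero : single (0 : A) = 0 := rfl

lemma single_mul (x y : A) : single (x * y) = single x * single y := by
  apply Mat.of.symm.injective
  ext i j
  change x * y = ((single x).entries * (single y).entries) i j
  rw [Matrix.mul_apply, Fin.sum_univ_one]
  rfl

lemma single_one : single (1 : A) = 1 := by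
  apply Mat.of.symm.injective
  ext i j
  rw [Subsingleton.elim i j]
  exact (Matrix.one_apply_eq (n := Fin 1) (α := A) j).symm

/-- The class of `x x⋆` in `W(A)`. -/
noncomputable def squareClass (x : A) : CuntzSemigroup A :=
  matClass (single x * star (single x)) (mul_star_self_nonneg _)

/-- `x x⋆` and `x⋆ x` have the same class. -/
lemma squareClass_eq (x : A) : squareClass x = matClass (star (single x) * single x)
    (star_mul_self_nonneg _) := by
  refine le_antisymm cuntzLE_mul_star ?_
  have := cuntzLE_mul_star (y := star (single x))
  simp only [star_star] at this
  exact this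

lemma squareClass_mul_left_le (r x : A) : squareClass (r * x) ≤ squareClass x := by
  refine CuntzLE.of_star_mul_mul _ _ (star (single r)) ?_
  rw [single_mul, star_mul, star_star]
  simp only [mul_assoc]

lemma squareClass_mul_right_le (x r : A) : squareClass (x * r) ≤ squareClass x := by
  rw [squareClass_eq, squareClass_eq]
  refine CuntzLE.of_star_mul_mul _ _ (single r) ?_
  rw [single_mul, star_mul]
  simp only [mul_assoc]

lemma squareClass_add_le (x y : A) : squareClass (x + y) ≤ squareClass x + squareClass y := by
  set X := single x
  set Y := single y
  have hX := mul_star_self_nonneg X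
  have hY := mul_star_self_nonneg Y
  have h2 : 0 ≤ X * star X + Y * star Y := add_nonneg hX hY
  have h3 : 0 ≤ (2 : ℝ) • (X * star X + Y * star Y) := smul_nonneg (by norm_num) h2
  calc squareClass (x + y) ≤ matClass ((2 : ℝ) • (X * star X + Y * star Y)) h3 := by
        refine CuntzLE.of_le _ h3 ?_
        rw [single_add, ← sub_nonneg]
        have : (2 : ℝ) • (X * star X + Y * star Y) - (X + Y) * star (X + Y) =
            (X - Y) * star (X - Y) := by
          rw [two_smul, star_add, star_sub]; noncomm_ring
        rw [this]
        exact mul_star_self_nonneg _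
    _ ≤ matClass _ h2 := CuntzLE.smul h2 (by norm_num) h3
    _ ≤ squareClass x + squareClass y := matClass_add_le hX hY h2

/-- The ideal of the elements `x` with `⟨x x⋆⟩ ≤ m c` for some `m`. -/
noncomputable def idealBelow (c : CuntzSemigroup A) : TwoSidedIdeal A :=
  TwoSidedIdeal.mk' {x | ∃ m : ℕ, squareClass x ≤ m • c}
    ⟨0, CuntzLE.of_val_eq_zero _ (by change single 0 * star (single 0) = 0; simp [single_zero])⟩
    (fun {x y} ⟨m, hm⟩ ⟨k, hk⟩ => ⟨m + k, by
      rw [add_nsmul]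
      exact (squareClass_add_le x y).trans (add_le_add hm hk)⟩)
    (fun {x} ⟨m, hm⟩ => ⟨m, by
      have : squareClass (-x) = squareClass x := by
        simp only [squareClass, single_neg, star_neg, neg_mul_neg]
      rwa [this]⟩)
    (fun {x y} ⟨m, hm⟩ => ⟨m, (squareClass_mul_left_le x y).trans hm⟩)
    (fun {x y} ⟨m, hm⟩ => ⟨m, (squareClass_mul_right_le x y).trans hm⟩)

lemma mem_idealBelow {c : CuntzSemigroup A} {x : A} :
    x ∈ idealBelow c ↔ ∃ m : ℕ, squareClass x ≤ m • c :=
  TwoSidedIdeal.mem_mk' ..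

/-- In a simple C⋆-algebra every nonzero ideal is everything, even if it is not closed: a dense
ideal contains an element close to `1`, which is invertible. -/
lemma IsSimple.one_mem (hA : IsSimple A) (I : TwoSidedIdeal A) {x : A} (hx : x ∈ I)
    (hx0 : x ≠ 0) : (1 : A) ∈ I := by
  let J : TwoSidedIdeal A := TwoSidedIdeal.mk' (closure (I : Set A))
    (subset_closure I.zero_mem)
    (fun {x y} hx hy => map_mem_closure₂ continuous_add hx hy fun _ ha _ hb => I.add_mem ha hb)
    (fun {x} hx => map_mem_closure continuous_neg hx fun _ ha => I.neg_mem ha)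
    (fun {x y} hy => map_mem_closure (continuous_const_mul x) hy fun _ ha => I.mul_mem_left _ _ ha)
    (fun {x y} hx => map_mem_closure (f := (· * y)) (continuous_mul_const y) hx fun _ ha =>
      I.mul_mem_right _ _ ha)
  have hJ : ∀ y, y ∈ J ↔ y ∈ closure (I : Set A) := fun y => TwoSidedIdeal.mem_mk' ..
  have hclosed : IsClosed (J : Set A) := by
    have : (J : Set A) = closure (I : Set A) := Set.ext hJ
    rw [this]
    exact isClosed_closure
  rcases hA.2 J hclosed with h | h
  · have : x ∈ J := (hJ x).mpr (subset_closure hx)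
    rw [h] at this
    exact absurd this hx0
  · have h1 : (1 : A) ∈ closure (I : Set A) := (hJ 1).mp (h ▸ trivial)
    obtain ⟨y, hy, hdist⟩ := Metric.mem_closure_iff.mp h1 1 one_pos
    rw [dist_eq_norm] at hdist
    have hu := isUnit_one_sub_of_norm_lt_one hdist
    rw [sub_sub_cancel] at hu
    obtain ⟨v, hv⟩ := hu.exists_left_inv
    exact hv ▸ I.mul_mem_left v y hy

lemma exists_diag_ne_zero {a : PosMat A} (ha : a.val ≠ 0) : ∃ i, a.val.entries i i ≠ 0 := by
  by_contra! h
  obtain ⟨c, hc⟩ := CStarAlgebra.nonneg_iff_eq_star_mul_self.mp a.nonneg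
  refine ha ?_
  have h0 : c = 0 := by
    apply Mat.of.symm.injective
    ext q i
    have h1 : (a.val.entries i i) = ∑ q, star (c.entries q i) * c.entries q i := by
      rw [hc]
      exact Matrix.mul_apply (M := c.entriesᴴ) (N := c.entries)
    rw [h i] at h1
    have h2 := (Finset.sum_eq_zero_iff_of_nonneg fun q _ =>
      star_mul_self_nonneg (c.entries q i)).mp h1.symm q (Finset.mem_univ q)
    exact (CStarRing.star_mul_self_eq_zero_iff _).mp h2
  rw [hc, h0, mul_zero]

/-- In a simple C⋆-algebra every nonzero element of `W(A)` is an order unit for the class of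
the unit. -/
lemma IsSimple.exists_one_le_nsmul (hA : IsSimple A) {a : PosMat A} (ha : a.val ≠ 0) :
    ∃ m : ℕ, matClass (1 : Mat 1 A) zero_le_one ≤ m • cuntzClass a := by
  obtain ⟨i, hi⟩ := exists_diag_ne_zero ha
  set x := a.val.entries i i
  have hconj : Mat.conj (Matrix.single i (0 : Fin 1) 1) a.val = single x := by
    apply Mat.of.symm.injective
    ext p q
    change ((Matrix.single i (0 : Fin 1) (1 : A))ᴴ * a.val.entries *
      Matrix.single i (0 : Fin 1) (1 : A)) p q = x
    rw [Subsingleton.elim p 0, Subsingleton.elim q 0, Matrix.mul_single_apply_same,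
      Matrix.conjTranspose_single, Matrix.single_mul_apply_same]
    simp [x]
  have hx : 0 ≤ single x := hconj ▸ Mat.conj_nonneg _ a.nonneg
  have hmem : x ∈ idealBelow (cuntzClass a) := by
    refine mem_idealBelow.mpr ⟨1, ?_⟩
    rw [one_nsmul]
    have h1 : squareClass x ≤ matClass (single x) hx := by
      obtain ⟨s, hs, hss⟩ : ∃ s : Mat 1 A, IsSelfAdjoint s ∧ s * s = single x :=
        ⟨CFC.sqrt _, IsSelfAdjoint.of_nonneg (CFC.sqrt_nonneg _), CFC.sqrt_mul_sqrt_self _⟩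
      refine CuntzLE.of_star_mul_mul _ _ s ?_
      rw [(IsSelfAdjoint.of_nonneg hx).star_eq, hs.star_eq, ← hss]
      simp only [mul_assoc]
    exact h1.trans (CuntzLE.of_conj (a := posMat (single x) hx) _ hconj)
  obtain ⟨m, hm⟩ := mem_idealBelow.mp (hA.one_mem _ hmem hi)
  refine ⟨m, le_trans (le_of_eq ?_) hm⟩
  simp only [squareClass, single_one, star_one, mul_one]

end Simple

/-! ### From tracial almost divisibility to almost divisibility -/

section Main

variable {A : Type*} [CStarAlgebra A] [PartialOrder A] [StarOrderedRing A]

lemma NormalizedQuasitrace.rankHom_one (τ : NormalizedQuasitrace A) :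
    τ.rankHom (matClass (1 : Mat 1 A) zero_le_one) = 1 := by
  have h1 : τ.eval (posMat (1 : Mat 1 A) zero_le_one) = 1 := by
    rw [NormalizedQuasitrace.eval, τ.normalized, Complex.one_re]
  refine le_antisymm (τ.rank_le fun δ _ => ?_) ?_
  · simpa using! τ.cut_le_size δ (posMat (1 : Mat 1 A) zero_le_one)
  · rw [← h1]
    exact τ.eval_le_rank ((CStarAlgebra.norm_le_one_iff_of_nonneg _ zero_le_one).mpr le_rfl)

/-- The ranks of a nonzero element of a simple C⋆-algebra are bounded away from `0`. -/
lemma IsSimple.exists_le_rank (hA : IsSimple A) {a : PosMat A} (ha : a.val ≠ 0) :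
    ∃ r : ℝ, 0 < r ∧ ∀ τ : NormalizedQuasitrace A, r ≤ τ.rank a := by
  obtain ⟨m, hm⟩ := hA.exists_one_le_nsmul ha
  refine ⟨1 / (m + 1), by positivity, fun τ => ?_⟩
  have h := τ.rankHom_mono hm
  rw [τ.rankHom_one, map_nsmul, nsmul_eq_mul, τ.rankHom_cuntzClass] at h
  rw [div_le_iff₀ (by positivity)]
  nlinarith [τ.rank_nonneg a]

/-- Under strong tracial comparison, tracial almost divisibility implies almost divisibility. -/
lemma IsSimple.isAlmostDivisible (hA : IsSimple A) (hc : HasStrongTracialComparison A 0)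
    (hd : IsTraciallyAlmostDivisible A 0) : IsAlmostDivisible A 0 := by
  intro a _ k _
  by_cases ha : a.val = 0
  · refine ⟨0, ?_, ?_⟩ <;> rw [nsmul_zero]
    swap
    · exact CuntzLE.of_val_eq_zero 0 ha
    exact CuntzLE.of_val_eq_zero (a := 0) _ rfl
  obtain ⟨r, hr, hra⟩ := hA.exists_le_rank ha
  have hk0 : (0 : ℝ) ≤ k := Nat.cast_nonneg k
  set ε : ℝ := r / (2 * (k + 1) * (k + 3)) with hε
  have hε0 : 0 < ε := by positivity
  -- `k M < K` and `(k + 1) (M - 1) = K + 1` for `M = k + 3` and `K = k M + 1`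
  obtain ⟨x, hx, hxτ⟩ := hd.exists_rank a (M := k + 3) (K := k * (k + 3) + 1) (by omega) (by omega)
    hε0
  rcases isEmpty_or_nonempty (NormalizedQuasitrace A) with hτ | hτ
  -- without quasitraces comparison is unconditional, and `⟨a⟩` absorbs its multiples
  · refine ⟨cuntzClass a, hc.le ha fun τ => hτ.elim τ, ?_⟩
    obtain ⟨b, hb⟩ := cuntzClass_surjective (k • cuntzClass a)
    rw [zero_add, mul_one, succ_nsmul', ← hb]
    exact PosMat.le_add_right a b
  have hup : ∀ τ : NormalizedQuasitrace A, τ.rankHom (k • x) < τ.rank a := fun τ => by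
    have h := τ.rankHom_mono hx
    rw [map_nsmul, map_nsmul, nsmul_eq_mul, nsmul_eq_mul, τ.rankHom_cuntzClass] at h
    push_cast at h
    rw [map_nsmul, nsmul_eq_mul]
    have h2 : (k : ℝ) * (k * (k + 3) + 1) * τ.rankHom x ≤ k * (k + 3) * τ.rank a := by nlinarith
    by_contra! h3
    have h4 := hra τ
    nlinarith [mul_le_mul_of_nonneg_left h3 (show (0 : ℝ) ≤ k * (k + 3) + 1 by positivity)]
  have hlow : ∀ τ : NormalizedQuasitrace A, τ.rankHom (cuntzClass a) <
      τ.rankHom (((k + 1) * (0 + 1)) • x) := fun τ => by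
    have h := hxτ τ
    push_cast at h
    rw [map_nsmul, nsmul_eq_mul, τ.rankHom_cuntzClass]
    push_cast
    -- `ε` is chosen so that the error is half of the lower bound `r` for the rank of `a`
    have h1 : (k + 1) * (k + 3) * ε = r / 2 := by rw [hε]; field_simp
    have h4 := hra τ
    have h5 := mul_le_mul_of_nonneg_left h (show (0 : ℝ) ≤ k + 1 by positivity)
    by_contra! h3
    have h6 := mul_le_mul_of_nonneg_left h3 (show (0 : ℝ) ≤ k * (k + 3) + 1 by positivity)
    nlinarith
  refine ⟨x, hc.le ha hup, ?_⟩
  obtain ⟨b, hb⟩ := cuntzClass_surjective (((k + 1) * (0 + 1)) • x)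
  rw [← hb] at hlow ⊢
  -- a class of positive rank is nonzero
  refine hc.le (fun hb0 => ?_) hlow
  obtain ⟨τ⟩ := hτ
  have h1 := τ.rankHom_mono (show cuntzClass b ≤ cuntzClass 0 from CuntzLE.of_val_eq_zero 0 hb0)
  have h2 := hlow τ
  simp only [τ.rankHom_cuntzClass] at h1 h2
  rw [τ.rank_zero] at h1
  linarith [τ.rank_nonneg a]

end Main

end PureCStar

theorem mainTheorem10 (A : Type*) [CStarAlgebra A] [PartialOrder A] [StarOrderedRing A]
    [TopologicalSpace.SeparableSpace A] (hA : PureCStar.IsSimple A) :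
    PureCStar.IsPure A ↔ PureCStar.IsTraciallyPure A :=
  ⟨fun h => ⟨h.1.hasStrongTracialComparison, h.2.isTraciallyAlmostDivisible⟩,
    fun h => ⟨h.1.hasComparison, hA.isAlmostDivisible h.1 h.2⟩⟩
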